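/- Let $B\subset\mathbb C$ be compact, let $R\subset(0,\infty)$ be unbounded, and for each $\rho\in R$ let $K_\rho:B\times B\to\mathbb C$ be a measurable Hermitian kernel. For each $\rho\in R$ let $\mathcal Z_\rho$ be a simple finite point process on $B$ that is determinantal with kernel $K_\rho$ with respect to Lebesgue measure: for all disjoint measurable $D_1,\dots,D_k\subset B$, $$\mathbf E\Big[\prod_{i=1}^k\#(D_i\cap\mathcal Z_\rho)\Big]=\int_{D_1\times\cdots\times D_k}\det\big(K_\rho(x_i,x_j)\big)_{1\le i,j\le k}\,dx_1\cdots dx_k ,$$ both sides being finite. Write $X_\rho(f)=\sum_{z\in\mathcal Z_\rho}f(z)$, and let $\mathrm{Cov}_\rho(f,g)$, $\mathrm{Var}_\rho(f)$ and $\mathrm{Cum}_\rho(f_1,\dots,f_k)$ be the covariance, variance and joint cumulant of $X_\rho(f),X_\rho(g)$, of $X_\rho(f)$, and of $X_\rho(f_1),\dots,X_\rho(f_k)$. A test function is a $C^3$ function $f:\mathbb C\to\mathbb R$ with compact support contained in the interior $B^\circ$. All limits are as $\rho\to\infty$ in $R$, and bounds with a constant $c$ are required for all large $\rho$. Assume: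 * (UB) $\sup_{x,y\in B}|K_\rho(x,y)|\le c\rho$. * ($L^1$B) $|K_\rho(x,y)|\le\varphi_\rho(x-y)$ for $x,y\in B$, with $\|\varphi_\rho\|_{L^1(\mathbb C)}\le c$. * (ID) the same $\varphi_\rho$ satisfies $\|\,|y|^3\varphi_\rho(y)\|_{L^1(\mathbb C)}=o(\rho^{-1})$. * (LLAP) for every compact $B_2\subset B^\circ$ and $p=0,1,2$, $$\sup_{x,z\in B_2}\Big|x^pK_\rho(x,z)-\int_BK_\rho(x,y)\,y^p\,K_\rho(y,z)\,dy\Big|\to0,\qquad \sup_{x,z\in B_2}\Big|K_\rho(x,z)\bar z^p-\int_BK_\rho(x,y)\,\bar y^p\,K_\rho(y,z)\,dy\Big|\to0 .$$ * (CO) $\mathrm{Cov}_\rho(\partial_z\partial_{\bar z}F,\,z\bar z)\to0$ for every test function $F$. Then: 1. For every $k\ge3$ and all test functions $f_1,\dots,f_k$, the mixed moments of $X_\rho(f_1),\dots,X_\rho(f_k)$ that enter the joint cumulant are finite for all large $\rho$, and $\mathrm{Cum}_\rho(f_1,\dots,f_k)\to0$. 2. For every test function $f$ the statistic $X_\rho(f)$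 is asymptotically normal with convergence of all moments, in the following sense. Put $\sigma_\rho^2=\mathrm{Var}_\rho(f)$ and $s_\rho=\max(1,\sigma_\rho)$, let $Y_\rho=(X_\rho(f)-\mathbf E X_\rho(f))/s_\rho$ and let $N_\rho$ be a centred normal variable with variance $\sigma_\rho^2/s_\rho^2$. Then $\mathbf E\,g(Y_\rho)-\mathbf E\,g(N_\rho)\to0$ for every bounded continuous $g:\mathbb R\to\mathbb R$, and for every integer $k\ge0$ the moment $\mathbf E Y_\rho^k$ is finite for all large $\rho$ and $\mathbf E Y_\rho^k-\mathbf E N_\rho^k\to0$. Moreover: * if $\liminf\sigma_\rho^2>0$, then $(X_\rho(f)-\mathbf E X_\rho(f))/\sigma_\rho$ converges to $N(0,1)$ in distribution and with all moments; * if $\sigma_\rho^2\to v\in[0,\infty)$, then $X_\rho(f)-\mathbf E X_\rho(f)$ converges to $N(0,v)$ in distribution and with all moments. -/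

import Mathlib

open MeasureTheory ProbabilityTheory Filter Topology
open scoped NNReal BoundedContinuousFunction

noncomputable section

namespace DetCLT

/-- The filter `ρ → ∞` on an index set `R` of real numbers. -/
def toInfty (R : Set ℝ) : Filter R := Filter.comap (fun ρ : R => (ρ : ℝ)) atTop

section PointConfigurations

variable {Ω : Type*} [MeasurableSpace Ω]

/-- The number of points of the random configuration `Z` that lie in `D`. -/
def pointCount (Z : Ω → Finset ℂ) (D : Set ℂ) (ω : Ω) : ℕ :=
  ((Z ω : Set ℂ) ∩ D).ncard

/-- The linear statistic `∑_{z ∈ Z} f z`. -/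
def linStat (Z : Ω → Finset ℂ) (f : ℂ → ℝ) (ω : Ω) : ℝ :=
  ∑ z ∈ Z ω, f z

/-- `Z` is a (simple, finite) point process on `B` under `P` which is determinantal with kernel `K`
with respect to Lebesgue measure: for disjoint measurable `D₁, …, D_k ⊆ B`,
`E ∏ #(D_i ∩ Z) = ∫_{D₁ × ⋯ × D_k} det (K (x_i, x_j)) dx`, both sides being finite. -/
structure IsDeterminantal (B : Set ℂ) (K : ℂ → ℂ → ℂ) (P : Measure Ω) (Z : Ω → Finset ℂ) :
    Prop where
  subset : ∀ ω, (Z ω : Set ℂ) ⊆ B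
  measurable_count : ∀ D : Set ℂ, MeasurableSet D → Measurable (pointCount Z D)
  intensity : ∀ (k : ℕ) (D : Fin k → Set ℂ), (∀ i, MeasurableSet (D i)) → (∀ i, D i ⊆ B) →
    Pairwise (fun i j => Disjoint (D i) (D j)) →
      Integrable (fun ω => ∏ i, (pointCount Z (D i) ω : ℝ)) P ∧
      IntegrableOn (fun x : Fin k → ℂ => (Matrix.of fun i j => K (x i) (x j)).det)
        (Set.univ.pi D) ∧
      ((∫ ω, ∏ i, (pointCount Z (D i) ω : ℝ) ∂P : ℝ) : ℂ) =
        ∫ x in Set.univ.pi D, (Matrix.of fun i j => K (x i) (x j)).det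

/-- The joint cumulant `Cum(X₁, …, X_k)` of real random variables, as the sum over all set
partitions `π` of the index set of `(-1)^(|π|-1) (|π|-1)! ∏_{S ∈ π} E ∏_{j ∈ S} X_j`. -/
def jointCumulant (P : Measure Ω) {k : ℕ} (X : Fin k → Ω → ℝ) : ℝ :=
  ∑ π : Finpartition (Finset.univ : Finset (Fin k)),
    (-1 : ℝ) ^ (π.parts.card - 1) * ((π.parts.card - 1).factorial : ℝ) *
      ∏ S ∈ π.parts, ∫ ω, ∏ j ∈ S, X j ω ∂P

end PointConfigurations

/-- `C³` test functions with (compact) support in the interior of `B`. -/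
def IsTestFunction (B : Set ℂ) (f : ℂ → ℝ) : Prop :=
  ContDiff ℝ 3 f ∧ HasCompactSupport f ∧ tsupport f ⊆ interior B

/-- `∂_z ∂_{z̄} F = (1/4) Δ F`. -/
def dzdzbar (F : ℂ → ℝ) (z : ℂ) : ℝ :=
  (1 / 4) * Laplacian.laplacian F z

section Conditions

variable {R : Set ℝ} (B : Set ℂ) (K : R → ℂ → ℂ → ℂ)

/-- The standing assumptions on the kernels: Hermitian symmetric and measurable on `B × B`. -/
def IsHermitianKernelFamily : Prop :=
  (∀ ρ, ∀ x ∈ B, ∀ y ∈ B, K ρ x y = star (K ρ y x)) ∧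
  ∀ ρ, Measurable (fun p : B × B => K ρ p.1 p.2)

/-- Uniform bound: `sup_{B × B} |K_ρ| ≤ c ρ`. -/
def UB : Prop :=
  ∃ c : ℝ, ∀ᶠ ρ in toInfty R, ∀ x ∈ B, ∀ y ∈ B, ‖K ρ x y‖ ≤ c * (ρ : ℝ)

/-- `L¹` bound: `|K_ρ(x, y)| ≤ φ_ρ(x - y)` on `B × B`, with `‖φ_ρ‖₁ ≤ c`. -/
def L1B (φ : R → ℂ → ℝ) : Prop :=
  ∃ c : ℝ, ∀ᶠ ρ in toInfty R,
    (∀ x ∈ B, ∀ y ∈ B, ‖K ρ x y‖ ≤ φ ρ (x - y)) ∧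
    Integrable (φ ρ) ∧ ∫ y, ‖φ ρ y‖ ≤ c

/-- Interaction decay: `‖ |y|³ φ_ρ ‖₁ = o(1/ρ)`. -/
def ID (φ : R → ℂ → ℝ) : Prop :=
  (∀ᶠ ρ in toInfty R, Integrable (fun y : ℂ => ‖y‖ ^ 3 * φ ρ y)) ∧
  (fun ρ : R => ∫ y : ℂ, ‖(‖y‖ ^ 3 * φ ρ y)‖) =o[toInfty R] (fun ρ : R => (ρ : ℝ)⁻¹)

/-- Limited local analytic projection: for every compact `B₂` in the interior of `B` and `p ≤ 2`,
uniformly over `x, z ∈ B₂`, `∫_B K_ρ(x, y) y^p K_ρ(y, z) dy = x^p K_ρ(x, z) + o(1)` and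
`∫_B K_ρ(x, y) ȳ^p K_ρ(y, z) dy = K_ρ(x, z) z̄^p + o(1)`. -/
def LLAP : Prop :=
  ∀ B₂ : Set ℂ, IsCompact B₂ → B₂ ⊆ interior B → ∀ p : ℕ, p ≤ 2 → ∀ ε : ℝ, 0 < ε →
    ∀ᶠ ρ in toInfty R, ∀ x ∈ B₂, ∀ z ∈ B₂,
      ‖x ^ p * K ρ x z - ∫ y in B, K ρ x y * y ^ p * K ρ y z‖ ≤ ε ∧
      ‖K ρ x z * (star z) ^ p - ∫ y in B, K ρ x y * (star y) ^ p * K ρ y z‖ ≤ ε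

variable {Ω : R → Type*} [∀ ρ, MeasurableSpace (Ω ρ)]

/-- Covariance condition: `Cov_ρ(∂_z ∂_{z̄} F, z z̄) = o(1)` for every `C³` test function `F`. -/
def CO (P : ∀ ρ, Measure (Ω ρ)) (Z : ∀ ρ, Ω ρ → Finset ℂ) : Prop :=
  ∀ F : ℂ → ℝ, IsTestFunction B F →
    Tendsto (fun ρ => cov[linStat (Z ρ) (dzdzbar F), linStat (Z ρ) Complex.normSq; P ρ])
      (toInfty R) (𝓝 0)

end Conditions

section Normality

variable {R : Set ℝ} {Ω : R → Type*} [∀ ρ, MeasurableSpace (Ω ρ)]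

/-- The random variables `Y_ρ` have finite moments (eventually, for each order) and, as `ρ → ∞`,
converge to the centred normal law of variance `v` in distribution and with all moments. -/
def TendsToNormalWithMoments (P : ∀ ρ, Measure (Ω ρ)) [∀ ρ, IsProbabilityMeasure (P ρ)]
    (Y : ∀ ρ, Ω ρ → ℝ) (v : ℝ≥0) : Prop :=
  TendstoInDistribution Y (toInfty R) (id : ℝ → ℝ) P (gaussianReal 0 v) ∧
  ∀ k : ℕ, (∀ᶠ ρ in toInfty R, Integrable (fun ω => Y ρ ω ^ k) (P ρ)) ∧
    Tendsto (fun ρ => ∫ ω, Y ρ ω ^ k ∂(P ρ)) (toInfty R) (𝓝 (∫ x, x ^ k ∂(gaussianReal 0 v)))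

/-- The laws of the random variables `Y_ρ` and the centred normal laws of variances `v_ρ`
become indistinguishable as `ρ → ∞`, in the weak sense and in all moments. -/
def IsAsymptoticToNormals (P : ∀ ρ, Measure (Ω ρ)) (Y : ∀ ρ, Ω ρ → ℝ) (v : R → ℝ≥0) : Prop :=
  (∀ g : ℝ →ᵇ ℝ, Tendsto (fun ρ => ∫ ω, g (Y ρ ω) ∂(P ρ) - ∫ x, g x ∂(gaussianReal 0 (v ρ)))
    (toInfty R) (𝓝 0)) ∧
  ∀ k : ℕ, (∀ᶠ ρ in toInfty R, Integrable (fun ω => Y ρ ω ^ k) (P ρ)) ∧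
    Tendsto (fun ρ => ∫ ω, Y ρ ω ^ k ∂(P ρ) - ∫ x, x ^ k ∂(gaussianReal 0 (v ρ)))
      (toInfty R) (𝓝 0)

end Normality

end DetCLT

end

/-! The moment generating function of a linear statistic of a determinantal process is a Fredholm
determinant, `E exp(t X(f)) = det(1 + (exp(t f) - 1) K)`, read here as an identity of formal power
series in `t`. Its logarithmic derivative is the trace of `f exp(t f) R` with `R = K (1 + (exp(t f)
- 1) K)⁻¹`, and the coefficient of `t ^ i` in that trace is the cumulant of order `i + 1` divided by
`i!` (`moment_sum_points`, `momentCoeff_succ`). So the rows of `R` are to be found approximately.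

Fix a base point `b`, write `h = y - b`, and replace functions of `y` by second order Taylor
polynomials in `h` and `h̄`. The cubic remainder costs the supremum of `|K|` times the third moment
of a row, that is `O(ρ) · o(1/ρ)`. By the local projection property, in `∫ K(b, y) p(y) K(y, z) dy`
the monomials `h` and `h²` give almost nothing, `h̄` and `h̄²` move to the endpoint `z`, and `h h̄`
gives the new kernel `N(b, z) = ∫ K(b, y) |y - b|² K(y, z) dy`. A further composition of `N` with a
function `e` and `K` only multiplies it by `e(b)`. Hence, up to `o(1)`, each coefficient of `R` is
of the form `K(b, z) (w₀ + w₂ h̄ + w₅ h̄²) + w₄ N(b, z)` with `h = z - b`, and the `w` obey a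
recursion in the algebra of 2-jets (`RowApprox.sandwich`).

That recursion is solved by generating functions (`rowApprox_resolventCoeff`): `w₀ = exp(-t f(b))`
and `w₄ = -t ∂∂̄f(b) exp(-t f(b))`, the terms `t² ∂f ∂̄f` having cancelled. On the diagonal the
powers of `h̄` vanish, so `f exp(t f) R` is `f K - t f ∂∂̄f N` up to `o(1)` in each coefficient: of
degree one in `t`. Therefore all cumulants of order at least three tend to zero
(`exists_norm_cumulantCoeff_le`), and joint cumulants follow by polarization
(`jointCumulant_polarization`).

Normality is the method of moments. With higher cumulants negligible, the moment–cumulant recursion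
drives the moments to those of a normal law with the same variance (`tendsto_sub_gaussMoment`).
Since the normalised variances are bounded, passing to subsequences reduces weak convergence to the
case of a fixed limiting variance, where convergence of moments yields convergence of characteristic
functions. -/

namespace DetCLT

/-! ### Cumulants as sums over set partitions, and their recursion -/

section SetCumulant

variable {α : Type*} [DecidableEq α]

/-- The cumulant of a set of indices, computed from a function giving the mixed moments. -/
noncomputable def setCumulant (M : Finset α → ℝ) (S : Finset α) : ℝ :=
  ∑ π : Finpartition S, (-1 : ℝ) ^ (π.parts.card - 1) * ((π.parts.card - 1).factorial : ℝ) *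
    ∏ T ∈ π.parts, M T

theorem Finpartition.parts_card_filter_notMem {S : Finset α} (π : Finpartition S) {a : α}
    (ha : a ∈ S) : (π.parts.filter (a ∉ ·)).card = π.parts.card - 1 := by
  have : π.parts.filter (a ∉ ·) = π.parts.erase (π.part a) := by
    ext T
    simp only [Finset.mem_filter, Finset.mem_erase, and_comm (a := T ≠ _)]
    refine and_congr_right fun hT => not_congr ?_
    rw [← π.part_eq_iff_mem hT, eq_comm]
  rw [this, Finset.card_erase_of_mem (π.part_mem.2 ha)]

/-- Adding a new block sets up a bijection between partitions of the proper subsets of `S` that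
contain `a` and partitions of `S` with a marked block that does not contain `a`. -/
theorem sum_ssubset_finpartition {S : Finset α} {a : α}
    (F : Finset (Finset α) → ℝ) :
    ∑ T ∈ S.ssubsets.filter (a ∈ ·), ∑ π : Finpartition T, F (insert (S \ T) π.parts) =
      ∑ π : Finpartition S, ∑ _b ∈ π.parts.filter (fun b => a ∈ S \ b), F π.parts := by
  rw [Finset.sum_sigma', Finset.sum_sigma']
  have key : ∀ x : (T : Finset α) × Finpartition T,
      x ∈ (S.ssubsets.filter (a ∈ ·)).sigma (fun _ => Finset.univ) →
        x.1 ⊆ S ∧ S \ x.1 ≠ ∅ ∧ a ∈ x.1 := by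
    intro x hx
    simp only [Finset.mem_sigma, Finset.mem_filter, Finset.mem_ssubsets, Finset.mem_univ,
      and_true] at hx
    exact ⟨hx.1.1, (Finset.sdiff_nonempty.2 hx.1.2).ne_empty, hx.2⟩
  have ext1 : ∀ x y : (T : Finset α) × Finpartition T, x.1 = y.1 → x.2.parts = y.2.parts →
      x = y := by
    rintro ⟨T, π⟩ ⟨T', π'⟩ h1 h2
    obtain rfl : T = T' := h1
    rw [show π = π' from Finpartition.ext h2]
  refine Finset.sum_bij (fun x hx => ⟨x.2.extend (b := S \ x.1) (key x hx).2.1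
      Finset.disjoint_sdiff (by
        show x.1 ∪ (S \ x.1) = S
        exact Finset.union_sdiff_of_subset (key x hx).1), S \ x.1⟩) ?_ ?_ ?_ ?_
  · intro x hx
    obtain ⟨h1, h2, h3⟩ := key x hx
    simp only [Finset.mem_sigma, Finset.mem_univ, true_and, Finset.mem_filter,
      Finpartition.extend_parts, Finset.mem_insert, true_or, Finset.mem_sdiff, not_and, not_not]
    exact ⟨h1 h3, fun _ => h3⟩
  · intro x hx y hy hxy
    obtain ⟨h1, h2, h3⟩ := key x hx
    obtain ⟨h1', h2', h3'⟩ := key y hy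
    simp only [Sigma.mk.injEq, heq_eq_eq] at hxy
    have hT : x.1 = y.1 := by
      rw [← Finset.sdiff_sdiff_eq_self h1, hxy.2, Finset.sdiff_sdiff_eq_self h1']
    refine ext1 x y hT ?_
    have hp := congrArg Finpartition.parts hxy.1
    simp only [Finpartition.extend_parts] at hp
    have hn : ∀ z : (T : Finset α) × Finpartition T, S \ z.1 ≠ ∅ → S \ z.1 ∉ z.2.parts := by
      intro z hz hmem
      obtain ⟨b, hb⟩ := Finset.nonempty_iff_ne_empty.2 hz
      exact (Finset.mem_sdiff.1 hb).2 (z.2.subset hmem hb)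
    rw [← Finset.erase_insert (hn x h2), hp, hxy.2, Finset.erase_insert (hn y h2')]
  · rintro ⟨π, b⟩ hb
    simp only [Finset.mem_sigma, Finset.mem_univ, true_and, Finset.mem_filter,
      Finset.mem_sdiff] at hb
    obtain ⟨hb, haS, hab⟩ := hb
    have hbS : b ⊆ S := π.subset hb
    have hbne : b ≠ ∅ := π.ne_empty hb
    have hsup : (π.parts.erase b).sup id = S \ b := by
      ext y
      simp only [Finset.mem_sup, Finset.mem_erase, id, Finset.mem_sdiff]
      constructor
      · rintro ⟨T, ⟨hTb, hT⟩, hy⟩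
        exact ⟨π.subset hT hy, fun hyb => hTb (π.eq_of_mem_parts hT hb hy hyb)⟩
      · rintro ⟨hyS, hyb⟩
        obtain ⟨T, hT, hy⟩ := π.exists_mem hyS
        exact ⟨T, ⟨fun h => hyb (h ▸ hy), hT⟩, hy⟩
    refine ⟨⟨S \ b, π.ofSubset (Finset.erase_subset b π.parts) hsup⟩, ?_, ?_⟩
    · simp only [Finset.mem_sigma, Finset.mem_filter, Finset.mem_ssubsets, Finset.mem_univ,
        and_true, Finset.mem_sdiff]
      refine ⟨Finset.sdiff_ssubset hbS (Finset.nonempty_iff_ne_empty.2 hbne), haS, hab⟩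
    · have hbb : S \ (S \ b) = b := Finset.sdiff_sdiff_eq_self hbS
      simp only [Sigma.mk.injEq, heq_eq_eq]
      refine ⟨?_, hbb⟩
      ext1
      simp only [Finpartition.extend_parts, Finpartition.ofSubset_parts, hbb,
        Finset.insert_erase hb]
  · intro x hx
    rfl

/-- By the bijection above, the terms with `T ≠ S` run over partitions of `S` with a marked block
avoiding `a`. A partition with `c ≥ 2` blocks has `c - 1` such marks, each of weight `(-1)^(c-2)
(c-2)!`; the total is minus its weight in `setCumulant M S`, so only the one-block partition
survives. -/
theorem setCumulant_recursion (M : Finset α → ℝ) (hM : M ∅ = 1) {S : Finset α} {a : α}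
    (ha : a ∈ S) :
    ∑ T ∈ S.powerset.filter (a ∈ ·), setCumulant M T * M (S \ T) = M S := by
  have hsplit : S.powerset.filter (a ∈ ·) = insert S (S.ssubsets.filter (a ∈ ·)) := by
    ext T
    simp only [Finset.mem_filter, Finset.mem_powerset, Finset.mem_insert, Finset.mem_ssubsets,
      Finset.ssubset_iff_subset_ne]
    constructor
    · rintro ⟨h1, h2⟩
      by_cases h : T = S
      · exact Or.inl h
      · exact Or.inr ⟨⟨h1, h⟩, h2⟩
    · rintro (rfl | ⟨⟨h1, -⟩, h2⟩)
      · exact ⟨subset_rfl, ha⟩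
      · exact ⟨h1, h2⟩
  rw [hsplit, Finset.sum_insert (by simp), Finset.sdiff_self, hM, mul_one]
  -- The weight is expressed through the number of blocks after `S \ T` has been added, hence `- 2`
  -- in place of `- 1`. Truncation of the subtraction is harmless: a single block carries no mark.
  have h1 : ∀ T ∈ S.ssubsets.filter (a ∈ ·), setCumulant M T * M (S \ T) =
      ∑ π : Finpartition T, (fun p : Finset (Finset α) => (-1 : ℝ) ^ (p.card - 2) *
        ((p.card - 2).factorial : ℝ) * ∏ U ∈ p, M U) (insert (S \ T) π.parts) := by
    intro T hT
    simp only [Finset.mem_filter, Finset.mem_ssubsets] at hT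
    rw [setCumulant, Finset.sum_mul]
    refine Finset.sum_congr rfl fun π _ => ?_
    have hn : S \ T ∉ π.parts := by
      intro hmem
      obtain ⟨b, hb⟩ := Finset.sdiff_nonempty.2 hT.1.2
      exact (Finset.mem_sdiff.1 hb).2 (π.subset hmem hb)
    simp only [Finset.card_insert_of_notMem hn, Finset.prod_insert hn]
    rw [show π.parts.card + 1 - 2 = π.parts.card - 1 by omega]
    ring
  rw [Finset.sum_congr rfl h1, sum_ssubset_finpartition (fun p : Finset (Finset α) =>
    (-1 : ℝ) ^ (p.card - 2) * ((p.card - 2).factorial : ℝ) * ∏ U ∈ p, M U), setCumulant, ← Finset.sum_add_distrib]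
  have hSne : S ≠ ∅ := Finset.ne_empty_of_mem ha
  rw [Finset.sum_eq_single (Finpartition.indiscrete (a := S) hSne)]
  · simp [Finpartition.indiscrete_parts]
  · intro π _ hπ
    have hfil : π.parts.filter (fun b => a ∈ S \ b) = π.parts.filter (a ∉ ·) := by
      ext b; simp [ha]
    rw [Finset.sum_const, hfil, Finpartition.parts_card_filter_notMem π ha]
    have hcard : 2 ≤ π.parts.card := by
      by_contra hlt
      have hpos : 0 < π.parts.card := Finset.card_pos.2 (π.parts_nonempty hSne)
      obtain ⟨T, hT⟩ := Finset.card_eq_one.1 (show π.parts.card = 1 by omega)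
      refine hπ (Finpartition.ext ?_)
      have := π.sup_parts
      rw [hT, Finset.sup_singleton] at this
      rw [hT, Finpartition.indiscrete_parts, ← this]
      rfl
    obtain ⟨p, hp⟩ := Nat.exists_eq_add_of_le hcard
    rw [hp, show 2 + p - 1 = p + 1 by omega, show 2 + p - 2 = p by omega, pow_succ,
      Nat.factorial_succ, nsmul_eq_mul]
    push_cast
    ring
  · intro h; exact absurd (Finset.mem_univ _) h

/-- If the mixed moments depend only on the number of factors, then so do the cumulants, and they
satisfy the usual recursion. -/
theorem setCumulant_eq_of_card (M : Finset α → ℝ) (m κ : ℕ → ℝ) (hM : ∀ S, M S = m S.card)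
    (hm : m 0 = 1)
    (hrec : ∀ k, m (k + 1) = ∑ i ∈ Finset.range (k + 1), (k.choose i : ℝ) * κ (i + 1) * m (k - i))
    (S : Finset α) (hS : S.Nonempty) : setCumulant M S = κ S.card := by
  induction S using Finset.strongInduction with
  | H S ih =>
    obtain ⟨a, ha⟩ := hS
    have h := setCumulant_recursion M (by simp [hM, hm]) ha
    obtain ⟨k, hk⟩ : ∃ k, S.card = k + 1 :=
      ⟨S.card - 1, by have := Finset.card_pos.2 ⟨a, ha⟩; omega⟩
    have hke : (S.erase a).card = k := by rw [Finset.card_erase_of_mem ha, hk]; rfl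
    have hsum : ∀ G : Finset α → ℝ, ∑ T ∈ S.powerset.filter (a ∈ ·), G T =
        ∑ T ∈ (S.erase a).powerset, G (insert a T) := by
      intro G
      symm
      refine Finset.sum_bij (fun T _ => insert a T) ?_ ?_ ?_ (fun _ _ => rfl)
      · intro T hT
        simp only [Finset.mem_powerset, Finset.mem_filter, Finset.mem_insert, true_or,
          and_true] at hT ⊢
        exact Finset.insert_subset ha (hT.trans (Finset.erase_subset _ _))
      · intro T hT T' hT' hTT'
        simp only [Finset.mem_powerset, Finset.subset_erase] at hT hT'
        rw [← Finset.erase_insert hT.2, hTT', Finset.erase_insert hT'.2]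
      · intro T hT
        simp only [Finset.mem_powerset, Finset.mem_filter] at hT
        exact ⟨T.erase a, Finset.mem_powerset.2 (Finset.erase_subset_erase a hT.1),
          Finset.insert_erase hT.2⟩
    have hG : ∀ T ∈ (S.erase a).powerset, insert a T ≠ S →
        setCumulant M (insert a T) * M (S \ insert a T) = κ (T.card + 1) * m (k - T.card) := by
      intro T hT hne
      simp only [Finset.mem_powerset] at hT
      have hT' := Finset.subset_erase.1 hT
      have hsub : insert a T ⊆ S := Finset.insert_subset ha hT'.1
      have hc : (insert a T).card = T.card + 1 := Finset.card_insert_of_notMem hT'.2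
      rw [ih _ (Finset.ssubset_iff_subset_ne.2 ⟨hsub, hne⟩) ⟨a, by simp⟩, hM,
        Finset.card_sdiff_of_subset hsub, hc, hk, Nat.add_sub_add_right]
    have hS' : insert a (S.erase a) = S := Finset.insert_erase ha
    rw [hsum] at h
    have hcount : ∑ T ∈ (S.erase a).powerset, κ (T.card + 1) * m (k - T.card) = m (k + 1) := by
      rw [Finset.sum_powerset_apply_card (fun j => κ (j + 1) * m (k - j)), hke, hrec]
      refine Finset.sum_congr rfl fun i _ => ?_
      rw [nsmul_eq_mul, mul_assoc]
    -- In both sums only the term of the full set escapes the induction hypothesis. The remaining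
    -- terms agree, so these two agree as well.
    have hmem : S.erase a ∈ (S.erase a).powerset := Finset.mem_powerset_self _
    rw [← Finset.add_sum_erase _ _ hmem] at h hcount
    have hrest : ∑ T ∈ (S.erase a).powerset.erase (S.erase a),
        setCumulant M (insert a T) * M (S \ insert a T) =
        ∑ T ∈ (S.erase a).powerset.erase (S.erase a), κ (T.card + 1) * m (k - T.card) := by
      refine Finset.sum_congr rfl fun T hT => hG T (Finset.mem_of_mem_erase hT) fun hEq => ?_
      refine (Finset.mem_erase.1 hT).1 ?_
      have hT' := Finset.subset_erase.1 (Finset.mem_powerset.1 (Finset.mem_of_mem_erase hT))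
      rw [← hEq, Finset.erase_insert hT'.2]
    rw [hrest, hS', Finset.sdiff_self] at h
    rw [hke, Nat.sub_self] at hcount
    rw [hM ∅, Finset.card_empty, hm, hM S, hk] at h
    rw [hm] at hcount
    rw [hk]
    linarith

end SetCumulant

/-! ### Multilinearity and polarization of joint cumulants -/

section Polarization

/-- Inclusion–exclusion: after multilinear expansion a map `r` occurs for every `s` that contains
its image, and the alternating sum over these `s` vanishes unless `r` is onto, hence a permutation.
-/
theorem sum_perm_eq_polarization {k : ℕ} {V : Type*} [AddCommGroup V] [Module ℝ V]
    (f : MultilinearMap ℝ (fun _ : Fin k => V) ℝ) (e : Fin k → V) :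
    ∑ s : Finset (Fin k), (-1 : ℝ) ^ sᶜ.card * f (fun _ => ∑ j ∈ s, e j) =
      ∑ σ : Equiv.Perm (Fin k), f (fun i => e (σ i)) := by
  have h1 : ∀ s : Finset (Fin k), f (fun _ => ∑ j ∈ s, e j) =
      ∑ r : Fin k → Fin k, if ∀ i, r i ∈ s then f (fun i => e (r i)) else 0 := by
    intro s
    rw [MultilinearMap.map_sum_finset f (fun _ j => e j) (fun _ => s), ← Finset.sum_filter]
    refine Finset.sum_congr ?_ fun _ _ => rfl
    ext r; simp [Fintype.mem_piFinset]
  simp_rw [h1, Finset.mul_sum]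
  rw [Finset.sum_comm]
  have h2 : ∀ r : Fin k → Fin k, ∑ s : Finset (Fin k), (-1 : ℝ) ^ sᶜ.card *
      (if ∀ i, r i ∈ s then f (fun i => e (r i)) else 0) =
      if Function.Bijective r then f (fun i => e (r i)) else 0 := by
    intro r
    have : ∑ s : Finset (Fin k), (-1 : ℝ) ^ sᶜ.card *
        (if ∀ i, r i ∈ s then f (fun i => e (r i)) else 0) =
        ∑ u : Finset (Fin k), (-1 : ℝ) ^ u.card *
        (if u ∈ (Finset.univ.image r)ᶜ.powerset then f (fun i => e (r i)) else 0) := by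
      refine Finset.sum_bij (fun s _ => sᶜ) (fun _ _ => Finset.mem_univ _)
        (fun _ _ _ _ h => compl_injective h) (fun u _ => ⟨uᶜ, Finset.mem_univ _, compl_compl u⟩) ?_
      intro s _
      congr 2
      rw [Finset.mem_powerset, Finset.compl_subset_compl]
      simp [Finset.subset_iff]
    rw [this]
    simp_rw [mul_ite, mul_zero]
    rw [← Finset.sum_filter, Finset.filter_mem_eq_inter, Finset.univ_inter, ← Finset.sum_mul]
    have h3 := Finset.sum_powerset_neg_one_pow_card (x := (Finset.univ.image r)ᶜ)
    have h4 : ∑ u ∈ (Finset.univ.image r)ᶜ.powerset, (-1 : ℝ) ^ u.card =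
        if (Finset.univ.image r)ᶜ = ∅ then 1 else 0 := by exact_mod_cast h3
    rw [h4]
    have h5 : (Finset.univ.image r)ᶜ = ∅ ↔ Function.Bijective r := by
      rw [Finset.compl_eq_empty_iff, ← Finite.surjective_iff_bijective, Finset.eq_univ_iff_forall]
      simp [Function.Surjective]
    simp [h5]
  rw [Finset.sum_congr rfl fun r _ => h2 r, ← Finset.sum_filter]
  symm
  refine Finset.sum_bij (fun σ _ => ⇑σ) ?_ ?_ ?_ (fun _ _ => rfl)
  · intro σ _; exact Finset.mem_filter.2 ⟨Finset.mem_univ _, σ.bijective⟩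
  · intro σ _ τ _ h; exact DFunLike.coe_injective h
  · intro r hr
    exact ⟨Equiv.ofBijective r (Finset.mem_filter.1 hr).2, Finset.mem_univ _, rfl⟩

variable {Ω : Type*} [MeasurableSpace Ω]

theorem jointCumulant_eq_setCumulant (P : Measure Ω) {k : ℕ} (X : Fin k → Ω → ℝ) :
    jointCumulant P X = setCumulant (fun S => ∫ ω, ∏ j ∈ S, X j ω ∂P) Finset.univ := rfl

theorem jointCumulant_comp_perm (P : Measure Ω) {k : ℕ} (X : Fin k → Ω → ℝ)
    (σ : Equiv.Perm (Fin k)) : jointCumulant P (fun i => X (σ i)) = jointCumulant P X := by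
  let e : Finset (Fin k) ≃o Finset (Fin k) :=
    { σ.finsetCongr with map_rel_iff' := by intro a b; simp }
  have he : ∀ S, e S = S.map σ.toEmbedding := fun S => rfl
  have heu : e Finset.univ = Finset.univ := by simp [he]
  let F : Finpartition (Finset.univ : Finset (Fin k)) → Finpartition (Finset.univ : Finset (Fin k)) :=
    fun π => (π.map e).copy heu
  have hF : Function.Injective F := by
    intro π π' h
    have := congrArg Finpartition.parts h
    simp only [F, Finpartition.copy_parts, Finpartition.parts_map] at this
    exact Finpartition.ext (Finset.map_injective _ this)
  have hFb : Function.Bijective F := Finite.injective_iff_bijective.1 hF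
  unfold jointCumulant
  refine Eq.trans ?_ (hFb.sum_comp _)
  refine Finset.sum_congr rfl fun π _ => ?_
  have hparts : (F π).parts = π.parts.map e.toEquiv.toEmbedding := rfl
  rw [hparts, Finset.card_map, Finset.prod_map]
  congr 1
  refine Finset.prod_congr rfl fun S _ => ?_
  refine integral_congr_ae (Eventually.of_forall fun ω => ?_)
  show ∏ j ∈ S, X (σ j) ω = ∏ j ∈ S.map σ.toEmbedding, X j ω
  rw [Finset.prod_map]
  rfl

/-- Slot `i` lies in exactly one block of `π`, so only one factor of the product depends on it, and
that factor is linear in it. -/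
theorem setIntegral_prod_update (P : Measure Ω) {k : ℕ} (Y : Fin k → Ω → ℝ) (U V : Ω → ℝ) (a b : ℝ)
    (i : Fin k) (π : Finpartition (Finset.univ : Finset (Fin k)))
    (hU : ∀ S : Finset (Fin k), Integrable (fun ω => ∏ j ∈ S, Function.update Y i U j ω) P)
    (hV : ∀ S : Finset (Fin k), Integrable (fun ω => ∏ j ∈ S, Function.update Y i V j ω) P) :
    ∏ S ∈ π.parts, ∫ ω, ∏ j ∈ S, Function.update Y i (fun ω => a * U ω + b * V ω) j ω ∂P =
      a * ∏ S ∈ π.parts, ∫ ω, ∏ j ∈ S, Function.update Y i U j ω ∂P +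
      b * ∏ S ∈ π.parts, ∫ ω, ∏ j ∈ S, Function.update Y i V j ω ∂P := by
  obtain ⟨S₀, hS₀, hi⟩ := π.exists_mem (Finset.mem_univ i)
  have hother : ∀ W : Ω → ℝ, ∏ S ∈ π.parts.erase S₀, ∫ ω, ∏ j ∈ S, Function.update Y i W j ω ∂P =
      ∏ S ∈ π.parts.erase S₀, ∫ ω, ∏ j ∈ S, Y j ω ∂P := by
    intro W
    refine Finset.prod_congr rfl fun S hS => ?_
    refine integral_congr_ae (Eventually.of_forall fun ω => Finset.prod_congr rfl fun j hj => ?_)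
    have : j ≠ i := by
      rintro rfl
      exact (Finset.mem_erase.1 hS).1 (π.eq_of_mem_parts (Finset.mem_erase.1 hS).2 hS₀ hj hi)
    rw [Function.update_of_ne this]
  have hpt : ∀ (W : Ω → ℝ) ω, ∏ j ∈ S₀, Function.update Y i W j ω =
      W ω * ∏ j ∈ S₀.erase i, Y j ω := by
    intro W ω
    rw [← Finset.mul_prod_erase _ _ hi, Function.update_self]
    congr 1
    refine Finset.prod_congr rfl fun j hj => ?_
    rw [Function.update_of_ne (Finset.mem_erase.1 hj).1]
  rw [← Finset.mul_prod_erase _ _ hS₀, ← Finset.mul_prod_erase _ _ hS₀,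
    ← Finset.mul_prod_erase _ _ hS₀, hother, hother, hother]
  have h1 := hU S₀
  have h2 := hV S₀
  simp_rw [hpt] at h1 h2 ⊢
  have : ∫ ω, (a * U ω + b * V ω) * ∏ j ∈ S₀.erase i, Y j ω ∂P =
      a * (∫ ω, U ω * ∏ j ∈ S₀.erase i, Y j ω ∂P) +
      b * (∫ ω, V ω * ∏ j ∈ S₀.erase i, Y j ω ∂P) := by
    rw [← integral_const_mul, ← integral_const_mul, ← integral_add (h1.const_mul a) (h2.const_mul b)]
    refine integral_congr_ae (Eventually.of_forall fun ω => ?_)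
    simp only
    ring
  rw [this]
  ring

/-- The joint cumulant of linear combinations, as a multilinear form in the coefficients. -/
noncomputable def cumulantForm (P : Measure Ω) {k : ℕ} (X : Fin k → Ω → ℝ)
    (hX : ∀ (c : Fin k → Fin k → ℝ) (S : Finset (Fin k)),
      Integrable (fun ω => ∏ i ∈ S, ∑ j, c i j * X j ω) P) :
    MultilinearMap ℝ (fun _ : Fin k => Fin k → ℝ) ℝ :=
  have key : ∀ (c : Fin k → Fin k → ℝ) (i : Fin k) (u v : Fin k → ℝ) (a b : ℝ),
      jointCumulant P (fun l ω => ∑ j, Function.update c i (a • u + b • v) l j * X j ω) =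
        a * jointCumulant P (fun l ω => ∑ j, Function.update c i u l j * X j ω) +
        b * jointCumulant P (fun l ω => ∑ j, Function.update c i v l j * X j ω) := by
    intro c i u v a b
    have hup : ∀ w : Fin k → ℝ, (fun l ω => ∑ j, Function.update c i w l j * X j ω) =
        Function.update (fun l ω => ∑ j, c l j * X j ω) i (fun ω => ∑ j, w j * X j ω) := by
      intro w
      ext l ω
      by_cases h : l = i
      · subst h; simp
      · simp [Function.update_of_ne h]
    have hint : ∀ (w : Fin k → ℝ) (S : Finset (Fin k)), Integrable (fun ω => ∏ j ∈ S,
        Function.update (fun l ω => ∑ j, c l j * X j ω) i (fun ω => ∑ j, w j * X j ω) j ω) P := by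
      intro w S
      rw [← hup]
      exact hX _ S
    have hlin : (fun ω => ∑ j, (a • u + b • v) j * X j ω) =
        fun ω => a * (∑ j, u j * X j ω) + b * (∑ j, v j * X j ω) := by
      ext ω
      rw [Finset.mul_sum, Finset.mul_sum, ← Finset.sum_add_distrib]
      refine Finset.sum_congr rfl fun j _ => ?_
      simp only [Pi.add_apply, Pi.smul_apply, smul_eq_mul]
      ring
    rw [hup, hup, hup, hlin, jointCumulant, jointCumulant, jointCumulant, Finset.mul_sum,
      Finset.mul_sum, ← Finset.sum_add_distrib]
    refine Finset.sum_congr rfl fun π _ => ?_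
    have := setIntegral_prod_update P (fun l ω => ∑ j, c l j * X j ω) (fun ω => ∑ j, u j * X j ω)
      (fun ω => ∑ j, v j * X j ω) a b i π (hint u) (hint v)
    convert congrArg (fun x => (-1 : ℝ) ^ (π.parts.card - 1) *
      ((π.parts.card - 1).factorial : ℝ) * x) this using 1
    ring
  { toFun := fun c => jointCumulant P (fun i ω => ∑ j, c i j * X j ω)
    map_update_add' := by
      intro inst c i u v
      obtain rfl : inst = instDecidableEqFin k := Subsingleton.elim _ _
      simpa using key c i u v 1 1
    map_update_smul' := by
      intro inst c i a u
      obtain rfl : inst = instDecidableEqFin k := Subsingleton.elim _ _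
      simpa using key c i u 0 a 0 }

theorem cumulantForm_apply (P : Measure Ω) {k : ℕ} (X : Fin k → Ω → ℝ)
    (hX : ∀ (c : Fin k → Fin k → ℝ) (S : Finset (Fin k)),
      Integrable (fun ω => ∏ i ∈ S, ∑ j, c i j * X j ω) P) (c : Fin k → Fin k → ℝ) :
    cumulantForm P X hX c = jointCumulant P (fun i ω => ∑ j, c i j * X j ω) := rfl

/-- The form lives on coefficient vectors because integrability of mixed moments is known for the
span of the `X j` only. Symmetry makes all `k!` permutation terms equal. -/
theorem jointCumulant_polarization (P : Measure Ω) {k : ℕ} (X : Fin k → Ω → ℝ)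
    (hX : ∀ (c : Fin k → Fin k → ℝ) (S : Finset (Fin k)),
      Integrable (fun ω => ∏ i ∈ S, ∑ j, c i j * X j ω) P) :
    (k.factorial : ℝ) * jointCumulant P X = ∑ s : Finset (Fin k), (-1 : ℝ) ^ sᶜ.card *
      jointCumulant P (fun (_ : Fin k) ω => ∑ j ∈ s, X j ω) := by
  have h := sum_perm_eq_polarization (cumulantForm P X hX) (fun j => Pi.single j 1)
  have h1 : ∀ σ : Equiv.Perm (Fin k),
      cumulantForm P X hX (fun i => Pi.single (σ i) 1) = jointCumulant P X := by
    intro σ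
    rw [← jointCumulant_comp_perm P X σ]
    rw [cumulantForm_apply]
    congr 1
    ext i ω
    simp [Pi.single_apply]
  have h2 : ∀ s : Finset (Fin k), cumulantForm P X hX (fun _ => ∑ j ∈ s, Pi.single j 1) =
      jointCumulant P (fun (_ : Fin k) ω => ∑ j ∈ s, X j ω) := by
    intro s
    rw [cumulantForm_apply]
    congr 1
    ext i ω
    simp [Finset.sum_apply, Pi.single_apply]
  simp_rw [h1, h2] at h
  rw [h, Finset.sum_const, Finset.card_univ, Fintype.card_perm, Fintype.card_fin, nsmul_eq_mul]

end Polarization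

end DetCLT

namespace DetCLT

/-! ### Calculus of bounded measurable functions -/

section BddMeas

variable {E F : Type*} [MeasurableSpace E] [MeasurableSpace F]

/-- Bounded measurable complex functions. -/
structure BddMeas (f : E → ℂ) : Prop where
  measurable : Measurable f
  bounded : ∃ C : ℝ, ∀ x, ‖f x‖ ≤ C

namespace BddMeas

theorem const (c : ℂ) : BddMeas (fun _ : E => c) := ⟨measurable_const, ‖c‖, fun _ => le_rfl⟩

theorem add {f g : E → ℂ} (hf : BddMeas f) (hg : BddMeas g) : BddMeas (fun x => f x + g x) := by
  obtain ⟨C, hC⟩ := hf.bounded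
  obtain ⟨D, hD⟩ := hg.bounded
  exact ⟨hf.measurable.add hg.measurable, C + D, fun x =>
    (norm_add_le _ _).trans (add_le_add (hC x) (hD x))⟩

theorem mul {f g : E → ℂ} (hf : BddMeas f) (hg : BddMeas g) : BddMeas (fun x => f x * g x) := by
  obtain ⟨C, hC⟩ := hf.bounded
  obtain ⟨D, hD⟩ := hg.bounded
  refine ⟨hf.measurable.mul hg.measurable, C * D, fun x => ?_⟩
  rw [norm_mul]
  exact mul_le_mul (hC x) (hD x) (norm_nonneg _) ((norm_nonneg _).trans (hC x))

theorem neg {f : E → ℂ} (hf : BddMeas f) : BddMeas (fun x => -f x) := by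
  simpa using (const (-1)).mul hf

theorem sum {ι : Type*} {s : Finset ι} {f : ι → E → ℂ} (hf : ∀ i ∈ s, BddMeas (f i)) :
    BddMeas (fun x => ∑ i ∈ s, f i x) := by
  classical
  induction s using Finset.induction with
  | empty => simpa using const 0
  | insert a s ha ih =>
    simp only [Finset.sum_insert ha]
    exact (hf a (by simp)).add (ih fun i hi => hf i (by simp [hi]))

theorem prod {ι : Type*} {s : Finset ι} {f : ι → E → ℂ} (hf : ∀ i ∈ s, BddMeas (f i)) :
    BddMeas (fun x => ∏ i ∈ s, f i x) := by
  classical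
  induction s using Finset.induction with
  | empty => simpa using const 1
  | insert a s ha ih =>
    simp only [Finset.prod_insert ha]
    exact (hf a (by simp)).mul (ih fun i hi => hf i (by simp [hi]))

theorem pow {f : E → ℂ} (hf : BddMeas f) (n : ℕ) : BddMeas (fun x => f x ^ n) := by
  simpa using prod (s := Finset.range n) (f := fun _ => f) fun _ _ => hf

theorem div_const {f : E → ℂ} (hf : BddMeas f) (c : ℂ) : BddMeas (fun x => f x / c) := by
  simpa [div_eq_mul_inv] using hf.mul (const c⁻¹)

theorem comp {f : E → ℂ} (hf : BddMeas f) {g : F → E} (hg : Measurable g) :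
    BddMeas (fun x => f (g x)) :=
  ⟨hf.measurable.comp hg, hf.bounded.choose, fun x => hf.bounded.choose_spec (g x)⟩

theorem integrable {f : E → ℂ} (hf : BddMeas f) (μ : Measure E) [IsFiniteMeasure μ] :
    Integrable f μ :=
  Integrable.of_bound hf.measurable.aestronglyMeasurable _
    (Eventually.of_forall hf.bounded.choose_spec)

theorem integral_right {f : E × F → ℂ} (hf : BddMeas f) (μ : Measure F) [IsFiniteMeasure μ] :
    BddMeas (fun x => ∫ y, f (x, y) ∂μ) := by
  obtain ⟨C, hC⟩ := hf.bounded
  refine ⟨(hf.measurable.stronglyMeasurable.integral_prod_right' (ν := μ)).measurable,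
    C * μ.real Set.univ, fun x => ?_⟩
  exact norm_integral_le_of_norm_le_const (Eventually.of_forall fun y => hC _)

theorem det {ι : Type*} [Fintype ι] [DecidableEq ι] {A : E → Matrix ι ι ℂ}
    (hA : ∀ i j, BddMeas (fun x => A x i j)) : BddMeas (fun x => (A x).det) := by
  simp_rw [Matrix.det_apply']
  exact sum fun σ _ => (const _).mul (prod fun i _ => hA _ _)

theorem norm_le {f : E → ℂ} (hf : BddMeas f) : ∃ C : ℝ, 0 ≤ C ∧ ∀ x, ‖f x‖ ≤ C := by
  obtain ⟨C, hC⟩ := hf.bounded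
  exact ⟨max C 0, le_max_right _ _, fun x => (hC x).trans (le_max_left _ _)⟩

end BddMeas

end BddMeas

/-! ### Formal Fredholm determinant, minors and resolvent -/

/-- Expansion of a determinant along the first column, with the minors written as determinants of
the lower right block in which one row is replaced by the first row. -/
theorem det_eq_sub_sum_det_updateRow {A : Type*} [CommRing A] {n : ℕ}
    (M : Matrix (Fin (n + 1)) (Fin (n + 1)) A) :
    M.det = M 0 0 * (M.submatrix Fin.succ Fin.succ).det -
      ∑ p : Fin n, M p.succ 0 * Matrix.det (Matrix.of fun i j : Fin n =>
        if i = p then M 0 j.succ else M i.succ j.succ) := by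
  -- Every permutation of `Fin (n + 1)` is one of the last `n` indices followed by the transposition
  -- of `0` and `p`. The choice `p = 0` gives the main term, any other `p` one change of sign.
  have h0 : M.det = ∑ p : Fin (n + 1), ∑ e : Equiv.Perm (Fin n),
      ((Equiv.Perm.sign (Equiv.Perm.decomposeFin.symm (p, e)) : ℤ) : A) *
        ∏ i, M (Equiv.Perm.decomposeFin.symm (p, e) i) i := by
    rw [Matrix.det_apply', Finset.univ_perm_fin_succ, Finset.sum_map, Fintype.sum_prod_type]
    rfl
  rw [h0, Fin.sum_univ_succ, sub_eq_add_neg, ← Finset.sum_neg_distrib]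
  congr 1
  · rw [Matrix.det_apply', Finset.mul_sum]
    refine Finset.sum_congr rfl fun e _ => ?_
    rw [Fin.prod_univ_succ]
    simp
    ring
  · refine Finset.sum_congr rfl fun p _ => ?_
    rw [Matrix.det_apply', Finset.mul_sum, ← Finset.sum_neg_distrib]
    refine Finset.sum_congr rfl fun e _ => ?_
    rw [Fin.prod_univ_succ, Equiv.Perm.decomposeFin.symm_sign]
    simp only [Fin.succ_ne_zero, if_false, Equiv.Perm.decomposeFin_symm_apply_zero,
      Equiv.Perm.decomposeFin_symm_apply_succ, Matrix.of_apply]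
    have : ∏ i : Fin n, M (Equiv.swap 0 p.succ (e i).succ) i.succ =
        ∏ i : Fin n, (if e i = p then M 0 i.succ else M (e i).succ i.succ) := by
      refine Finset.prod_congr rfl fun i _ => ?_
      split_ifs with h
      · rw [h, Equiv.swap_apply_right]
      · rw [Equiv.swap_apply_of_ne_of_ne (Fin.succ_ne_zero _) (by simpa using h)]
    rw [this]
    push_cast
    ring

section Fredholm

set_option linter.unusedSectionVars false

open PowerSeries (coeff)
open Finset.HasAntidiagonal (antidiagonal)

/-- The power series `e^{a t} - 1`. -/
noncomputable def expSubOne (a : ℂ) : PowerSeries ℂ :=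
  PowerSeries.rescale a (PowerSeries.exp ℂ) - 1

theorem coeff_zero_expSubOne (a : ℂ) : coeff 0 (expSubOne a) = 0 := by
  rw [expSubOne, map_sub, PowerSeries.coeff_rescale]
  simp

theorem coeff_rescale_exp (a : ℂ) (i : ℕ) :
    coeff i (PowerSeries.rescale a (PowerSeries.exp ℂ)) = a ^ i / i.factorial := by
  simp [PowerSeries.coeff_rescale, PowerSeries.coeff_exp, div_eq_mul_inv]

theorem coeff_succ_expSubOne (a : ℂ) (i : ℕ) :
    coeff (i + 1) (expSubOne a) = a ^ (i + 1) / (i + 1).factorial := by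
  rw [expSubOne, map_sub, coeff_rescale_exp, PowerSeries.coeff_one, if_neg (by omega), sub_zero]

theorem coeff_derivative_expSubOne (a : ℂ) (i : ℕ) :
    coeff i (PowerSeries.derivative ℂ (expSubOne a)) = a ^ (i + 1) / i.factorial := by
  rw [PowerSeries.coeff_derivative, coeff_succ_expSubOne, Nat.factorial_succ]
  have h1 : (i.factorial : ℂ) ≠ 0 := by exact_mod_cast i.factorial_ne_zero
  have h2 : (i + 1 : ℂ) ≠ 0 := by exact_mod_cast i.succ_ne_zero
  push_cast
  field_simp

theorem derivation_prod {R A : Type*} [CommRing R] [CommRing A] [Algebra R A]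
    (D : Derivation R A A) {n : ℕ} (f : Fin n → A) :
    D (∏ i, f i) = ∑ p, D (f p) * ∏ j ∈ {p}ᶜ, f j := by
  have key : ∀ s : Finset (Fin n), D (∏ i ∈ s, f i) = ∑ p ∈ s, D (f p) * ∏ j ∈ s.erase p, f j := by
    intro s
    induction s using Finset.induction with
    | empty => simp
    | insert a s ha ih =>
      rw [Finset.prod_insert ha, Derivation.leibniz, ih, Finset.sum_insert ha,
        Finset.erase_insert ha, smul_eq_mul, smul_eq_mul, Finset.mul_sum, add_comm, mul_comm]
      congr 1
      refine Finset.sum_congr rfl fun p hp => ?_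
      have hpa : p ≠ a := fun h => ha (h ▸ hp)
      rw [Finset.erase_insert_of_ne hpa.symm, Finset.prod_insert
        (fun h => ha (Finset.mem_of_mem_erase h))]
      ring
  rw [key]
  refine Finset.sum_congr rfl fun p _ => ?_
  rw [Finset.compl_singleton]

theorem sum_antidiagonal_assoc {M : Type*} [AddCommMonoid M] (k : ℕ) (F : ℕ → ℕ → ℕ → M) :
    ∑ p ∈ antidiagonal k, ∑ q ∈ antidiagonal p.2, F p.1 q.1 q.2 =
      ∑ p ∈ antidiagonal k, ∑ q ∈ antidiagonal p.1, F q.1 q.2 p.2 := by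
  rw [Finset.sum_sigma', Finset.sum_sigma']
  refine Finset.sum_bij' (fun x _ => ⟨(x.1.1 + x.2.1, x.2.2), (x.1.1, x.2.1)⟩)
    (fun x _ => ⟨(x.2.1, x.2.2 + x.1.2), (x.2.2, x.1.2)⟩) ?_ ?_ ?_ ?_ ?_
  · rintro ⟨⟨a, b⟩, ⟨c, d⟩⟩ h
    simp only [Finset.mem_sigma, Finset.HasAntidiagonal.mem_antidiagonal] at h ⊢
    obtain ⟨h1, h2⟩ := h
    exact ⟨by omega, trivial⟩
  · rintro ⟨⟨a, b⟩, ⟨c, d⟩⟩ h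
    simp only [Finset.mem_sigma, Finset.HasAntidiagonal.mem_antidiagonal] at h ⊢
    obtain ⟨h1, h2⟩ := h
    exact ⟨by omega, trivial⟩
  · rintro ⟨⟨a, b⟩, ⟨c, d⟩⟩ h
    simp only [Finset.mem_sigma, Finset.HasAntidiagonal.mem_antidiagonal] at h
    obtain ⟨h1, rfl⟩ := h
    rfl
  · rintro ⟨⟨a, b⟩, ⟨c, d⟩⟩ h
    simp only [Finset.mem_sigma, Finset.HasAntidiagonal.mem_antidiagonal] at h
    obtain ⟨h1, rfl⟩ := h
    rfl
  · intro x _; rfl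

variable {E : Type*} [MeasurableSpace E]

theorem integral_pi_eq_insertNth (μ : Measure E) [IsFiniteMeasure μ] {n : ℕ} (p : Fin (n + 1))
    {F : (Fin (n + 1) → E) → ℂ} (hF : BddMeas F) :
    ∫ x, F x ∂(Measure.pi fun _ => μ) =
      ∫ t, ∫ s, F (p.insertNth (α := fun _ => E) t s) ∂(Measure.pi fun _ => μ) ∂μ := by
  have h := (measurePreserving_piFinSuccAbove (fun _ : Fin (n + 1) => μ) p).symm
  rw [← h.integral_comp' F, integral_prod]
  · rfl
  · exact (hF.comp (MeasurableEquiv.measurable _)).integrable _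

variable (μ : Measure E) (K : E → E → ℂ) (g : E → ℂ)

/-- The coefficient of `t ^ k` in `∏ (e^{t g(x_i)} - 1)`. -/
noncomputable def expCoeff (n k : ℕ) (x : Fin n → E) : ℂ :=
  coeff k (∏ i, expSubOne (g (x i)))

/-- The coefficient of `t ^ k` in the integral of `∏ (e^{t g(x_i)} - 1)` against the `n`-point
intensity. -/
noncomputable def fredholmCoeff (n k : ℕ) : ℂ :=
  ∫ x, expCoeff g n k x * (Matrix.of fun i j => K (x i) (x j)).det ∂(Measure.pi fun _ : Fin n => μ)

/-- The coefficient of `t ^ k` in the `n`-th Fredholm minor. -/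
noncomputable def fredholmMinorCoeff (n k : ℕ) (x y : E) : ℂ :=
  ∫ s, expCoeff g n k s * (Matrix.of fun i j : Fin (n + 1) =>
    K (Fin.cons (α := fun _ => E) x s i) (Fin.cons (α := fun _ => E) y s j)).det
      ∂(Measure.pi fun _ : Fin n => μ)

/-- The coefficient of `t ^ k` in the kernel of `K (1 + (e^{t g} - 1) K)⁻¹`. -/
noncomputable def resolventCoeff : ℕ → E → E → ℂ
  | 0 => K
  | k + 1 => fun x y => -∑ i : Fin (k + 1),
      ∫ s, resolventCoeff i x s * coeff (k + 1 - i) (expSubOne (g s)) * K s y ∂μ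

variable {μ K g}

/-- The defining sum stops below `k + 1` to be well founded. The omitted term vanishes because
`exp(t g) - 1` has no constant coefficient, so the full Cauchy product `R = K - R (exp(t g) - 1) K`
is recovered. -/
theorem resolventCoeff_eq (k : ℕ) (x y : E) : resolventCoeff μ K g k x y =
    (if k = 0 then K x y else 0) - ∑ p ∈ antidiagonal k,
      ∫ s, resolventCoeff μ K g p.2 x s * coeff p.1 (expSubOne (g s)) * K s y ∂μ := by
  cases k with
  | zero => simp [resolventCoeff, coeff_zero_expSubOne]
  | succ k =>
    rw [← Finset.HasAntidiagonal.map_swap_antidiagonal, Finset.sum_map,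
      Finset.Nat.sum_antidiagonal_eq_sum_range_succ_mk, Finset.sum_range_succ]
    simp only [Function.Embedding.coeFn_mk, Prod.swap, tsub_self, coeff_zero_expSubOne, mul_zero,
      zero_mul, integral_zero, add_zero, Nat.add_eq_zero_iff, one_ne_zero, and_false, if_false,
      zero_sub]
    rw [resolventCoeff, Finset.sum_range]

theorem expCoeff_insertNth {n k : ℕ} (p : Fin (n + 1)) (t : E) (s : Fin n → E) :
    expCoeff g (n + 1) k (p.insertNth (α := fun _ => E) t s) =
      ∑ q ∈ antidiagonal k, coeff q.1 (expSubOne (g t)) * expCoeff g n q.2 s := by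
  simp only [expCoeff]
  rw [Fin.prod_univ_succAbove _ p, PowerSeries.coeff_mul]
  simp

/-- Each factor `exp(t g) - 1` is divisible by `t`. Hence finitely many `n` contribute to a given
power of `t`, and the Fredholm series raises no question of convergence. -/
theorem expCoeff_eq_zero {n k : ℕ} (h : k < n) (x : Fin n → E) : expCoeff g n k x = 0 := by
  induction n generalizing k with
  | zero => omega
  | succ n ih =>
    rw [show x = (0 : Fin (n + 1)).insertNth (α := fun _ => E) (x 0) (fun i => x i.succ) by
      simp [Fin.insertNth_zero']; exact (Fin.cons_self_tail x).symm, expCoeff_insertNth]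
    refine Finset.sum_eq_zero fun q hq => ?_
    rw [Finset.HasAntidiagonal.mem_antidiagonal] at hq
    rcases Nat.eq_zero_or_pos q.1 with h0 | h0
    · rw [h0, coeff_zero_expSubOne, zero_mul]
    · rw [ih (by omega), mul_zero]

theorem BddMeas.coeff_expSubOne (hg : BddMeas g) (i : ℕ) :
    BddMeas (fun x => coeff i (expSubOne (g x))) := by
  cases i with
  | zero => simpa [coeff_zero_expSubOne] using BddMeas.const 0
  | succ i => simpa only [coeff_succ_expSubOne] using (hg.pow _).div_const _

theorem BddMeas.coeff_prod_expSubOne (hg : BddMeas g) (n k : ℕ) (T : Finset (Fin n)) :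
    BddMeas (fun x : Fin n → E => coeff k (∏ i ∈ T, expSubOne (g (x i)))) := by
  simp_rw [PowerSeries.coeff_prod]
  exact sum fun l _ => prod fun i _ => (hg.coeff_expSubOne _).comp (measurable_pi_apply _)

theorem BddMeas.expCoeff (hg : BddMeas g) (n k : ℕ) : BddMeas (expCoeff g n k) :=
  hg.coeff_prod_expSubOne n k Finset.univ

theorem bddMeas_kernel (hK : BddMeas (Function.uncurry K)) {F : Type*} [MeasurableSpace F]
    {a b : F → E} (ha : Measurable a) (hb : Measurable b) : BddMeas (fun z => K (a z) (b z)) :=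
  hK.comp (ha.prodMk hb)

theorem measurable_cons_apply {F : Type*} [MeasurableSpace F] {n : ℕ} {a : F → E}
    {s : F → Fin n → E} (ha : Measurable a) (hs : Measurable s) (i : Fin (n + 1)) :
    Measurable (fun z => Fin.cons (α := fun _ => E) (a z) (s z) i) := by
  refine Fin.cases ?_ (fun j => ?_) i
  · simpa using ha
  · simp only [Fin.cons_succ]
    exact (measurable_pi_apply j).comp hs

theorem bddMeas_minor (hK : BddMeas (Function.uncurry K)) {F : Type*} [MeasurableSpace F] {n : ℕ}
    {a b : F → E} {s : F → Fin n → E} (ha : Measurable a) (hb : Measurable b) (hs : Measurable s) :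
    BddMeas (fun z => (Matrix.of fun i j : Fin (n + 1) => K (Fin.cons (α := fun _ => E) (a z) (s z) i)
      (Fin.cons (α := fun _ => E) (b z) (s z) j)).det) :=
  BddMeas.det fun i j => bddMeas_kernel hK (measurable_cons_apply ha hs i)
    (measurable_cons_apply hb hs j)

theorem bddMeas_det (hK : BddMeas (Function.uncurry K)) (n : ℕ) :
    BddMeas (fun x : Fin n → E => (Matrix.of fun i j => K (x i) (x j)).det) :=
  BddMeas.det fun i j => bddMeas_kernel hK (measurable_pi_apply i) (measurable_pi_apply j)

variable [IsFiniteMeasure μ]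

theorem bddMeas_fredholmMinorCoeff (hK : BddMeas (Function.uncurry K)) (hg : BddMeas g) (n k : ℕ) :
    BddMeas (fun z : E × E => fredholmMinorCoeff μ K g n k z.1 z.2) := by
  have : BddMeas (fun w : (E × E) × (Fin n → E) => expCoeff g n k w.2 *
      (Matrix.of fun i j : Fin (n + 1) => K (Fin.cons (α := fun _ => E) w.1.1 w.2 i)
        (Fin.cons (α := fun _ => E) w.1.2 w.2 j)).det) :=
    ((hg.expCoeff n k).comp measurable_snd).mul
      (bddMeas_minor hK (by fun_prop) (by fun_prop) (by fun_prop))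
  exact this.integral_right _

theorem bddMeas_resolventCoeff (hK : BddMeas (Function.uncurry K)) (hg : BddMeas g) (k : ℕ) :
    BddMeas (fun z : E × E => resolventCoeff μ K g k z.1 z.2) := by
  induction k using Nat.strong_induction_on with
  | _ k ih =>
    cases k with
    | zero => simp only [resolventCoeff]; exact hK
    | succ k =>
      simp only [resolventCoeff]
      refine BddMeas.neg (BddMeas.sum fun i _ => ?_)
      have : BddMeas (fun w : (E × E) × E => resolventCoeff μ K g i w.1.1 w.2 *
          coeff (k + 1 - i) (expSubOne (g w.2)) * K w.2 w.1.2) :=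
        (((ih i i.2).comp (g := fun w : (E × E) × E => (w.1.1, w.2)) (by fun_prop)).mul
          ((hg.coeff_expSubOne _).comp measurable_snd)).mul
          (bddMeas_kernel hK (by fun_prop) (by fun_prop))
      exact this.integral_right _

/-- Interchanging the first point with the `p`-th point. -/
theorem det_replace_row {n : ℕ} (p : Fin (n + 1)) (x t : E) (s : Fin n → E) :
    Matrix.det (Matrix.of fun i j : Fin (n + 1) =>
      K (if i = p then x else p.insertNth (α := fun _ => E) t s i)
        (p.insertNth (α := fun _ => E) t s j)) =
    Matrix.det (Matrix.of fun i j : Fin (n + 1) =>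
      K (Fin.cons (α := fun _ => E) x s i) (Fin.cons (α := fun _ => E) t s j)) := by
  let e : Fin (n + 1) ≃ Fin (n + 1) := (finSuccEquiv' p).trans (finSuccEquiv' 0).symm
  rw [← Matrix.det_submatrix_equiv_self e (Matrix.of fun i j : Fin (n + 1) =>
    K (Fin.cons (α := fun _ => E) x s i) (Fin.cons (α := fun _ => E) t s j))]
  congr 1
  ext i j
  simp only [Matrix.of_apply, Matrix.submatrix_apply]
  have he : ∀ (u : E) (j : Fin (n + 1)), Fin.cons (α := fun _ => E) u s (e j) =
      if j = p then u else p.insertNth (α := fun _ => E) t s j := by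
    intro u j
    refine Fin.succAboveCases p ?_ (fun l => ?_) j
    · simp [e]
    · simp [e, Fin.succAbove_ne]
  rw [he, he]
  congr 1
  split_ifs with h
  · subst h; simp
  · rfl

/-- Fredholm's recursion: the bordered determinant is expanded along its first column, and after
integration the `n + 1` minors contribute equally by symmetry in the points. -/
theorem fredholmMinorCoeff_succ (hK : BddMeas (Function.uncurry K)) (hg : BddMeas g) (n k : ℕ)
    (x y : E) : fredholmMinorCoeff μ K g (n + 1) k x y = K x y * fredholmCoeff μ K g (n + 1) k -
      (n + 1) * ∑ q ∈ antidiagonal k, ∫ s, fredholmMinorCoeff μ K g n q.2 x s *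
        coeff q.1 (expSubOne (g s)) * K s y ∂μ := by
  have hrow : ∀ p : Fin (n + 1), BddMeas (fun s : Fin (n + 1) → E => expCoeff g (n + 1) k s *
      (K (s p) y * Matrix.det (Matrix.of fun i j : Fin (n + 1) =>
        K (if i = p then x else s i) (s j)))) := fun p =>
    (hg.expCoeff _ _).mul ((bddMeas_kernel hK (by fun_prop) (by fun_prop)).mul
      (BddMeas.det fun i j => bddMeas_kernel hK (by split_ifs <;> fun_prop) (by fun_prop)))
  have hexp : ∀ s : Fin (n + 1) → E, expCoeff g (n + 1) k s *
      (Matrix.of fun i j : Fin (n + 1 + 1) => K (Fin.cons (α := fun _ => E) x s i)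
        (Fin.cons (α := fun _ => E) y s j)).det =
      K x y * (expCoeff g (n + 1) k s * (Matrix.of fun i j => K (s i) (s j)).det) -
      ∑ p : Fin (n + 1), expCoeff g (n + 1) k s *
      (K (s p) y * Matrix.det (Matrix.of fun i j : Fin (n + 1) =>
        K (if i = p then x else s i) (s j))) := by
    intro s
    rw [det_eq_sub_sum_det_updateRow, mul_sub, ← Finset.mul_sum]
    have h1 : (Matrix.of fun i j : Fin (n + 1 + 1) => K (Fin.cons (α := fun _ => E) x s i)
        (Fin.cons (α := fun _ => E) y s j)).submatrix Fin.succ Fin.succ =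
        Matrix.of fun i j => K (s i) (s j) := by ext i j; simp
    rw [h1]
    congr 1
    · simp only [Matrix.of_apply, Fin.cons_zero]; ring
    · congr 1
      refine Finset.sum_congr rfl fun p _ => ?_
      simp only [Matrix.of_apply, Fin.cons_zero, Fin.cons_succ]
      congr 3
      ext i j
      split_ifs <;> rfl
  rw [fredholmMinorCoeff]
  simp_rw [hexp]
  rw [integral_sub ((((hg.expCoeff _ _).mul (bddMeas_det hK _)).integrable _).const_mul _)
    ((BddMeas.sum fun p _ => hrow p).integrable _), integral_const_mul,
    integral_finsetSum _ fun p _ => (hrow p).integrable _]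
  congr 1
  -- Splitting off the `p`-th point `t` and relabelling the others leaves the minor with row point
  -- `x` and column point `t`, whatever `p` is.
  have hp : ∀ p : Fin (n + 1), ∫ s, expCoeff g (n + 1) k s *
      (K (s p) y * Matrix.det (Matrix.of fun i j : Fin (n + 1) =>
        K (if i = p then x else s i) (s j))) ∂(Measure.pi fun _ => μ) =
      ∑ q ∈ antidiagonal k, ∫ s, fredholmMinorCoeff μ K g n q.2 x s *
        coeff q.1 (expSubOne (g s)) * K s y ∂μ := by
    intro p
    rw [integral_pi_eq_insertNth μ p (hrow p)]
    simp_rw [expCoeff_insertNth, det_replace_row, Fin.insertNth_apply_same, Finset.sum_mul]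
    rw [← integral_finsetSum]
    · refine integral_congr_ae (Eventually.of_forall fun t => ?_)
      simp only
      rw [integral_finsetSum]
      · refine Finset.sum_congr rfl fun q _ => ?_
        rw [fredholmMinorCoeff, mul_assoc, ← integral_mul_const]
        refine integral_congr_ae (Eventually.of_forall fun s => ?_)
        simp only
        ring
      · intro q _
        exact (((BddMeas.const _).mul (hg.expCoeff _ _)).mul ((BddMeas.const _).mul
          (bddMeas_minor hK measurable_const measurable_const measurable_id))).integrable _
    · intro q _
      exact ((((bddMeas_fredholmMinorCoeff hK hg n q.2).comp
        (g := fun s => (x, s)) (by fun_prop)).mul (hg.coeff_expSubOne _)).mul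
        (bddMeas_kernel hK (by fun_prop) (by fun_prop))).integrable _
  simp_rw [hp]
  simp

/-- The derivative in `t` hits one of the `n + 1` factors. By symmetry each choice gives the same,
and the point that is hit becomes the diagonal argument of a minor. -/
theorem succ_mul_fredholmCoeff (hK : BddMeas (Function.uncurry K)) (hg : BddMeas g) (n k : ℕ) :
    ((k : ℂ) + 1) * fredholmCoeff μ K g (n + 1) (k + 1) =
      (n + 1) * ∑ q ∈ antidiagonal k, ∫ t, g t ^ (q.1 + 1) / q.1.factorial *
        fredholmMinorCoeff μ K g n q.2 t t ∂μ := by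
  have hder : ∀ i, BddMeas (fun t => coeff i (PowerSeries.derivative ℂ (expSubOne (g t)))) := by
    intro i
    simp_rw [coeff_derivative_expSubOne]
    exact (hg.pow _).div_const _
  have hterm : ∀ p : Fin (n + 1), BddMeas (fun s : Fin (n + 1) → E =>
      coeff k (PowerSeries.derivative ℂ (expSubOne (g (s p))) *
        ∏ j ∈ {p}ᶜ, expSubOne (g (s j))) * (Matrix.of fun i j => K (s i) (s j)).det) := by
    intro p
    refine BddMeas.mul ?_ (bddMeas_det hK _)
    simp_rw [PowerSeries.coeff_mul]
    exact BddMeas.sum fun q _ => ((hder q.1).comp (by fun_prop)).mul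
      (hg.coeff_prod_expSubOne _ _ _)
  have hexp : ∀ s : Fin (n + 1) → E, ((k : ℂ) + 1) * (expCoeff g (n + 1) (k + 1) s *
      (Matrix.of fun i j => K (s i) (s j)).det) = ∑ p : Fin (n + 1),
      coeff k (PowerSeries.derivative ℂ (expSubOne (g (s p))) *
        ∏ j ∈ {p}ᶜ, expSubOne (g (s j))) * (Matrix.of fun i j => K (s i) (s j)).det := by
    intro s
    rw [← Finset.sum_mul, ← map_sum, ← derivation_prod, PowerSeries.coeff_derivative, expCoeff]
    ring
  rw [fredholmCoeff, ← integral_const_mul]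
  simp_rw [hexp]
  rw [integral_finsetSum _ fun p _ => (hterm p).integrable _]
  have hp : ∀ p : Fin (n + 1), ∫ s, coeff k (PowerSeries.derivative ℂ (expSubOne (g (s p))) *
        ∏ j ∈ {p}ᶜ, expSubOne (g (s j))) * (Matrix.of fun i j => K (s i) (s j)).det
        ∂(Measure.pi fun _ => μ) =
      ∑ q ∈ antidiagonal k, ∫ t, g t ^ (q.1 + 1) / q.1.factorial *
        fredholmMinorCoeff μ K g n q.2 t t ∂μ := by
    intro p
    rw [integral_pi_eq_insertNth μ p (hterm p)]
    have hdet : ∀ t s, (Matrix.of fun i j => K (p.insertNth (α := fun _ => E) t s i)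
        (p.insertNth (α := fun _ => E) t s j)).det = (Matrix.of fun i j : Fin (n + 1) =>
        K (Fin.cons (α := fun _ => E) t s i) (Fin.cons (α := fun _ => E) t s j)).det := by
      intro t s
      rw [← det_replace_row p]
      congr 1
      ext i j
      simp only [Matrix.of_apply]
      split_ifs with h
      · subst h; simp
      · rfl
    have hprod : ∀ t s, ∏ j ∈ {p}ᶜ, expSubOne (g (p.insertNth (α := fun _ => E) t s j)) =
        ∏ j, expSubOne (g (s j)) := by
      intro t s
      rw [← Fin.image_succAbove_univ, Finset.prod_image fun a _ b _ h =>
        Fin.succAbove_right_injective h]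
      simp
    simp_rw [hprod, hdet, Fin.insertNth_apply_same, PowerSeries.coeff_mul, Finset.sum_mul,
      coeff_derivative_expSubOne]
    rw [← integral_finsetSum]
    · refine integral_congr_ae (Eventually.of_forall fun t => ?_)
      simp only
      rw [integral_finsetSum]
      · refine Finset.sum_congr rfl fun q _ => ?_
        rw [fredholmMinorCoeff, ← integral_const_mul]
        refine integral_congr_ae (Eventually.of_forall fun s => ?_)
        simp only [expCoeff]
        ring
      · intro q _
        exact (((BddMeas.const _).mul (hg.expCoeff _ _)).mul
          (bddMeas_minor hK measurable_const measurable_const measurable_id)).integrable _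
    · intro q _
      exact (((hg.pow _).div_const _).mul ((bddMeas_fredholmMinorCoeff hK hg n q.2).comp
        (g := fun s => (s, s)) (by fun_prop))).integrable _
  simp_rw [hp]
  simp

variable (μ K g)

/-- The coefficient of `t ^ k` in the Fredholm determinant of `1 + (e^{t g} - 1) K`. -/
noncomputable def momentCoeff (k : ℕ) : ℂ :=
  ∑ n ∈ Finset.range (k + 1), fredholmCoeff μ K g n k / n.factorial

noncomputable def minorCoeff (k : ℕ) (x y : E) : ℂ :=
  ∑ n ∈ Finset.range (k + 1), fredholmMinorCoeff μ K g n k x y / n.factorial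

/-- The coefficient of `t ^ i` in the derivative of the cumulant generating function. -/
noncomputable def cumulantCoeff (i : ℕ) : ℂ :=
  ∑ q ∈ antidiagonal i,
    ∫ t, g t ^ (q.1 + 1) / q.1.factorial * resolventCoeff μ K g q.2 t t ∂μ

variable {μ K g}

theorem minorCoeff_eq_sum (k N : ℕ) (h : k < N) (x y : E) : minorCoeff μ K g k x y =
    ∑ n ∈ Finset.range N, fredholmMinorCoeff μ K g n k x y / n.factorial := by
  refine Finset.sum_subset (Finset.range_mono h) fun n _ hn => ?_
  rw [Finset.mem_range, not_lt] at hn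
  simp [fredholmMinorCoeff, expCoeff_eq_zero (show k < n by omega)]

theorem minorCoeff_eq (hK : BddMeas (Function.uncurry K)) (hg : BddMeas g) (k : ℕ) (x y : E) :
    minorCoeff μ K g k x y = K x y * momentCoeff μ K g k - ∑ q ∈ antidiagonal k,
      ∫ s, minorCoeff μ K g q.2 x s * coeff q.1 (expSubOne (g s)) * K s y ∂μ := by
  have h1 : ∀ n, fredholmMinorCoeff μ K g (n + 1) k x y / (n + 1).factorial =
      K x y * (fredholmCoeff μ K g (n + 1) k / (n + 1).factorial) -
      ∑ q ∈ antidiagonal k, ∫ s, (fredholmMinorCoeff μ K g n q.2 x s / n.factorial) *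
        coeff q.1 (expSubOne (g s)) * K s y ∂μ := by
    intro n
    have h2 : ∀ q : ℕ × ℕ, ∫ s, (fredholmMinorCoeff μ K g n q.2 x s / n.factorial) *
        coeff q.1 (expSubOne (g s)) * K s y ∂μ = (n.factorial : ℂ)⁻¹ *
        ∫ s, fredholmMinorCoeff μ K g n q.2 x s * coeff q.1 (expSubOne (g s)) * K s y ∂μ := by
      intro q
      rw [← integral_const_mul]
      refine integral_congr_ae (Eventually.of_forall fun s => ?_)
      simp only
      ring
    simp_rw [h2]
    rw [fredholmMinorCoeff_succ hK hg, ← Finset.mul_sum, Nat.factorial_succ]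
    have h3 : (n.factorial : ℂ) ≠ 0 := by exact_mod_cast n.factorial_ne_zero
    have h4 : (n + 1 : ℂ) ≠ 0 := by exact_mod_cast n.succ_ne_zero
    push_cast
    field_simp
  have h0 : fredholmMinorCoeff μ K g 0 k x y = K x y * fredholmCoeff μ K g 0 k := by
    simp [fredholmMinorCoeff, fredholmCoeff, mul_comm, integral_const_mul]
  rw [minorCoeff, Finset.sum_range_succ', momentCoeff, Finset.sum_range_succ', mul_add,
    Finset.mul_sum]
  simp_rw [h1, Finset.sum_sub_distrib, h0]
  rw [Finset.sum_comm]
  -- Shifting the number of points leaves only `k` summands. Nothing is lost: terms with `q.1 = 0`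
  -- vanish, and otherwise `q.2 < k`.
  have h5 : ∀ q ∈ antidiagonal k, ∑ n ∈ Finset.range k,
      ∫ s, (fredholmMinorCoeff μ K g n q.2 x s / n.factorial) *
        coeff q.1 (expSubOne (g s)) * K s y ∂μ =
      ∫ s, minorCoeff μ K g q.2 x s * coeff q.1 (expSubOne (g s)) * K s y ∂μ := by
    intro q hq
    rw [Finset.HasAntidiagonal.mem_antidiagonal] at hq
    rcases Nat.eq_zero_or_pos q.1 with h | h
    · simp [h, coeff_zero_expSubOne]
    · rw [← integral_finsetSum]
      · refine integral_congr_ae (Eventually.of_forall fun s => ?_)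
        simp only
        rw [minorCoeff_eq_sum q.2 k (by omega), Finset.sum_mul, Finset.sum_mul]
      · intro n _
        exact (((((bddMeas_fredholmMinorCoeff hK hg n q.2).comp
          (g := fun s => (x, s)) (by fun_prop)).div_const _).mul (hg.coeff_expSubOne _)).mul
          (bddMeas_kernel hK (by fun_prop) (by fun_prop))).integrable _
  rw [Finset.sum_congr rfl h5]
  simp
  ring

/-- The classical formula that the resolvent is the minor `D` divided by the determinant `d`. Both
sides solve `D = K d - D (exp(t g) - 1) K`, which determines each coefficient from lower ones. -/
theorem minorCoeff_eq_resolvent (hK : BddMeas (Function.uncurry K)) (hg : BddMeas g) (k : ℕ)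
    (x y : E) : minorCoeff μ K g k x y = ∑ q ∈ antidiagonal k,
      resolventCoeff μ K g q.1 x y * momentCoeff μ K g q.2 := by
  induction k using Nat.strong_induction_on generalizing y with
  | _ k ih =>
    rw [minorCoeff_eq hK hg]
    have h1 : ∀ q ∈ antidiagonal k,
        ∫ s, minorCoeff μ K g q.2 x s * coeff q.1 (expSubOne (g s)) * K s y ∂μ =
        ∑ a ∈ antidiagonal q.2, (∫ s, resolventCoeff μ K g a.1 x s *
          coeff q.1 (expSubOne (g s)) * K s y ∂μ) * momentCoeff μ K g a.2 := by
      intro q hq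
      rw [Finset.HasAntidiagonal.mem_antidiagonal] at hq
      rcases Nat.eq_zero_or_pos q.1 with h | h
      · simp [h, coeff_zero_expSubOne]
      · simp_rw [← integral_mul_const]
        rw [← integral_finsetSum]
        · refine integral_congr_ae (Eventually.of_forall fun s => ?_)
          simp only
          rw [ih q.2 (by omega), Finset.sum_mul, Finset.sum_mul]
          refine Finset.sum_congr rfl fun a _ => ?_
          ring
        · intro a _
          exact (((((bddMeas_resolventCoeff hK hg a.1).comp
            (g := fun s => (x, s)) (by fun_prop)).mul (hg.coeff_expSubOne _)).mul
            (bddMeas_kernel hK (by fun_prop) (by fun_prop))).integrable _).mul_const _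
    rw [Finset.sum_congr rfl h1, sum_antidiagonal_assoc k (fun i a b =>
      (∫ s, resolventCoeff μ K g a x s * coeff i (expSubOne (g s)) * K s y ∂μ) *
        momentCoeff μ K g b)]
    simp_rw [resolventCoeff_eq (μ := μ) (K := K) (g := g) _ x y, sub_mul,
      Finset.sum_sub_distrib, Finset.sum_mul]
    congr 1
    rw [Finset.sum_eq_single (0, k)]
    · simp
    · rintro ⟨a, b⟩ hq hne
      rw [Finset.HasAntidiagonal.mem_antidiagonal] at hq
      have : a ≠ 0 := by rintro rfl; simp_all
      simp [this]
    · simp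

/-- This is `d' = tr(g exp(t g) R) d` for the Fredholm determinant `d`. As the coefficients of `d`
will be moments over factorials, it is the moment–cumulant recursion and identifies `cumulantCoeff`
of index `i` as `κ_{i+1} / i!`. -/
theorem momentCoeff_succ (hK : BddMeas (Function.uncurry K)) (hg : BddMeas g) (k : ℕ) :
    ((k : ℂ) + 1) * momentCoeff μ K g (k + 1) =
      ∑ q ∈ antidiagonal k, cumulantCoeff μ K g q.1 * momentCoeff μ K g q.2 := by
  have h0 : fredholmCoeff μ K g 0 (k + 1) = 0 := by
    simp [fredholmCoeff, expCoeff, PowerSeries.coeff_one]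
  have hr : ∀ i, BddMeas (fun t => g t ^ (i + 1) / (i.factorial : ℂ)) := fun i =>
    (hg.pow _).div_const _
  have h1 : ∀ n, ((k : ℂ) + 1) * (fredholmCoeff μ K g (n + 1) (k + 1) / (n + 1).factorial) =
      ∑ q ∈ antidiagonal k, ∫ t, g t ^ (q.1 + 1) / q.1.factorial *
        (fredholmMinorCoeff μ K g n q.2 t t / n.factorial) ∂μ := by
    intro n
    have h2 : ∀ q : ℕ × ℕ, ∫ t, g t ^ (q.1 + 1) / q.1.factorial *
        (fredholmMinorCoeff μ K g n q.2 t t / n.factorial) ∂μ = (n.factorial : ℂ)⁻¹ *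
        ∫ t, g t ^ (q.1 + 1) / q.1.factorial * fredholmMinorCoeff μ K g n q.2 t t ∂μ := by
      intro q
      rw [← integral_const_mul]
      refine integral_congr_ae (Eventually.of_forall fun s => ?_)
      simp only
      ring
    simp_rw [h2]
    rw [← Finset.mul_sum, mul_div_assoc', succ_mul_fredholmCoeff hK hg, Nat.factorial_succ]
    have h3 : (n.factorial : ℂ) ≠ 0 := by exact_mod_cast n.factorial_ne_zero
    have h4 : (n + 1 : ℂ) ≠ 0 := by exact_mod_cast n.succ_ne_zero
    push_cast
    field_simp
  rw [momentCoeff, Finset.sum_range_succ', h0, zero_div, add_zero, Finset.mul_sum]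
  simp_rw [h1]
  rw [Finset.sum_comm]
  have h5 : ∀ q ∈ antidiagonal k, ∑ n ∈ Finset.range (k + 1),
      ∫ t, g t ^ (q.1 + 1) / q.1.factorial *
        (fredholmMinorCoeff μ K g n q.2 t t / n.factorial) ∂μ =
      ∑ a ∈ antidiagonal q.2, (∫ t, g t ^ (q.1 + 1) / q.1.factorial *
        resolventCoeff μ K g a.1 t t ∂μ) * momentCoeff μ K g a.2 := by
    intro q hq
    rw [Finset.HasAntidiagonal.mem_antidiagonal] at hq
    simp_rw [← integral_mul_const]
    rw [← integral_finsetSum, ← integral_finsetSum]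
    · refine integral_congr_ae (Eventually.of_forall fun t => ?_)
      simp only
      rw [← Finset.mul_sum, ← minorCoeff_eq_sum q.2 (k + 1) (by omega),
        minorCoeff_eq_resolvent hK hg, Finset.mul_sum]
      refine Finset.sum_congr rfl fun a _ => ?_
      ring
    · intro a _
      exact (((hr q.1).mul ((bddMeas_resolventCoeff hK hg a.1).comp
        (g := fun s => (s, s)) (by fun_prop))).integrable _).mul_const _
    · intro n _
      exact ((hr q.1).mul (((bddMeas_fredholmMinorCoeff hK hg n q.2).comp
        (g := fun s => (s, s)) (by fun_prop)).div_const _)).integrable _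
  rw [Finset.sum_congr rfl h5, sum_antidiagonal_assoc k (fun i a b =>
    (∫ t, g t ^ (i + 1) / (i.factorial : ℂ) * resolventCoeff μ K g a t t ∂μ) *
      momentCoeff μ K g b)]
  simp_rw [cumulantCoeff, Finset.sum_mul]

end Fredholm

end DetCLT

namespace DetCLT

/-! ### Factorial moments from counts on disjoint sets -/

section FactorialMoments

set_option linter.unusedSectionVars false

open scoped Classical in
/-- The sum of `Φ (p ∘ x)` over all tuples `x` of points of `A` such that `p ∘ x` is injective. -/
noncomputable def injSum (A : Finset ℂ) {n : ℕ} (p : ℂ → ℂ) (Φ : (Fin n → ℂ) → ℂ) : ℂ :=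
  ∑ x ∈ Fintype.piFinset (fun _ : Fin n => A),
    if Function.Injective (p ∘ x) then Φ (p ∘ x) else 0

open scoped Classical in
-- Distinct points are eventually separated by the approximations and coinciding points never are,
-- so the indicator converges although injectivity is not a continuous condition.
theorem tendsto_injective_ite {n : ℕ} {p : ℕ → ℂ → ℂ}
    (hp : ∀ z, Tendsto (fun m => p m z) atTop (𝓝 z)) {Φ : (Fin n → ℂ) → ℂ} (hΦ : Continuous Φ)
    (x : Fin n → ℂ) :
    Tendsto (fun m => if Function.Injective (p m ∘ x) then Φ (p m ∘ x) else 0) atTop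
      (𝓝 (if Function.Injective x then Φ x else 0)) := by
  have hx : Tendsto (fun m => p m ∘ x) atTop (𝓝 x) := tendsto_pi_nhds.2 fun i => hp (x i)
  by_cases h : Function.Injective x
  · have hev : ∀ᶠ m in atTop, Function.Injective (p m ∘ x) := by
      have : ∀ᶠ m in atTop, ∀ i j, i ≠ j → p m (x i) ≠ p m (x j) := by
        refine eventually_all.2 fun i => eventually_all.2 fun j => ?_
        by_cases hij : i = j
        · exact Eventually.of_forall fun _ hne => absurd hij hne
        · exact (((hp (x i)).sub (hp (x j))).eventually_ne (sub_ne_zero.2 (h.ne hij))).mono fun m hm _ =>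
            sub_ne_zero.1 hm
      exact this.mono fun m hm i j hij => by_contra fun hne => hm i j hne hij
    rw [if_pos h]
    refine ((hΦ.tendsto x).comp hx).congr' (hev.mono fun m hm => ?_)
    simp only [if_pos hm, Function.comp_apply]
  · have : ∀ m, ¬ Function.Injective (p m ∘ x) := fun m hm => h hm.of_comp
    simp [h, this]

theorem tendsto_injSum {n : ℕ} (A : Finset ℂ) {p : ℕ → ℂ → ℂ}
    (hp : ∀ z, Tendsto (fun m => p m z) atTop (𝓝 z)) {Φ : (Fin n → ℂ) → ℂ} (hΦ : Continuous Φ) :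
    Tendsto (fun m => injSum A (p m) Φ) atTop (𝓝 (injSum A id Φ)) := by
  classical
  exact tendsto_finsetSum _ fun x _ => tendsto_injective_ite hp hΦ x

variable {Ω : Type*} [MeasurableSpace Ω] {Z : Ω → Finset ℂ} {B : Set ℂ}

open scoped Classical in
theorem pointCount_eq_sum (D : Set ℂ) (ω : Ω) :
    (pointCount Z D ω : ℂ) = ∑ z ∈ Z ω, if z ∈ D then 1 else 0 := by
  rw [pointCount, Finset.sum_boole, ← Set.ncard_coe_finset]
  congr 2
  ext z
  simp

open scoped Classical in
-- Tuples are sorted by the level sets of `p` in which their points lie. Injectivity of `p ∘ x` says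
-- that these are distinct, hence disjoint, which is the situation covered by `IsDeterminantal`.
theorem injSum_simpleFunc (hZ : ∀ ω, (Z ω : Set ℂ) ⊆ B) {n : ℕ} (p : SimpleFunc ℂ ℂ)
    (Φ : (Fin n → ℂ) → ℂ) (ω : Ω) :
    injSum (Z ω) p Φ = ∑ c ∈ Fintype.piFinset (fun _ : Fin n => p.range),
      if Function.Injective c then Φ c * ∏ i, (pointCount Z (B ∩ p ⁻¹' {c i}) ω : ℂ) else 0 := by
  have h1 : ∀ c : Fin n → ℂ, ∏ i, (pointCount Z (B ∩ p ⁻¹' {c i}) ω : ℂ) =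
      ∑ x ∈ Fintype.piFinset (fun _ : Fin n => Z ω), if p ∘ x = c then 1 else 0 := by
    intro c
    simp_rw [pointCount_eq_sum]
    rw [Finset.prod_univ_sum]
    refine Finset.sum_congr rfl fun x hx => ?_
    rw [Fintype.mem_piFinset] at hx
    have hiff : ∀ i, x i ∈ B ∩ p ⁻¹' {c i} ↔ p (x i) = c i := fun i =>
      and_iff_right (hZ ω (hx i))
    by_cases hc : p ∘ x = c
    · rw [if_pos hc]
      exact Finset.prod_eq_one fun i _ => if_pos ((hiff i).2 (congrFun hc i))
    · rw [if_neg hc]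
      obtain ⟨i, hi⟩ := Function.ne_iff.1 hc
      exact Finset.prod_eq_zero (Finset.mem_univ i) (if_neg fun h => hi ((hiff i).1 h))
  simp_rw [h1, Finset.mul_sum]
  have h2 : ∀ c : Fin n → ℂ, (if Function.Injective c then
      ∑ x ∈ Fintype.piFinset (fun _ : Fin n => Z ω), Φ c * (if p ∘ x = c then 1 else 0) else 0) =
      ∑ x ∈ Fintype.piFinset (fun _ : Fin n => Z ω),
        if p ∘ x = c then (if Function.Injective c then Φ c else 0) else 0 := by
    intro c
    split_ifs <;> simp
  simp_rw [h2]
  rw [Finset.sum_comm]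
  refine Finset.sum_congr rfl fun x _ => ?_
  rw [Finset.sum_ite_eq]
  have hmem : p ∘ x ∈ Fintype.piFinset fun _ : Fin n => p.range :=
    Fintype.mem_piFinset.2 fun i => p.mem_range_self _
  simp only [hmem, if_true]

theorem IsDeterminantal.congr {K K' : ℂ → ℂ → ℂ} {P : Measure Ω} (h : IsDeterminantal B K P Z)
    (hKK' : ∀ x ∈ B, ∀ y ∈ B, K x y = K' x y) : IsDeterminantal B K' P Z := by
  refine ⟨h.subset, h.measurable_count, fun k D hD hDB hdisj => ?_⟩
  obtain ⟨h1, h2, h3⟩ := h.intensity k D hD hDB hdisj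
  have heq : Set.EqOn (fun x : Fin k → ℂ => (Matrix.of fun i j => K (x i) (x j)).det)
      (fun x => (Matrix.of fun i j => K' (x i) (x j)).det) (Set.univ.pi D) := by
    intro x hx
    simp only
    congr 1
    ext i j
    exact hKK' _ (hDB i (hx i trivial)) _ (hDB j (hx j trivial))
  have hm : MeasurableSet (Set.univ.pi D) := MeasurableSet.univ_pi hD
  exact ⟨h1, h2.congr_fun heq hm, h3.trans (setIntegral_congr_fun hm heq)⟩

theorem measurable_injSum_simpleFunc {K : ℂ → ℂ → ℂ} {P : Measure Ω}
    (h : IsDeterminantal B K P Z) (hB : MeasurableSet B) {n : ℕ} (p : SimpleFunc ℂ ℂ)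
    (Φ : (Fin n → ℂ) → ℂ) : Measurable (fun ω => injSum (Z ω) p Φ) := by
  classical
  simp_rw [injSum_simpleFunc h.subset]
  refine Finset.measurable_sum _ fun c _ => ?_
  split_ifs
  · refine Measurable.const_mul (Finset.measurable_prod _ fun i _ => ?_) _
    exact (measurable_from_top (f := fun n : ℕ => (n : ℂ))).comp
      (h.measurable_count _ (hB.inter (p.measurableSet_fiber _)))
  · exact measurable_const

open scoped Classical in
theorem integral_injSum_simpleFunc {K : ℂ → ℂ → ℂ} {P : Measure Ω}
    (h : IsDeterminantal B K P Z) (hB : MeasurableSet B) {n : ℕ} (p : SimpleFunc ℂ ℂ)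
    (Φ : (Fin n → ℂ) → ℂ) :
    Integrable (fun ω => injSum (Z ω) p Φ) P ∧ ∫ ω, injSum (Z ω) p Φ ∂P =
      ∫ x, (if Function.Injective (p ∘ x) then Φ (p ∘ x) else 0) *
        (Matrix.of fun i j => K (x i) (x j)).det
        ∂(Measure.pi fun _ : Fin n => volume.restrict B) := by
  simp_rw [injSum_simpleFunc h.subset]
  have hdisj : ∀ c : Fin n → ℂ, Function.Injective c →
      Pairwise (fun i j => Disjoint (B ∩ p ⁻¹' {c i}) (B ∩ p ⁻¹' {c j})) := by
    intro c hc i j hij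
    refine Disjoint.mono Set.inter_subset_right Set.inter_subset_right ?_
    exact Disjoint.preimage _ (Set.disjoint_singleton.2 (hc.ne hij))
  have hint := fun (c : Fin n → ℂ) (hc : Function.Injective c) =>
    h.intensity n (fun i => B ∩ p ⁻¹' {c i}) (fun i => hB.inter (p.measurableSet_fiber _))
      (fun i => Set.inter_subset_left) (hdisj c hc)
  have hcast : ∀ (c : Fin n → ℂ) ω, ∏ i, (pointCount Z (B ∩ p ⁻¹' {c i}) ω : ℂ) =
      ((∏ i, (pointCount Z (B ∩ p ⁻¹' {c i}) ω : ℝ) : ℝ) : ℂ) := by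
    intro c ω; push_cast; rfl
  have hI : ∀ c : Fin n → ℂ, Integrable (fun ω => if Function.Injective c then
      Φ c * ∏ i, (pointCount Z (B ∩ p ⁻¹' {c i}) ω : ℂ) else 0) P := by
    intro c
    split_ifs with hc
    · simp_rw [hcast]
      exact ((hint c hc).1.ofReal).const_mul _
    · exact integrable_zero _ _ _
  refine ⟨integrable_finsetSum _ fun c _ => hI c, ?_⟩
  rw [integral_finsetSum _ fun c _ => hI c]
  let D : (Fin n → ℂ) → Set (Fin n → ℂ) := fun c => Set.univ.pi fun i => p ⁻¹' {c i}
  have hD : ∀ c, MeasurableSet (D c) := fun c =>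
    MeasurableSet.univ_pi fun i => p.measurableSet_fiber _
  let G : (Fin n → ℂ) → (Fin n → ℂ) → ℂ := fun c x => if Function.Injective c then
    (D c).indicator (fun x => Φ c * (Matrix.of fun i j => K (x i) (x j)).det) x else 0
  have hpi : ∀ c, (Measure.pi fun _ : Fin n => volume.restrict B).restrict (D c) =
      volume.restrict (Set.univ.pi fun i => B ∩ p ⁻¹' {c i}) := by
    intro c
    rw [Measure.restrict_pi_pi, volume_pi, Measure.restrict_pi_pi]
    simp_rw [Measure.restrict_restrict (p.measurableSet_fiber _), Set.inter_comm B]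
  have hG : ∀ c, Integrable (G c) (Measure.pi fun _ : Fin n => volume.restrict B) := by
    intro c
    simp only [G]
    split_ifs with hc
    · rw [integrable_indicator_iff (hD c), IntegrableOn, hpi]
      exact (hint c hc).2.1.const_mul _
    · exact integrable_zero _ _ _
  have hsum : ∀ x, (if Function.Injective (p ∘ x) then Φ (p ∘ x) else 0) *
        (Matrix.of fun i j => K (x i) (x j)).det =
      ∑ c ∈ Fintype.piFinset (fun _ : Fin n => p.range), G c x := by
    intro x
    have hDx : ∀ c, x ∈ D c ↔ p ∘ x = c := by
      intro c
      simp [D, Set.mem_pi, funext_iff]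
    rw [Finset.sum_eq_single (p ∘ x)]
    · simp only [G, Set.indicator, hDx, if_true]
      split_ifs <;> simp
    · intro c _ hc
      simp only [G, Set.indicator, hDx, if_neg hc.symm, ite_self]
    · intro hx
      exact absurd (Fintype.mem_piFinset.2 fun i => p.mem_range_self _) hx
  simp_rw [hsum]
  rw [integral_finsetSum _ fun c _ => hG c]
  refine Finset.sum_congr rfl fun c _ => ?_
  simp only [G]
  split_ifs with hc
  · rw [integral_indicator (hD c), hpi, integral_const_mul, integral_const_mul, ← (hint c hc).2.2,
      ← integral_complex_ofReal]
    simp_rw [hcast]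
  · simp

/-- Simple functions that approximate the identity. -/
noncomputable def discretization (m : ℕ) : SimpleFunc ℂ ℂ :=
  SimpleFunc.approxOn id measurable_id Set.univ 0 (Set.mem_univ _) m

theorem tendsto_discretization (z : ℂ) : Tendsto (fun m => discretization m z) atTop (𝓝 z) :=
  SimpleFunc.tendsto_approxOn measurable_id (Set.mem_univ _) (by simp)

theorem measurable_injSum {K : ℂ → ℂ → ℂ} {P : Measure Ω} (h : IsDeterminantal B K P Z)
    (hB : MeasurableSet B) {n : ℕ} {Φ : (Fin n → ℂ) → ℂ} (hΦ : Continuous Φ) :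
    Measurable (fun ω => injSum (Z ω) id Φ) :=
  measurable_of_tendsto_metrizable (fun m => measurable_injSum_simpleFunc h hB (discretization m) Φ)
    (tendsto_pi_nhds.2 fun ω => tendsto_injSum (Z ω) tendsto_discretization hΦ)

/-- If `p ∘ x` is injective then so is `x`. The number of tuples of distinct points is therefore a
bound uniform in `p`, to be used for dominated convergence. -/
theorem norm_injSum_le (A : Finset ℂ) {n : ℕ} (p : ℂ → ℂ) {Φ : (Fin n → ℂ) → ℂ} {C : ℝ}
    (hC : ∀ x, ‖Φ x‖ ≤ C) (hC0 : 0 ≤ C) :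
    ‖injSum A p Φ‖ ≤ C * ‖injSum A id (fun _ : Fin n → ℂ => 1)‖ := by
  classical
  have h1 : ‖injSum A id (fun _ : Fin n → ℂ => 1)‖ = ∑ x ∈ Fintype.piFinset (fun _ : Fin n => A),
      if Function.Injective x then (1 : ℝ) else 0 := by
    rw [injSum, Finset.sum_boole, Finset.sum_boole, Complex.norm_natCast]
    rfl
  rw [h1, Finset.mul_sum, injSum]
  refine (norm_sum_le _ _).trans (Finset.sum_le_sum fun x _ => ?_)
  by_cases hx : Function.Injective (p ∘ x)
  · rw [if_pos hx, if_pos hx.of_comp, mul_one]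
    exact hC _
  · rw [if_neg hx, norm_zero]
    split_ifs <;> simp [hC0]

theorem det_eq_zero_of_not_injective {K : ℂ → ℂ → ℂ} {n : ℕ} {x : Fin n → ℂ}
    (hx : ¬ Function.Injective x) : (Matrix.of fun i j => K (x i) (x j)).det = 0 := by
  simp only [Function.Injective, not_forall] at hx
  obtain ⟨i, j, hij, hne⟩ := hx
  refine Matrix.det_zero_of_row_eq hne ?_
  ext l
  simp [hij]

/-- A limit of the discretised identities. Fatou's lemma, applied to the numbers of separated
tuples, first shows that the number of tuples of distinct points is integrable; it then dominates
the random side, while boundedness of `K` dominates the other. Tuples with repeated points do not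
matter, their determinant being zero. -/
theorem integral_injSum {K : ℂ → ℂ → ℂ} {P : Measure Ω} (h : IsDeterminantal B K P Z)
    (hB : IsCompact B) (hK : BddMeas (Function.uncurry K)) {n : ℕ} {Φ : (Fin n → ℂ) → ℂ}
    (hΦ : Continuous Φ) (hΦb : ∃ C, ∀ x, ‖Φ x‖ ≤ C) :
    Integrable (fun ω => injSum (Z ω) id Φ) P ∧ ∫ ω, injSum (Z ω) id Φ ∂P =
      ∫ x, Φ x * (Matrix.of fun i j => K (x i) (x j)).det
        ∂(Measure.pi fun _ : Fin n => volume.restrict B) := by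
  classical
  have hBm := hB.measurableSet
  have : IsFiniteMeasure (volume.restrict B : Measure ℂ) :=
    ⟨by rw [Measure.restrict_apply_univ]; exact hB.measure_lt_top⟩
  obtain ⟨C, hC⟩ := hΦb
  have hC0 : 0 ≤ C := (norm_nonneg _).trans (hC 0)
  obtain ⟨D, hD0, hD⟩ := (bddMeas_det hK n).norm_le
  set ν := Measure.pi fun _ : Fin n => (volume.restrict B : Measure ℂ)
  have hnorm : ∀ (p : ℂ → ℂ) (A : Finset ℂ), ‖injSum A p (fun _ : Fin n → ℂ => 1)‖ =
      (injSum A p (fun _ : Fin n → ℂ => 1)).re := by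
    intro p A
    rw [injSum, Finset.sum_boole, Complex.norm_natCast, Complex.natCast_re]
  have hbound : ∀ m, ∫⁻ ω, ‖‖injSum (Z ω) (discretization m) (fun _ : Fin n → ℂ => 1)‖‖ₑ ∂P ≤
      ENNReal.ofReal (D * ν.real Set.univ) := by
    intro m
    obtain ⟨h1, h2⟩ := integral_injSum_simpleFunc h hBm (discretization m) (fun _ : Fin n → ℂ => 1)
    simp_rw [enorm_norm]
    rw [← ofReal_integral_norm_eq_lintegral_enorm h1]
    refine ENNReal.ofReal_le_ofReal ?_
    simp_rw [hnorm]
    have h3 : ∫ ω, (injSum (Z ω) (discretization m) (fun _ : Fin n → ℂ => 1)).re ∂P =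
        (∫ ω, injSum (Z ω) (discretization m) (fun _ : Fin n → ℂ => 1) ∂P).re := integral_re h1
    rw [h3, h2]
    refine (Complex.re_le_norm _).trans ?_
    refine norm_integral_le_of_norm_le_const (Eventually.of_forall fun x => ?_)
    rw [norm_mul]
    refine (mul_le_of_le_one_left (norm_nonneg _) ?_).trans (hD x)
    split_ifs <;> simp
  have hcount : Integrable (fun ω => ‖injSum (Z ω) id (fun _ : Fin n → ℂ => 1)‖) P := by
    refine ⟨(measurable_injSum h hBm continuous_const).norm.aestronglyMeasurable, ?_⟩
    refine lt_of_le_of_lt ?_ (ENNReal.ofReal_lt_top (r := D * ν.real Set.univ))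
    refine (lintegral_congr fun ω => ?_).trans_le ((lintegral_liminf_le
      (f := fun m ω => ‖‖injSum (Z ω) (discretization m) (fun _ : Fin n → ℂ => 1)‖‖ₑ)
      (u := atTop) fun m => ?_).trans ?_)
    · exact ((tendsto_injSum (Z ω) tendsto_discretization continuous_const).norm.enorm).liminf_eq.symm
    · exact (measurable_injSum_simpleFunc h hBm _ _).norm.enorm
    · refine (liminf_le_liminf (Eventually.of_forall hbound)).trans ?_
      simp
  have hint : Integrable (fun ω => injSum (Z ω) id Φ) P :=
    (hcount.const_mul C).mono' (measurable_injSum h hBm hΦ).aestronglyMeasurable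
      (Eventually.of_forall fun ω => norm_injSum_le _ _ hC hC0)
  refine ⟨hint, ?_⟩
  have ht1 : Tendsto (fun m => ∫ ω, injSum (Z ω) (discretization m) Φ ∂P) atTop
      (𝓝 (∫ ω, injSum (Z ω) id Φ ∂P)) :=
    tendsto_integral_of_dominated_convergence _
      (fun m => (measurable_injSum_simpleFunc h hBm _ _).aestronglyMeasurable)
      (hcount.const_mul C)
      (fun m => Eventually.of_forall fun ω => norm_injSum_le _ _ hC hC0)
      (Eventually.of_forall fun ω => tendsto_injSum (Z ω) tendsto_discretization hΦ)
  have hmeas : ∀ m, Measurable (fun x : Fin n → ℂ =>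
      if Function.Injective (discretization m ∘ x) then Φ (discretization m ∘ x) else 0) := by
    intro m
    have hd : Measurable (fun x : Fin n → ℂ => discretization m ∘ x) :=
      measurable_pi_lambda _ fun i => (discretization m).measurable.comp (measurable_pi_apply i)
    refine Measurable.ite ?_ (hΦ.measurable.comp hd) measurable_const
    have : {x : Fin n → ℂ | Function.Injective (discretization m ∘ x)} =
        ⋂ i, ⋂ j, {x | discretization m (x i) = discretization m (x j) → i = j} := by
      ext x; simp [Function.Injective]
    rw [this]
    refine MeasurableSet.iInter fun i => MeasurableSet.iInter fun j => ?_
    by_cases hij : i = j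
    · simp [hij]
    · simp only [hij, imp_false]
      exact (measurableSet_eq_fun ((discretization m).measurable.comp (measurable_pi_apply i))
        ((discretization m).measurable.comp (measurable_pi_apply j))).compl
  have ht2 : Tendsto (fun m => ∫ x, (if Function.Injective (discretization m ∘ x) then
      Φ (discretization m ∘ x) else 0) * (Matrix.of fun i j => K (x i) (x j)).det ∂ν) atTop
      (𝓝 (∫ x, (if Function.Injective x then Φ x else 0) *
        (Matrix.of fun i j => K (x i) (x j)).det ∂ν)) := by
    refine tendsto_integral_of_dominated_convergence (fun _ => C * D)
      (fun m => ((hmeas m).mul (bddMeas_det hK n).measurable).aestronglyMeasurable)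
      (integrable_const _) (fun m => Eventually.of_forall fun x => ?_)
      (Eventually.of_forall fun x =>
        (tendsto_injective_ite tendsto_discretization hΦ x).mul_const _)
    rw [norm_mul]
    refine mul_le_mul ?_ (hD x) (norm_nonneg _) hC0
    split_ifs
    · exact hC _
    · simpa using hC0
  simp_rw [fun m => (integral_injSum_simpleFunc h hBm (discretization m) Φ).2] at ht1
  rw [tendsto_nhds_unique ht1 ht2]
  refine integral_congr_ae (Eventually.of_forall fun x => ?_)
  by_cases hx : Function.Injective x
  · simp [hx]
  · simp [hx, det_eq_zero_of_not_injective hx]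

end FactorialMoments

/-! ### Powers of linear statistics in terms of factorial moments -/

section Moments

open PowerSeries (coeff)

open scoped Classical in
theorem sum_injective_image {n : ℕ} (A : Finset ℂ) (F : Finset ℂ → ℂ) :
    ∑ x ∈ Fintype.piFinset (fun _ : Fin n => A),
      (if Function.Injective x then F (Finset.univ.image x) else 0) =
      n.factorial * ∑ T ∈ A.powersetCard n, F T := by
  rw [← Finset.sum_filter, ← Finset.sum_fiberwise_of_maps_to (t := A.powersetCard n)
    (g := fun x => Finset.univ.image x), Finset.mul_sum]
  · refine Finset.sum_congr rfl fun T hT => ?_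
    rw [Finset.mem_powersetCard] at hT
    rw [Finset.sum_congr rfl (g := fun _ => F T), Finset.sum_const, nsmul_eq_mul]
    · congr 2
      have hc : (Finset.univ : Finset (Fin n ↪ T)).card = n.factorial := by
        rw [Finset.card_univ, Fintype.card_embedding_eq, Fintype.card_coe, hT.2, Fintype.card_fin,
          Nat.descFactorial_self]
      rw [← hc]
      symm
      refine Finset.card_bij (fun e _ i => (e i : ℂ)) ?_ ?_ ?_
      · intro e _
        have hinj : Function.Injective (fun i => (e i : ℂ)) :=
          Subtype.val_injective.comp e.injective
        simp only [Finset.mem_filter, Fintype.mem_piFinset]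
        refine ⟨⟨fun i => hT.1 (e i).2, hinj⟩, ?_⟩
        refine Finset.eq_of_subset_of_card_le ?_ ?_
        · intro z hz
          obtain ⟨i, -, rfl⟩ := Finset.mem_image.1 hz
          exact (e i).2
        · rw [Finset.card_image_of_injective _ hinj, hT.2, Finset.card_univ, Fintype.card_fin]
      · intro e _ e' _ hee
        ext i
        exact congrFun hee i
      · intro x hx
        simp only [Finset.mem_filter] at hx
        have hm : ∀ i, x i ∈ T := fun i => hx.2 ▸ Finset.mem_image_of_mem x (Finset.mem_univ i)
        exact ⟨⟨fun i => ⟨x i, hm i⟩, fun i j hij => hx.1.2 (congrArg Subtype.val hij)⟩,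
          Finset.mem_univ _, rfl⟩
    · intro x hx
      rw [(Finset.mem_filter.1 hx).2]
  · intro x hx
    simp only [Finset.mem_filter, Fintype.mem_piFinset] at hx
    rw [Finset.mem_powersetCard]
    refine ⟨?_, by rw [Finset.card_image_of_injective _ hx.2, Finset.card_univ, Fintype.card_fin]⟩
    intro z hz
    obtain ⟨i, -, rfl⟩ := Finset.mem_image.1 hz
    exact hx.1 i

theorem rescale_exp_sum (A : Finset ℂ) (g : ℂ → ℂ) :
    PowerSeries.rescale (∑ z ∈ A, g z) (PowerSeries.exp ℂ) =
      ∏ z ∈ A, (1 + expSubOne (g z)) := by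
  classical
  induction A using Finset.induction with
  | empty => ext i; rw [Finset.sum_empty, coeff_rescale_exp]; cases i <;> simp [PowerSeries.coeff_one]
  | insert a A ha ih =>
    rw [Finset.sum_insert ha, Finset.prod_insert ha, ← ih, ← PowerSeries.exp_mul_exp_eq_exp_add]
    simp [expSubOne]

/-- Expand `exp(t ∑ g) = ∏ (1 + (exp(t g) - 1))` over subsets of `A`; a subset of size `n` is the
image of `n!` injective tuples. The summation range may be cut at `k` or at the size of `A`, since
terms beyond either vanish. -/
theorem pow_sum_div_factorial (A : Finset ℂ) (g : ℂ → ℂ) (k : ℕ) :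
    (∑ z ∈ A, g z) ^ k / k.factorial = ∑ n ∈ Finset.range (k + 1),
      injSum A id (expCoeff g n k) / n.factorial := by
  classical
  have h1 : ∀ n, injSum A id (expCoeff g n k) / n.factorial =
      ∑ T ∈ A.powersetCard n, coeff k (∏ z ∈ T, expSubOne (g z)) := by
    intro n
    rw [div_eq_iff (by exact_mod_cast n.factorial_ne_zero), mul_comm, ← sum_injective_image, injSum]
    refine Finset.sum_congr rfl fun x _ => ?_
    simp only [Function.id_comp]
    split_ifs with hx
    · rw [Finset.prod_image fun i _ j _ h => hx h, expCoeff]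
    · rfl
  simp_rw [h1]
  rw [← coeff_rescale_exp, rescale_exp_sum, Finset.prod_one_add, map_sum, Finset.sum_powerset]
  have h2 : ∀ n, k < n → ∑ T ∈ A.powersetCard n, coeff k (∏ z ∈ T, expSubOne (g z)) = 0 := by
    intro n hn
    rw [← h1, injSum]
    simp [expCoeff_eq_zero hn]
  have h3 : ∀ n, A.card < n → ∑ T ∈ A.powersetCard n, coeff k (∏ z ∈ T, expSubOne (g z)) = 0 := by
    intro n hn
    rw [Finset.powersetCard_eq_empty.2 hn, Finset.sum_empty]
  rcases le_total A.card k with h | h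
  · refine Finset.sum_subset (Finset.range_mono (by omega)) fun n _ hn => h3 n ?_
    simpa using hn
  · symm
    refine Finset.sum_subset (Finset.range_mono (by omega)) fun n _ hn => h2 n ?_
    simpa using hn

theorem continuous_expCoeff {g : ℂ → ℂ} (hg : Continuous g) (n k : ℕ) :
    Continuous (expCoeff g n k) := by
  have h1 : ∀ i, Continuous (fun z => coeff i (expSubOne (g z))) := by
    intro i
    cases i with
    | zero => simpa only [coeff_zero_expSubOne] using continuous_const
    | succ i => simp only [coeff_succ_expSubOne]; fun_prop
  unfold expCoeff
  simp_rw [PowerSeries.coeff_prod]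
  exact continuous_finsetSum _ fun l _ => continuous_finsetProd _ fun i _ =>
    (h1 _).comp (continuous_apply i)

variable {Ω : Type*} [MeasurableSpace Ω] {Z : Ω → Finset ℂ} {B : Set ℂ} {K : ℂ → ℂ → ℂ}
  {P : Measure Ω}

theorem measurable_sum_points (h : IsDeterminantal B K P Z) (hB : MeasurableSet B) {g : ℂ → ℂ}
    (hg : Continuous g) : Measurable (fun ω => ∑ z ∈ Z ω, g z) := by
  have h1 : ∀ ω, ∑ z ∈ Z ω, g z = ∑ n ∈ Finset.range (1 + 1),
      injSum (Z ω) id (expCoeff g n 1) / n.factorial := by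
    intro ω
    rw [← pow_sum_div_factorial]
    simp
  simp_rw [h1]
  exact Finset.measurable_sum _ fun n _ =>
    (measurable_injSum h hB (continuous_expCoeff hg n 1)).div_const _

theorem moment_sum_points (h : IsDeterminantal B K P Z) (hB : IsCompact B)
    (hK : BddMeas (Function.uncurry K)) {g : ℂ → ℂ} (hg : Continuous g)
    (hgb : ∃ C, ∀ z, ‖g z‖ ≤ C) (k : ℕ) :
    Integrable (fun ω => (∑ z ∈ Z ω, g z) ^ k) P ∧
      (∫ ω, (∑ z ∈ Z ω, g z) ^ k ∂P) / k.factorial = momentCoeff (volume.restrict B) K g k := by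
  have hgm : BddMeas g := ⟨hg.measurable, hgb⟩
  have hk : (k.factorial : ℂ) ≠ 0 := by exact_mod_cast k.factorial_ne_zero
  have h0 : ∀ n, _ := fun n => integral_injSum h hB hK (continuous_expCoeff hg n k)
    (hgm.expCoeff n k).bounded
  have h1 : ∀ ω, (∑ z ∈ Z ω, g z) ^ k = k.factorial * ∑ n ∈ Finset.range (k + 1),
      injSum (Z ω) id (expCoeff g n k) / n.factorial := by
    intro ω
    rw [← pow_sum_div_factorial]
    field_simp
  simp_rw [h1]
  refine ⟨(integrable_finsetSum _ fun n _ => (h0 n).1.div_const _).const_mul _, ?_⟩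
  rw [integral_const_mul, mul_div_cancel_left₀ _ hk, integral_finsetSum _ fun n _ =>
    (h0 n).1.div_const _, momentCoeff]
  refine Finset.sum_congr rfl fun n _ => ?_
  rw [integral_div, (h0 n).2, fredholmCoeff]

end Moments

end DetCLT

namespace DetCLT

open scoped ComplexConjugate

/-! ### Second order jets in `h` and `h̄` -/

section Jets

/-- Evaluation of the quadratic polynomial with coefficients of `1, h, h̄, h², h h̄, h̄²`. -/
noncomputable def jetEval (w : Fin 6 → ℂ) (h : ℂ) : ℂ :=
  w 0 + (w 1 * h + w 2 * conj h) + (w 3 * h ^ 2 + w 4 * (h * conj h) + w 5 * conj h ^ 2)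

/-- Truncated multiplication of quadratic polynomials in `h, h̄`. -/
def jetMul (w v : Fin 6 → ℂ) : Fin 6 → ℂ :=
  ![w 0 * v 0, w 0 * v 1 + w 1 * v 0, w 0 * v 2 + w 2 * v 0,
    w 0 * v 3 + w 1 * v 1 + w 3 * v 0, w 0 * v 4 + w 1 * v 2 + w 2 * v 1 + w 4 * v 0,
    w 0 * v 5 + w 2 * v 2 + w 5 * v 0]

theorem norm_jet_linear_le (w : Fin 6 → ℂ) (h : ℂ) :
    ‖w 1 * h + w 2 * conj h‖ ≤ 2 * ‖w‖ * ‖h‖ := by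
  refine (norm_add_le _ _).trans ?_
  rw [norm_mul, norm_mul, RCLike.norm_conj]
  have h1 := mul_le_mul_of_nonneg_right (norm_le_pi_norm w 1) (norm_nonneg h)
  have h2 := mul_le_mul_of_nonneg_right (norm_le_pi_norm w 2) (norm_nonneg h)
  linarith

theorem norm_jet_quadratic_le (w : Fin 6 → ℂ) (h : ℂ) :
    ‖w 3 * h ^ 2 + w 4 * (h * conj h) + w 5 * conj h ^ 2‖ ≤ 3 * ‖w‖ * ‖h‖ ^ 2 := by
  refine (norm_add₃_le).trans ?_
  simp only [norm_mul, norm_pow, RCLike.norm_conj]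
  have h1 := mul_le_mul_of_nonneg_right (norm_le_pi_norm w 3) (sq_nonneg ‖h‖)
  have h2 := mul_le_mul_of_nonneg_right (norm_le_pi_norm w 4) (sq_nonneg ‖h‖)
  have h3 := mul_le_mul_of_nonneg_right (norm_le_pi_norm w 5) (sq_nonneg ‖h‖)
  rw [← sq]
  linarith

theorem norm_jetEval_sub_le (w : Fin 6 → ℂ) {h : ℂ} {d : ℝ} (hd : ‖h‖ ≤ d) :
    ‖jetEval w h - w 0‖ ≤ (2 + 3 * d) * ‖w‖ * ‖h‖ := by
  have : jetEval w h - w 0 = (w 1 * h + w 2 * conj h) +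
      (w 3 * h ^ 2 + w 4 * (h * conj h) + w 5 * conj h ^ 2) := by
    rw [jetEval]; ring
  rw [this]
  refine (norm_add_le _ _).trans ((add_le_add (norm_jet_linear_le w h)
    (norm_jet_quadratic_le w h)).trans ?_)
  have : ‖w‖ * ‖h‖ * ‖h‖ ≤ ‖w‖ * ‖h‖ * d :=
    mul_le_mul_of_nonneg_left hd (by positivity)
  nlinarith

theorem norm_jetEval_le (w : Fin 6 → ℂ) {h : ℂ} {d : ℝ} (hd : ‖h‖ ≤ d) :
    ‖jetEval w h‖ ≤ (1 + (2 + 3 * d) * d) * ‖w‖ := by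
  have h1 := norm_jetEval_sub_le w hd
  have h2 := norm_le_pi_norm w 0
  have h0 : 0 ≤ d := (norm_nonneg h).trans hd
  have h3 : (2 + 3 * d) * ‖w‖ * ‖h‖ ≤ (2 + 3 * d) * ‖w‖ * d :=
    mul_le_mul_of_nonneg_left hd (by positivity)
  calc ‖jetEval w h‖ = ‖(jetEval w h - w 0) + w 0‖ := by rw [sub_add_cancel]
    _ ≤ _ := norm_add_le _ _
    _ ≤ _ := by linarith

theorem norm_jetMul_le (w v : Fin 6 → ℂ) : ‖jetMul w v‖ ≤ 4 * (‖w‖ * ‖v‖) := by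
  have hb : ∀ i j, ‖w i * v j‖ ≤ ‖w‖ * ‖v‖ := fun i j => by
    rw [norm_mul]
    exact mul_le_mul (norm_le_pi_norm w i) (norm_le_pi_norm v j) (norm_nonneg _) (norm_nonneg _)
  have h0 : 0 ≤ ‖w‖ * ‖v‖ := by positivity
  refine (pi_norm_le_iff_of_nonneg (by positivity)).2 fun i => ?_
  fin_cases i
  · have := hb 0 0
    simp only [jetMul]
    exact this.trans (by linarith)
  · refine (norm_add_le _ _).trans ?_
    linarith [hb 0 1, hb 1 0]
  · refine (norm_add_le _ _).trans ?_
    linarith [hb 0 2, hb 2 0]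
  · refine norm_add₃_le.trans ?_
    linarith [hb 0 3, hb 1 1, hb 3 0]
  · refine norm_add₄_le.trans ?_
    linarith [hb 0 4, hb 1 2, hb 2 1, hb 4 0]
  · refine norm_add₃_le.trans ?_
    linarith [hb 0 5, hb 2 2, hb 5 0]

/-- The product terms lost by truncation are linear times quadratic, with constant `2 · 3 + 3 · 2 =
12`, and quadratic times quadratic, with constant `9` and a spare factor `‖h‖ ≤ d`. -/
theorem norm_jetEval_mul_sub_le (w v : Fin 6 → ℂ) {h : ℂ} {d : ℝ} (hd : ‖h‖ ≤ d) :
    ‖jetEval w h * jetEval v h - jetEval (jetMul w v) h‖ ≤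
      (12 + 9 * d) * (‖w‖ * ‖v‖) * ‖h‖ ^ 3 := by
  set L := w 1 * h + w 2 * conj h
  set Q := w 3 * h ^ 2 + w 4 * (h * conj h) + w 5 * conj h ^ 2
  set L' := v 1 * h + v 2 * conj h
  set Q' := v 3 * h ^ 2 + v 4 * (h * conj h) + v 5 * conj h ^ 2
  have heq : jetEval w h * jetEval v h - jetEval (jetMul w v) h = L * Q' + Q * L' + Q * Q' := by
    simp only [jetEval, jetMul, L, Q, L', Q']
    simp only [Matrix.cons_val]
    ring
  have hL : ‖L‖ ≤ 2 * ‖w‖ * ‖h‖ := norm_jet_linear_le w h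
  have hL' : ‖L'‖ ≤ 2 * ‖v‖ * ‖h‖ := norm_jet_linear_le v h
  have hQ : ‖Q‖ ≤ 3 * ‖w‖ * ‖h‖ ^ 2 := norm_jet_quadratic_le w h
  have hQ' : ‖Q'‖ ≤ 3 * ‖v‖ * ‖h‖ ^ 2 := norm_jet_quadratic_le v h
  rw [heq]
  refine norm_add₃_le.trans ?_
  simp only [norm_mul]
  have h1 := mul_le_mul hL hQ' (norm_nonneg _) (by positivity)
  have h2 := mul_le_mul hQ hL' (norm_nonneg _) (by positivity)
  have h3 := mul_le_mul hQ hQ' (norm_nonneg _) (by positivity)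
  have h4 : ‖w‖ * ‖v‖ * ‖h‖ ^ 3 * ‖h‖ ≤ ‖w‖ * ‖v‖ * ‖h‖ ^ 3 * d :=
    mul_le_mul_of_nonneg_left hd (by positivity)
  nlinarith

/-- For base points `b ∈ S`, the function `g b` agrees on `B` with a quadratic polynomial in
`y - b` and its conjugate, up to a cubic error; everything is uniform in `b`. -/
def HasJet (S B : Set ℂ) (g : ℂ → ℂ → ℂ) (w : ℂ → Fin 6 → ℂ) : Prop :=
  ∃ C : ℝ, ∀ b ∈ S, ‖w b‖ ≤ C ∧ ∀ y ∈ B, ‖g b y - jetEval (w b) (y - b)‖ ≤ C * ‖y - b‖ ^ 3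

theorem HasJet.of_eval {S B : Set ℂ} {w : ℂ → Fin 6 → ℂ} (hw : ∃ C : ℝ, ∀ b ∈ S, ‖w b‖ ≤ C) :
    HasJet S B (fun b y => jetEval (w b) (y - b)) w := by
  obtain ⟨C, hC⟩ := hw
  refine ⟨C, fun b hb => ⟨hC b hb, fun y _ => ?_⟩⟩
  have : 0 ≤ C := (norm_nonneg _).trans (hC b hb)
  rw [sub_self, norm_zero]
  positivity

theorem HasJet.mul {S B : Set ℂ} {g g' : ℂ → ℂ → ℂ} {w w' : ℂ → Fin 6 → ℂ} {d : ℝ}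
    (hd : ∀ b ∈ S, ∀ y ∈ B, ‖y - b‖ ≤ d) (h : HasJet S B g w) (h' : HasJet S B g' w') :
    HasJet S B (fun b y => g b y * g' b y) (fun b => jetMul (w b) (w' b)) := by
  obtain ⟨C, hC⟩ := h
  obtain ⟨C', hC'⟩ := h'
  -- The first entry bounds the product jet. The summands of the second account for the error of
  -- `g`, the error of `g'` and the truncation in `jetMul`.
  refine ⟨max (4 * (C * C')) (C * ((1 + (2 + 3 * d) * d) * C' + C' * d ^ 3) +
    (1 + (2 + 3 * d) * d) * C * C' + (12 + 9 * d) * (C * C')), fun b hb => ?_⟩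
  obtain ⟨h1, h2⟩ := hC b hb
  obtain ⟨h1', h2'⟩ := hC' b hb
  have hC0 : 0 ≤ C := (norm_nonneg _).trans h1
  have hC0' : 0 ≤ C' := (norm_nonneg _).trans h1'
  have hprod : ‖w b‖ * ‖w' b‖ ≤ C * C' := mul_le_mul h1 h1' (norm_nonneg _) hC0
  refine ⟨((norm_jetMul_le _ _).trans (by linarith)).trans (le_max_left _ _), fun y hy => ?_⟩
  refine le_trans ?_ (mul_le_mul_of_nonneg_right (le_max_right _ _) (by positivity))
  have hyd := hd b hb y hy
  have hd0 : 0 ≤ d := (norm_nonneg _).trans hyd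
  set t := ‖y - b‖ with ht
  have ht0 : 0 ≤ t := norm_nonneg _
  have hg' : ‖g' b y‖ ≤ (1 + (2 + 3 * d) * d) * C' + C' * d ^ 3 := by
    calc ‖g' b y‖ = ‖jetEval (w' b) (y - b) + (g' b y - jetEval (w' b) (y - b))‖ := by
          rw [add_sub_cancel]
      _ ≤ _ := norm_add_le _ _
      _ ≤ _ := add_le_add ((norm_jetEval_le _ hyd).trans
          (mul_le_mul_of_nonneg_left h1' (by positivity)))
          ((h2' y hy).trans (mul_le_mul_of_nonneg_left (pow_le_pow_left₀ ht0 hyd 3) hC0'))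
  have heq : g b y * g' b y - jetEval (jetMul (w b) (w' b)) (y - b) =
      (g b y - jetEval (w b) (y - b)) * g' b y +
      jetEval (w b) (y - b) * (g' b y - jetEval (w' b) (y - b)) +
      (jetEval (w b) (y - b) * jetEval (w' b) (y - b) -
        jetEval (jetMul (w b) (w' b)) (y - b)) := by ring
  rw [heq, add_mul, add_mul]
  refine norm_add₃_le.trans (add_le_add (add_le_add ?_ ?_) ?_)
  · rw [norm_mul]
    calc _ ≤ (C * t ^ 3) * ((1 + (2 + 3 * d) * d) * C' + C' * d ^ 3) :=
          mul_le_mul (h2 y hy) hg' (norm_nonneg _) (by positivity)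
      _ = _ := by ring
  · rw [norm_mul]
    calc _ ≤ ((1 + (2 + 3 * d) * d) * C) * (C' * t ^ 3) :=
          mul_le_mul ((norm_jetEval_le _ hyd).trans
            (mul_le_mul_of_nonneg_left h1 (by positivity))) (h2' y hy) (norm_nonneg _)
            (by positivity)
      _ = _ := by ring
  · refine (norm_jetEval_mul_sub_le _ _ hyd).trans ?_
    exact mul_le_mul_of_nonneg_right (mul_le_mul_of_nonneg_left hprod (by positivity))
      (by positivity)

end Jets

/-! ### Sandwiches between two copies of a near projection -/

section NearProjection

/-- A kernel that satisfies, with constants `M`, `c` and `ε`, the quantitative form of the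
boundedness, decay and limited local analytic projection conditions. -/
structure NearProjection (B S' : Set ℂ) (c : ℝ) (K : ℂ → ℂ → ℂ) (M ε : ℝ) : Prop where
  bddMeas : BddMeas (Function.uncurry K)
  bound : ∀ x y, ‖K x y‖ ≤ M
  row : ∀ x, ∫ y in B, ‖K x y‖ ≤ c
  col : ∀ y, ∫ x in B, ‖K x y‖ ≤ c
  cubic : ∀ x ∈ B, M * ∫ y in B, ‖K x y‖ * ‖y - x‖ ^ 3 ≤ ε
  holo : ∀ p ≤ 2, ∀ x ∈ S', ∀ z ∈ S', ‖x ^ p * K x z - ∫ y in B, K x y * y ^ p * K y z‖ ≤ ε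
  anti : ∀ p ≤ 2, ∀ x ∈ S', ∀ z ∈ S',
    ‖K x z * conj z ^ p - ∫ y in B, K x y * conj y ^ p * K y z‖ ≤ ε

/-- The kernel `∫ K(b, y) |y - b|² K(y, z) dy`. -/
noncomputable def secondKernel (B : Set ℂ) (K : ℂ → ℂ → ℂ) (b z : ℂ) : ℂ :=
  ∫ y in B, K b y * ((y - b) * conj (y - b)) * K y z

/-- The row `K(b, z) (w₀ + w₂ h̄ + w₅ h̄²) + w₄ N(b, z)`, where `h = z - b`. -/
noncomputable def rowEval (B : Set ℂ) (K : ℂ → ℂ → ℂ) (w : Fin 6 → ℂ) (b z : ℂ) : ℂ :=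
  K b z * (w 0 + w 2 * conj (z - b) + w 5 * conj (z - b) ^ 2) + w 4 * secondKernel B K b z

variable {B S S' : Set ℂ} {c M ε : ℝ} {K : ℂ → ℂ → ℂ}

theorem isFiniteMeasure_restrict_of_isCompact (hB : IsCompact B) :
    IsFiniteMeasure (volume.restrict B : Measure ℂ) :=
  ⟨by rw [Measure.restrict_apply_univ]; exact hB.measure_lt_top⟩

theorem integrable_mul_of_bound (hB : IsCompact B) {F : ℂ → ℂ} (hF : BddMeas F) {q : ℂ → ℂ}
    (hq : Measurable q) {C : ℝ} (hC : ∀ y ∈ B, ‖q y‖ ≤ C) :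
    IntegrableOn (fun y => F y * q y) B := by
  have := isFiniteMeasure_restrict_of_isCompact hB
  obtain ⟨D, hD0, hD⟩ := hF.norm_le
  refine Integrable.of_bound (hF.measurable.mul hq).aestronglyMeasurable (D * C) ?_
  refine (ae_restrict_iff' hB.measurableSet).2 (Eventually.of_forall fun y hy => ?_)
  rw [norm_mul]
  exact mul_le_mul (hD y) (hC y hy) (norm_nonneg _) hD0

namespace NearProjection

theorem row_bddMeas (hK : NearProjection B S' c K M ε) (x : ℂ) : BddMeas (K x) :=
  bddMeas_kernel hK.bddMeas measurable_const measurable_id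

theorem col_bddMeas (hK : NearProjection B S' c K M ε) (y : ℂ) : BddMeas (fun x => K x y) :=
  bddMeas_kernel hK.bddMeas measurable_id measurable_const

theorem integrable_sandwich (hK : NearProjection B S' c K M ε) (hB : IsCompact B) (b z : ℂ)
    {q : ℂ → ℂ} (hq : Measurable q) {C : ℝ} (hC : ∀ y ∈ B, ‖q y‖ ≤ C) :
    IntegrableOn (fun y => K b y * q y * K y z) B := by
  refine (integrable_mul_of_bound hB ((hK.row_bddMeas b).mul (hK.col_bddMeas z)) hq hC).congr
    (Eventually.of_forall fun y => ?_)
  simp only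
  ring

theorem integrable_norm_mul (hK : NearProjection B S' c K M ε) (hB : IsCompact B) (b : ℂ)
    {q : ℂ → ℝ} (hq : Continuous q) : IntegrableOn (fun y => ‖K b y‖ * q y) B := by
  obtain ⟨C, hC⟩ := hB.exists_bound_of_continuousOn hq.continuousOn
  have := (integrable_mul_of_bound hB (hK.row_bddMeas b) (q := fun y => (q y : ℂ))
    (Complex.measurable_ofReal.comp hq.measurable) (C := C) (by simpa using hC)).norm
  refine ((integrable_mul_of_bound hB (F := fun y => (‖K b y‖ : ℂ)) ⟨?_, M, ?_⟩
    (q := fun y => (q y : ℂ)) (Complex.measurable_ofReal.comp hq.measurable) (C := C)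
    (by simpa using hC)).re).congr (Eventually.of_forall fun y => ?_)
  · exact Complex.measurable_ofReal.comp (hK.row_bddMeas b).measurable.norm
  · intro y; simpa using hK.bound b y
  · simp [← Complex.ofReal_mul]

theorem nonneg (hK : NearProjection B S' c K M ε) : 0 ≤ M ∧ 0 ≤ c := by
  exact ⟨(norm_nonneg _).trans (hK.bound 0 0),
    (integral_nonneg fun _ => norm_nonneg _).trans (hK.row 0)⟩

/-- A factor with a cubic zero at the base point makes a sandwich small. -/
theorem norm_sandwich_cubic_le (hK : NearProjection B S' c K M ε) (hB : IsCompact B) {b : ℂ}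
    (hb : b ∈ B) (z : ℂ) {e : ℂ → ℂ} {C : ℝ} (hC0 : 0 ≤ C)
    (hC : ∀ y ∈ B, ‖e y‖ ≤ C * ‖y - b‖ ^ 3) :
    ‖∫ y in B, K b y * e y * K y z‖ ≤ C * ε := by
  have h1 : ‖∫ y in B, K b y * e y * K y z‖ ≤
      ∫ y in B, C * M * (‖K b y‖ * ‖y - b‖ ^ 3) := by
    refine norm_integral_le_of_norm_le
      ((hK.integrable_norm_mul hB b (by fun_prop)).const_mul _) ?_
    refine (ae_restrict_iff' hB.measurableSet).2 (Eventually.of_forall fun y hy => ?_)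
    rw [norm_mul, norm_mul]
    calc ‖K b y‖ * ‖e y‖ * ‖K y z‖ ≤ ‖K b y‖ * (C * ‖y - b‖ ^ 3) * M :=
          mul_le_mul (mul_le_mul_of_nonneg_left (hC y hy) (norm_nonneg _)) (hK.bound y z)
            (norm_nonneg _) (by positivity)
      _ = _ := by ring
  rw [integral_const_mul, mul_assoc] at h1
  exact h1.trans (mul_le_mul_of_nonneg_left (hK.cubic b hb) hC0)

/-- The jet is evaluated monomial by monomial through `holo` and `anti`: `h` and `h²` are evaluated
at `b`, giving zero, while `h̄` and `h̄²` are evaluated at `z`; the mixed monomial is kept exactly,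
as `secondKernel`. The factor `6` counts the cubic remainder and the five monomials other than the
mixed one. -/
theorem norm_sandwich_jet_sub_le (hK : NearProjection B S' c K M ε) (hB : IsCompact B) {R : ℝ}
    (hR : ∀ y ∈ B, ‖y‖ ≤ R) {b z : ℂ} (hbB : b ∈ B) (hb : b ∈ S') (hz : z ∈ S') {e : ℂ → ℂ}
    (he : Measurable e) {D : ℝ} (heD : ∀ y ∈ B, ‖e y‖ ≤ D) {w : Fin 6 → ℂ} {C : ℝ}
    (hw : ‖w‖ ≤ C) (hC : ∀ y ∈ B, ‖e y - jetEval w (y - b)‖ ≤ C * ‖y - b‖ ^ 3) :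
    ‖(∫ y in B, K b y * e y * K y z) - rowEval B K w b z‖ ≤ 6 * (1 + R) ^ 2 * C * ε := by
  have hC0 : 0 ≤ C := (norm_nonneg _).trans hw
  have hR0 : 0 ≤ R := (norm_nonneg _).trans (hR b hbB)
  have hε : 0 ≤ ε := (norm_nonneg _).trans (hK.holo 0 (by norm_num) b hb z hz)
  let I : (ℂ → ℂ) → ℂ := fun q => ∫ y in B, K b y * q y * K y z
  have hcont : ∀ {q : ℂ → ℂ}, Continuous q → IntegrableOn (fun y => K b y * q y * K y z) B := by
    intro q hq
    obtain ⟨D, hD⟩ := hB.exists_bound_of_continuousOn hq.continuousOn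
    exact hK.integrable_sandwich hB b z hq.measurable hD
  have hIlin : ∀ (a₁ a₂ : ℂ) (q₁ q₂ : ℂ → ℂ), Continuous q₁ → Continuous q₂ →
      I (fun y => a₁ * q₁ y + a₂ * q₂ y) = a₁ * I q₁ + a₂ * I q₂ := by
    intro a₁ a₂ q₁ q₂ h1 h2
    simp only [I]
    rw [← integral_const_mul, ← integral_const_mul, ← integral_add ((hcont h1).const_mul _)
      ((hcont h2).const_mul _)]
    refine integral_congr_ae (Eventually.of_forall fun y => ?_)
    simp only
    ring
  have hbR : ‖b‖ ≤ R := hR b hbB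
  have h1 : ‖I (fun _ => 1) - K b z‖ ≤ ε := by
    have := hK.holo 0 (by norm_num) b hb z hz
    rw [norm_sub_rev]
    simpa [I] using this
  have hy : ‖I (fun y => y) - b * K b z‖ ≤ ε := by
    have := hK.holo 1 (by norm_num) b hb z hz
    rw [norm_sub_rev]
    simpa [I] using this
  have hyy : ‖I (fun y => y ^ 2) - b ^ 2 * K b z‖ ≤ ε := by
    have := hK.holo 2 (by norm_num) b hb z hz
    rw [norm_sub_rev]
    simpa [I] using this
  have hcy : ‖I (fun y => conj y) - K b z * conj z‖ ≤ ε := by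
    have := hK.anti 1 (by norm_num) b hb z hz
    rw [norm_sub_rev]
    simpa [I] using this
  have hcyy : ‖I (fun y => conj y ^ 2) - K b z * conj z ^ 2‖ ≤ ε := by
    have := hK.anti 2 (by norm_num) b hb z hz
    rw [norm_sub_rev]
    simpa [I] using this
  have cconj : Continuous (fun y : ℂ => conj y) := Complex.continuous_conj
  have h1R : (1 + R) * ε ≤ (1 + R) ^ 2 * ε :=
    mul_le_mul_of_nonneg_right (by nlinarith) hε
  have hRε : 0 ≤ R * ε := mul_nonneg hR0 hε
  have hh : ‖I (fun y => y - b)‖ ≤ (1 + R) ^ 2 * ε := by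
    have : I (fun y => y - b) = (I (fun y => y) - b * K b z) - b * (I (fun _ => 1) - K b z) := by
      have := hIlin 1 (-b) (fun y => y) (fun _ => 1) continuous_id continuous_const
      rw [show (fun y : ℂ => y - b) = fun y => 1 * y + -b * 1 by ext y; ring, this]
      ring
    rw [this]
    refine (norm_sub_le _ _).trans ?_
    rw [norm_mul]
    have := mul_le_mul hbR h1 (norm_nonneg _) hR0
    linarith
  have hhc : ‖I (fun y => conj (y - b)) - conj (z - b) * K b z‖ ≤ (1 + R) ^ 2 * ε := by
    have : I (fun y => conj (y - b)) - conj (z - b) * K b z =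
        (I (fun y => conj y) - K b z * conj z) - conj b * (I (fun _ => 1) - K b z) := by
      have := hIlin 1 (-conj b) (fun y => conj y) (fun _ => 1) cconj continuous_const
      rw [show (fun y : ℂ => conj (y - b)) = fun y => 1 * conj y + -conj b * 1 by
        ext y; simp; ring, this, map_sub]
      ring
    rw [this]
    refine (norm_sub_le _ _).trans ?_
    rw [norm_mul, RCLike.norm_conj]
    have := mul_le_mul hbR h1 (norm_nonneg _) hR0
    linarith
  have hhh : ‖I (fun y => (y - b) ^ 2)‖ ≤ (1 + R) ^ 2 * ε := by
    have : I (fun y => (y - b) ^ 2) = (I (fun y => y ^ 2) - b ^ 2 * K b z) -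
        2 * (b * (I (fun y => y) - b * K b z)) + b ^ 2 * (I (fun _ => 1) - K b z) := by
      have e1 := hIlin 1 1 (fun y => y ^ 2) (fun y => -2 * b * y + b ^ 2 * 1) (by fun_prop)
        (by fun_prop)
      have e2 := hIlin (-2 * b) (b ^ 2) (fun y => y) (fun _ => 1) continuous_id continuous_const
      rw [show (fun y : ℂ => (y - b) ^ 2) = fun y => 1 * y ^ 2 + 1 * (-2 * b * y + b ^ 2 * 1) by
        ext y; ring, e1, e2]
      ring
    rw [this]
    refine (norm_add_le _ _).trans ((add_le_add_left (norm_sub_le _ _) _).trans ?_)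
    simp only [norm_mul, norm_pow, RCLike.norm_ofNat]
    have t1 := mul_le_mul hbR hy (norm_nonneg _) hR0
    have t2 := mul_le_mul (pow_le_pow_left₀ (norm_nonneg _) hbR 2) h1 (norm_nonneg _)
      (by positivity)
    nlinarith
  have hhhc : ‖I (fun y => conj (y - b) ^ 2) - conj (z - b) ^ 2 * K b z‖ ≤ (1 + R) ^ 2 * ε := by
    have : I (fun y => conj (y - b) ^ 2) - conj (z - b) ^ 2 * K b z =
        (I (fun y => conj y ^ 2) - K b z * conj z ^ 2) -
        2 * (conj b * (I (fun y => conj y) - K b z * conj z)) +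
        conj b ^ 2 * (I (fun _ => 1) - K b z) := by
      have e1 := hIlin 1 1 (fun y => conj y ^ 2) (fun y => -2 * conj b * conj y + conj b ^ 2 * 1)
        (by fun_prop) (by fun_prop)
      have e2 := hIlin (-2 * conj b) (conj b ^ 2) (fun y => conj y) (fun _ => 1) cconj
        continuous_const
      rw [show (fun y : ℂ => conj (y - b) ^ 2) = fun y => 1 * conj y ^ 2 +
        1 * (-2 * conj b * conj y + conj b ^ 2 * 1) by ext y; simp; ring, e1, e2, map_sub]
      ring
    rw [this]
    refine (norm_add_le _ _).trans ((add_le_add_left (norm_sub_le _ _) _).trans ?_)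
    simp only [norm_mul, norm_pow, RCLike.norm_conj, RCLike.norm_ofNat]
    have t1 := mul_le_mul hbR hcy (norm_nonneg _) hR0
    have t2 := mul_le_mul (pow_le_pow_left₀ (norm_nonneg _) hbR 2) h1 (norm_nonneg _)
      (by positivity)
    nlinarith
  have hjc : Continuous (fun y => jetEval w (y - b)) := by unfold jetEval; fun_prop
  obtain ⟨D', hD'⟩ := hB.exists_bound_of_continuousOn hjc.continuousOn
  have hsplit : (∫ y in B, K b y * e y * K y z) =
      (∫ y in B, K b y * (e y - jetEval w (y - b)) * K y z) + I (fun y => jetEval w (y - b)) := by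
    simp only [I]
    rw [← integral_add (hK.integrable_sandwich hB b z (q := fun y => e y - jetEval w (y - b))
      (by exact he.sub hjc.measurable) (C := D + D')
      fun y hy => (norm_sub_le _ _).trans (add_le_add (heD y hy) (hD' y hy))) (hcont hjc)]
    refine integral_congr_ae (Eventually.of_forall fun y => ?_)
    simp only
    ring
  have hjet : I (fun y => jetEval w (y - b)) = w 0 * I (fun _ => 1) + (w 1 * I (fun y => y - b) +
      w 2 * I (fun y => conj (y - b))) + (w 3 * I (fun y => (y - b) ^ 2) +
      w 4 * secondKernel B K b z + w 5 * I (fun y => conj (y - b) ^ 2)) := by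
    have e1 := hIlin (w 1) (w 2) (fun y => y - b) (fun y => conj (y - b)) (by fun_prop)
      (by fun_prop)
    have e2 := hIlin (w 3) (w 4) (fun y => (y - b) ^ 2) (fun y => (y - b) * conj (y - b))
      (by fun_prop) (by fun_prop)
    have e3 := hIlin 1 (w 5) (fun y => w 3 * (y - b) ^ 2 + w 4 * ((y - b) * conj (y - b)))
      (fun y => conj (y - b) ^ 2) (by fun_prop) (by fun_prop)
    have e4 := hIlin (w 0) 1 (fun _ => 1) (fun y => w 1 * (y - b) + w 2 * conj (y - b))
      (by fun_prop) (by fun_prop)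
    have e5 := hIlin 1 1 (fun y => w 0 * 1 + 1 * (w 1 * (y - b) + w 2 * conj (y - b)))
      (fun y => 1 * (w 3 * (y - b) ^ 2 + w 4 * ((y - b) * conj (y - b))) +
        w 5 * conj (y - b) ^ 2) (by fun_prop) (by fun_prop)
    have hfun : (fun y => jetEval w (y - b)) = fun y =>
        1 * (w 0 * 1 + 1 * (w 1 * (y - b) + w 2 * conj (y - b))) +
        1 * (1 * (w 3 * (y - b) ^ 2 + w 4 * ((y - b) * conj (y - b))) +
        w 5 * conj (y - b) ^ 2) := by
      ext y; rw [jetEval]; ring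
    rw [hfun, e5, e4, e3, e2, e1]
    simp only [one_mul]
    rfl
  have hfinal : (∫ y in B, K b y * e y * K y z) - rowEval B K w b z =
      (∫ y in B, K b y * (e y - jetEval w (y - b)) * K y z) +
      w 0 * (I (fun _ => 1) - K b z) + w 1 * I (fun y => y - b) +
      w 2 * (I (fun y => conj (y - b)) - conj (z - b) * K b z) + w 3 * I (fun y => (y - b) ^ 2) +
      w 5 * (I (fun y => conj (y - b) ^ 2) - conj (z - b) ^ 2 * K b z) := by
    rw [hsplit, hjet, rowEval]
    ring
  have hmul : ∀ (i : Fin 6) {x : ℂ} {a : ℝ}, ‖x‖ ≤ a → ‖w i * x‖ ≤ C * a := by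
    intro i x a hx
    rw [norm_mul]
    exact mul_le_mul ((norm_le_pi_norm w i).trans hw) hx (norm_nonneg _) hC0
  have h1' : ‖I (fun _ => 1) - K b z‖ ≤ (1 + R) ^ 2 * ε := h1.trans (by linarith)
  have hcub := hK.norm_sandwich_cubic_le hB hbB z hC0 hC
  have hcub' : C * ε ≤ C * ((1 + R) ^ 2 * ε) := mul_le_mul_of_nonneg_left (by linarith) hC0
  rw [hfinal]
  have n1 := norm_add_le ((∫ y in B, K b y * (e y - jetEval w (y - b)) * K y z) +
      w 0 * (I (fun _ => 1) - K b z) + w 1 * I (fun y => y - b) +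
      w 2 * (I (fun y => conj (y - b)) - conj (z - b) * K b z) + w 3 * I (fun y => (y - b) ^ 2))
      (w 5 * (I (fun y => conj (y - b) ^ 2) - conj (z - b) ^ 2 * K b z))
  have n2 := norm_add_le ((∫ y in B, K b y * (e y - jetEval w (y - b)) * K y z) +
      w 0 * (I (fun _ => 1) - K b z) + w 1 * I (fun y => y - b) +
      w 2 * (I (fun y => conj (y - b)) - conj (z - b) * K b z)) (w 3 * I (fun y => (y - b) ^ 2))
  have n3 := norm_add_le ((∫ y in B, K b y * (e y - jetEval w (y - b)) * K y z) +
      w 0 * (I (fun _ => 1) - K b z) + w 1 * I (fun y => y - b))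
      (w 2 * (I (fun y => conj (y - b)) - conj (z - b) * K b z))
  have n4 := norm_add₃_le (a := ∫ y in B, K b y * (e y - jetEval w (y - b)) * K y z)
      (b := w 0 * (I (fun _ => 1) - K b z)) (c := w 1 * I (fun y => y - b))
  have m0 := hmul 0 h1'
  have m1 := hmul 1 hh
  have m2 := hmul 2 hhc
  have m3 := hmul 3 hhh
  have m5 := hmul 5 hhhc
  linarith

end NearProjection

end NearProjection

end DetCLT

namespace DetCLT

open scoped ComplexConjugate

/-! ### Stability of the row form under composition -/

section RowApprox

/-- `S` lies in `S' ⊆ B`, at distance at least `δ` from `B \ S'`, and `B` is compact and contained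
in the disc of radius `R`. -/
structure Nested (S S' B : Set ℂ) (δ R : ℝ) : Prop where
  isCompact : IsCompact B
  subset_left : S ⊆ S'
  subset_right : S' ⊆ B
  pos : 0 < δ
  le_norm_sub : ∀ b ∈ S, ∀ y ∈ B, y ∉ S' → δ ≤ ‖y - b‖
  norm_le : ∀ y ∈ B, ‖y‖ ≤ R

variable {B S S' : Set ℂ} {c M ε δ R : ℝ} {K : ℂ → ℂ → ℂ}

theorem Nested.norm_sub_le (h : Nested S S' B δ R) {b : ℂ} (hb : b ∈ S) {y : ℂ} (hy : y ∈ B) :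
    ‖y - b‖ ≤ 2 * R := by
  have h1 := h.norm_le y hy
  have h2 := h.norm_le b (h.subset_right (h.subset_left hb))
  linarith [_root_.norm_sub_le y b]

theorem NearProjection.eps_nonneg (hK : NearProjection B S' c K M ε) {x : ℂ} (hx : x ∈ S') :
    0 ≤ ε :=
  (norm_nonneg _).trans (hK.holo 0 (by norm_num) x hx x hx)

theorem NearProjection.norm_sandwich_le (hK : NearProjection B S' c K M ε) (hB : IsCompact B)
    (x z : ℂ) {e : ℂ → ℂ} {C : ℝ} (hC0 : 0 ≤ C) (hC : ∀ y ∈ B, ‖e y‖ ≤ C) :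
    ‖∫ y in B, K x y * e y * K y z‖ ≤ C * c * M := by
  have h1 : ‖∫ y in B, K x y * e y * K y z‖ ≤ ∫ y in B, C * M * (‖K x y‖ * 1) := by
    refine norm_integral_le_of_norm_le
      ((hK.integrable_norm_mul hB x (by fun_prop)).const_mul _) ?_
    refine (ae_restrict_iff' hB.measurableSet).2 (Eventually.of_forall fun y hy => ?_)
    rw [norm_mul, norm_mul]
    calc ‖K x y‖ * ‖e y‖ * ‖K y z‖ ≤ ‖K x y‖ * C * M :=
          mul_le_mul (mul_le_mul_of_nonneg_left (hC y hy) (norm_nonneg _)) (hK.bound y z)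
            (norm_nonneg _) (by positivity)
      _ = _ := by ring
  rw [integral_const_mul] at h1
  simp only [mul_one] at h1
  refine h1.trans ?_
  have := mul_le_mul_of_nonneg_left (hK.row x) (mul_nonneg hC0 hK.nonneg.1)
  linarith

/-- The restriction of a factor to the first variable of a sandwich, when the quadratic weight
vanishes at the base point. -/
theorem NearProjection.norm_weighted_sandwich_le (hK : NearProjection B S' c K M ε)
    (hB : IsCompact B) {b z x : ℂ} (hx : x ∈ B) {e : ℂ → ℂ} {e₀ : ℂ} {C : ℝ}
    (hC0 : 0 ≤ C) (hC : ∀ y ∈ B, ‖e y - e₀‖ ≤ C * ‖y - b‖) :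
    ‖x - b‖ ^ 2 * ‖∫ y in B, K x y * (e y - e₀) * K y z‖ ≤
      C * (2 * c * M * ‖x - b‖ ^ 3 + ε) := by
  have hM := hK.nonneg.1
  -- Separates the weight `‖x - b‖² ‖y - b‖` into a cube of `‖x - b‖` and a cube of `‖y - x‖`; the
  -- latter is integrated at once by `cubic`, the former is left for the integral over `x`.
  have key : ∀ u v : ℝ, 0 ≤ u → 0 ≤ v → u ^ 2 * (u + v) ≤ 2 * u ^ 3 + v ^ 3 := by
    intro u v hu hv
    nlinarith [mul_nonneg hu (sq_nonneg (u - v)), mul_nonneg hv (sq_nonneg (u - v)),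
      mul_nonneg hu hv, pow_nonneg hu 3, pow_nonneg hv 3]
  have hI1 := hK.integrable_norm_mul hB x (q := fun _ => 1) (by fun_prop)
  have hI3 := hK.integrable_norm_mul hB x (q := fun y => ‖y - x‖ ^ 3) (by fun_prop)
  have h1 : ‖((‖x - b‖ ^ 2 : ℝ) : ℂ) * ∫ y in B, K x y * (e y - e₀) * K y z‖ ≤
      ∫ y in B, (2 * C * M * ‖x - b‖ ^ 3 * (‖K x y‖ * 1) + C * M * (‖K x y‖ * ‖y - x‖ ^ 3)) := by
    rw [← integral_const_mul]
    refine norm_integral_le_of_norm_le ((hI1.const_mul _).add (hI3.const_mul _)) ?_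
    refine (ae_restrict_iff' hB.measurableSet).2 (Eventually.of_forall fun y hy => ?_)
    rw [norm_mul, norm_mul, norm_mul, Complex.norm_real, Real.norm_of_nonneg (by positivity)]
    have ht : ‖y - b‖ ≤ ‖x - b‖ + ‖y - x‖ := by
      rw [show y - b = (x - b) + (y - x) by ring]
      exact norm_add_le _ _
    calc ‖x - b‖ ^ 2 * (‖K x y‖ * ‖e y - e₀‖ * ‖K y z‖)
        ≤ ‖x - b‖ ^ 2 * (‖K x y‖ * (C * (‖x - b‖ + ‖y - x‖)) * M) := by
          refine mul_le_mul_of_nonneg_left (mul_le_mul (mul_le_mul_of_nonneg_left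
            ((hC y hy).trans (mul_le_mul_of_nonneg_left ht hC0)) (norm_nonneg _))
            (hK.bound y z) (norm_nonneg _) (by positivity)) (by positivity)
      _ = C * M * ‖K x y‖ * (‖x - b‖ ^ 2 * (‖x - b‖ + ‖y - x‖)) := by ring
      _ ≤ C * M * ‖K x y‖ * (2 * ‖x - b‖ ^ 3 + ‖y - x‖ ^ 3) :=
          mul_le_mul_of_nonneg_left (key _ _ (norm_nonneg _) (norm_nonneg _)) (by positivity)
      _ = _ := by ring
  rw [norm_mul, Complex.norm_real, Real.norm_of_nonneg (by positivity), integral_add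
    (hI1.const_mul _) (hI3.const_mul _), integral_const_mul, integral_const_mul] at h1
  simp only [mul_one] at h1
  refine h1.trans ?_
  have h2 := mul_le_mul_of_nonneg_left (hK.row x)
    (show 0 ≤ 2 * C * M * ‖x - b‖ ^ 3 by positivity)
  have h3 := mul_le_mul_of_nonneg_left (hK.cubic x hx) hC0
  linarith

/-- For `x` in `S'` the reproducing property bounds the defect by `ε`. Elsewhere only boundedness is
available, but then `‖x - b‖ ≥ δ`, and the quadratic weight is at most `‖x - b‖³ / δ`, which cubic
decay can absorb. -/
theorem NearProjection.norm_weighted_defect_le (hK : NearProjection B S' c K M ε)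
    (h : Nested S S' B δ R) {b z x : ℂ} (hb : b ∈ S) (hz : z ∈ S) (hx : x ∈ B) :
    ‖x - b‖ ^ 2 * ‖(∫ y in B, K x y * K y z) - K x z‖ ≤
      (2 * R) ^ 2 * ε + (c + 1) * M / δ * ‖x - b‖ ^ 3 := by
  have hε := hK.eps_nonneg (h.subset_left hb)
  have hM := hK.nonneg.1
  have hc := hK.nonneg.2
  have hδ := h.pos
  have hd := h.norm_sub_le hb hx
  by_cases hxS : x ∈ S'
  · have h1 := hK.holo 0 (by norm_num) x hxS z (h.subset_left hz)
    simp only [pow_zero, one_mul, mul_one] at h1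
    rw [norm_sub_rev] at h1
    have h2 := mul_le_mul (pow_le_pow_left₀ (norm_nonneg _) hd 2) h1 (norm_nonneg _)
      (by positivity)
    have : 0 ≤ (c + 1) * M / δ * ‖x - b‖ ^ 3 := by positivity
    linarith
  · have h1 : ‖(∫ y in B, K x y * K y z) - K x z‖ ≤ (c + 1) * M := by
      have h2 := hK.norm_sandwich_le h.isCompact x z (e := fun _ => 1) (C := 1) zero_le_one
        (by simp)
      simp only [mul_one, one_mul] at h2
      have := hK.bound x z
      linarith [_root_.norm_sub_le (∫ y in B, K x y * K y z) (K x z)]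
    have h2 := h.le_norm_sub b hb x hx hxS
    have h3 : ‖x - b‖ ^ 2 ≤ ‖x - b‖ ^ 3 / δ := by
      rw [le_div_iff₀ hδ]
      calc ‖x - b‖ ^ 2 * δ ≤ ‖x - b‖ ^ 2 * ‖x - b‖ := mul_le_mul_of_nonneg_left h2 (by positivity)
        _ = _ := by ring
    have h4 := mul_le_mul h3 h1 (norm_nonneg _) (by positivity)
    have h5 : ‖x - b‖ ^ 3 / δ * ((c + 1) * M) = (c + 1) * M / δ * ‖x - b‖ ^ 3 := by ring
    have : 0 ≤ (2 * R) ^ 2 * ε := by positivity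
    linarith

theorem bddMeas_indicator (hB : IsCompact B) {q : ℂ → ℂ} (hq : Continuous q) :
    BddMeas (B.indicator q) := by
  obtain ⟨C, hC⟩ := hB.exists_bound_of_continuousOn hq.continuousOn
  refine ⟨hq.measurable.indicator hB.measurableSet, max C 0, fun x => ?_⟩
  by_cases hx : x ∈ B
  · rw [Set.indicator_of_mem hx]
    exact (hC x hx).trans (le_max_left _ _)
  · simp [hx]

theorem NearProjection.integral_secondKernel (hK : NearProjection B S' c K M ε)
    (hB : IsCompact B) {e : ℂ → ℂ} (he : BddMeas e) (b z : ℂ) :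
    ∫ y in B, secondKernel B K b y * e y * K y z =
      ∫ x in B, K b x * ((x - b) * conj (x - b)) * ∫ y in B, K x y * e y * K y z := by
  have := isFiniteMeasure_restrict_of_isCompact hB
  -- The weight is cut off outside `B` so as to be bounded on the whole plane, as `BddMeas` demands.
  let q : ℂ → ℂ := B.indicator fun x => (x - b) * conj (x - b)
  have hq : BddMeas q := bddMeas_indicator hB (by fun_prop)
  have hqeq : ∀ x ∈ B, q x = (x - b) * conj (x - b) := fun x hx => Set.indicator_of_mem hx _
  have h1 : ∀ y, secondKernel B K b y = ∫ x in B, K b x * q x * K x y := fun y =>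
    setIntegral_congr_fun hB.measurableSet fun x hx => by simp only [hqeq x hx]
  have hint : BddMeas (fun p : ℂ × ℂ => K b p.2 * q p.2 * K p.2 p.1 * e p.1 * K p.1 z) :=
    ((((bddMeas_kernel hK.bddMeas measurable_const measurable_snd).mul
      (hq.comp measurable_snd)).mul (bddMeas_kernel hK.bddMeas measurable_snd measurable_fst)).mul
      (he.comp measurable_fst)).mul (bddMeas_kernel hK.bddMeas measurable_fst measurable_const)
  calc ∫ y in B, secondKernel B K b y * e y * K y z
      = ∫ y in B, ∫ x in B, K b x * q x * K x y * e y * K y z := by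
        refine integral_congr_ae (Eventually.of_forall fun y => ?_)
        beta_reduce
        rw [h1, mul_assoc, ← integral_mul_const]
        simp only [mul_assoc]
    _ = ∫ x in B, ∫ y in B, K b x * q x * K x y * e y * K y z :=
        integral_integral_swap (hint.integrable _)
    _ = _ := by
        refine setIntegral_congr_fun hB.measurableSet fun x hx => ?_
        rw [← hqeq x hx, ← integral_const_mul]
        simp only [mul_assoc]

/-- Only the constant term of `e` is visible to `secondKernel`: its weight is already quadratic, so
the variation of `e` is of third order. The constant term leaves `secondKernel` composed with `K`,
which reproduces `secondKernel` up to the weighted defect. -/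
theorem NearProjection.norm_secondKernel_sandwich_le (hK : NearProjection B S' c K M ε)
    (h : Nested S S' B δ R) {b z : ℂ} (hb : b ∈ S) (hz : z ∈ S) {e : ℂ → ℂ} (he : BddMeas e)
    {e₀ : ℂ} {C : ℝ} (he₀ : ‖e₀‖ ≤ C) (hC : ∀ y ∈ B, ‖e y - e₀‖ ≤ C * ‖y - b‖) :
    ‖(∫ y in B, secondKernel B K b y * e y * K y z) - e₀ * secondKernel B K b z‖ ≤
      C * (3 * c + (2 * R) ^ 2 * c + (c + 1) / δ) * ε := by
  have hB := h.isCompact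
  have := isFiniteMeasure_restrict_of_isCompact hB
  have hC0 : 0 ≤ C := (norm_nonneg _).trans he₀
  have hM := hK.nonneg.1
  have hc := hK.nonneg.2
  have hδ := h.pos
  have hε := hK.eps_nonneg (h.subset_left hb)
  have hbB : b ∈ B := h.subset_right (h.subset_left hb)
  have hI1 := hK.integrable_norm_mul hB b (q := fun _ => 1) (by fun_prop)
  have hI3 := hK.integrable_norm_mul hB b (q := fun y => ‖y - b‖ ^ 3) (by fun_prop)
  have hcw : Continuous (fun x : ℂ => (x - b) * conj (x - b)) := by fun_prop
  obtain ⟨W, hW⟩ := hB.exists_bound_of_continuousOn hcw.continuousOn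
  have hin : BddMeas (fun x => ∫ y in B, K x y * e y * K y z) :=
    BddMeas.integral_right (f := fun p : ℂ × ℂ => K p.1 p.2 * e p.2 * K p.2 z)
      (((bddMeas_kernel hK.bddMeas measurable_fst measurable_snd).mul
      (he.comp measurable_snd)).mul (bddMeas_kernel hK.bddMeas measurable_snd measurable_const)) _
  have hi1 : IntegrableOn (fun x => K b x * ((x - b) * conj (x - b)) *
      ∫ y in B, K x y * e y * K y z) B :=
    (integrable_mul_of_bound hB ((hK.row_bddMeas b).mul hin) hcw.measurable hW).congr
      (Eventually.of_forall fun x => by simp only; ring)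
  have hi2 : IntegrableOn (fun x => K b x * ((x - b) * conj (x - b)) * K x z) B :=
    hK.integrable_sandwich hB b z hcw.measurable hW
  have hdiff : (∫ y in B, secondKernel B K b y * e y * K y z) - e₀ * secondKernel B K b z =
      ∫ x in B, K b x * ((x - b) * conj (x - b)) *
        ((∫ y in B, K x y * (e y - e₀) * K y z) +
          e₀ * ((∫ y in B, K x y * K y z) - K x z)) := by
    rw [hK.integral_secondKernel hB he, secondKernel, ← integral_const_mul, ← integral_sub hi1
      (hi2.const_mul _)]
    refine integral_congr_ae (Eventually.of_forall fun x => ?_)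
    have hs : ∫ y in B, K x y * (e y - e₀) * K y z =
        (∫ y in B, K x y * e y * K y z) - e₀ * ∫ y in B, K x y * K y z := by
      rw [← integral_const_mul, ← integral_sub]
      · refine integral_congr_ae (Eventually.of_forall fun y => ?_)
        simp only
        ring
      · exact (((hK.row_bddMeas x).mul he).mul (hK.col_bddMeas z)).integrable _
      · exact (((hK.row_bddMeas x).mul (hK.col_bddMeas z)).integrable _).const_mul _
    simp only
    rw [hs]
    ring
  have hbound : ‖∫ x in B, K b x * ((x - b) * conj (x - b)) *
        ((∫ y in B, K x y * (e y - e₀) * K y z) +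
          e₀ * ((∫ y in B, K x y * K y z) - K x z))‖ ≤
      ∫ x in B, (C * (ε + (2 * R) ^ 2 * ε) * (‖K b x‖ * 1) +
        C * (2 * c + (c + 1) / δ) * M * (‖K b x‖ * ‖x - b‖ ^ 3)) := by
    refine norm_integral_le_of_norm_le ((hI1.const_mul _).add (hI3.const_mul _)) ?_
    refine (ae_restrict_iff' hB.measurableSet).2 (Eventually.of_forall fun x hx => ?_)
    have h1 := hK.norm_weighted_sandwich_le (z := z) hB hx hC0 hC
    have h2 := hK.norm_weighted_defect_le h hb hz hx
    rw [norm_mul, norm_mul, norm_mul, RCLike.norm_conj]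
    set I₁ := ∫ y in B, K x y * (e y - e₀) * K y z
    set I₂ := (∫ y in B, K x y * K y z) - K x z
    have h3 : ‖I₁ + e₀ * I₂‖ ≤ ‖I₁‖ + C * ‖I₂‖ := by
      refine (norm_add_le _ _).trans ?_
      rw [norm_mul]
      gcongr
    calc ‖K b x‖ * (‖x - b‖ * ‖x - b‖) * ‖I₁ + e₀ * I₂‖
        ≤ ‖K b x‖ * (‖x - b‖ * ‖x - b‖) * (‖I₁‖ + C * ‖I₂‖) := by gcongr
      _ = ‖K b x‖ * (‖x - b‖ ^ 2 * ‖I₁‖ + C * (‖x - b‖ ^ 2 * ‖I₂‖)) := by ring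
      _ ≤ ‖K b x‖ * (C * (2 * c * M * ‖x - b‖ ^ 3 + ε) +
          C * ((2 * R) ^ 2 * ε + (c + 1) * M / δ * ‖x - b‖ ^ 3)) := by gcongr
      _ = _ := by ring
  rw [hdiff]
  refine hbound.trans ?_
  rw [integral_add (hI1.const_mul _) (hI3.const_mul _), integral_const_mul, integral_const_mul]
  simp only [mul_one]
  have h1 := mul_le_mul_of_nonneg_left (hK.row b)
    (show 0 ≤ C * (ε + (2 * R) ^ 2 * ε) by positivity)
  have h2 := mul_le_mul_of_nonneg_left (hK.cubic b hbB)
    (show 0 ≤ C * (2 * c + (c + 1) / δ) by positivity)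
  calc _ ≤ C * (ε + (2 * R) ^ 2 * ε) * c + C * (2 * c + (c + 1) / δ) * ε := by
        refine add_le_add h1 ?_
        rw [mul_assoc (C * (2 * c + (c + 1) / δ))]
        exact h2
    _ = _ := by ring

/-- The kernels `F K` are approximated, along rows that start in `S`, by the rows with
coefficients `w`, uniformly over all near projections. -/
def RowApprox (B S S' : Set ℂ) (c : ℝ) (F : (ℂ → ℂ → ℂ) → ℂ → ℂ → ℂ) (w : ℂ → Fin 6 → ℂ) : Prop :=
  ∃ A : ℝ, 0 ≤ A ∧ (∀ b ∈ S, ‖w b‖ ≤ A) ∧ ∀ K M ε, NearProjection B S' c K M ε →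
    ∀ b ∈ S, ∀ z ∈ S, ‖F K b z - rowEval B K (w b) b z‖ ≤ A * ε

theorem rowEval_add (w v : Fin 6 → ℂ) (b z : ℂ) :
    rowEval B K (w + v) b z = rowEval B K w b z + rowEval B K v b z := by
  simp only [rowEval, Pi.add_apply]
  ring

theorem rowEval_neg (w : Fin 6 → ℂ) (b z : ℂ) :
    rowEval B K (-w) b z = -rowEval B K w b z := by
  simp only [rowEval, Pi.neg_apply]
  ring

theorem RowApprox.neg {F : (ℂ → ℂ → ℂ) → ℂ → ℂ → ℂ} {w : ℂ → Fin 6 → ℂ}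
    (h : RowApprox B S S' c F w) : RowApprox B S S' c (fun K b z => -F K b z) (-w) := by
  obtain ⟨A, hA, hw, hF⟩ := h
  refine ⟨A, hA, fun b hb => by simpa using hw b hb, fun K M ε hK b hb z hz => ?_⟩
  rw [Pi.neg_apply, rowEval_neg, ← neg_add', norm_neg, ← sub_eq_add_neg]
  exact hF K M ε hK b hb z hz

theorem RowApprox.add {F G : (ℂ → ℂ → ℂ) → ℂ → ℂ → ℂ} {w v : ℂ → Fin 6 → ℂ}
    (h : RowApprox B S S' c F w) (h' : RowApprox B S S' c G v) :
    RowApprox B S S' c (fun K b z => F K b z + G K b z) (w + v) := by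
  obtain ⟨A, hA, hw, hF⟩ := h
  obtain ⟨A', hA', hw', hG⟩ := h'
  refine ⟨A + A', by positivity, fun b hb => (norm_add_le _ _).trans
    (add_le_add (hw b hb) (hw' b hb)), fun K M ε hK b hb z hz => ?_⟩
  rw [Pi.add_apply, rowEval_add, add_mul, add_sub_add_comm]
  exact (norm_add_le _ _).trans
    (add_le_add (hF K M ε hK b hb z hz) (hG K M ε hK b hb z hz))

theorem RowApprox.zero : RowApprox B S S' c (fun _ _ _ => 0) 0 :=
  ⟨0, le_rfl, by simp, by simp [rowEval]⟩

theorem RowApprox.sum {ι : Type*} {s : Finset ι} {F : ι → (ℂ → ℂ → ℂ) → ℂ → ℂ → ℂ}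
    {w : ι → ℂ → Fin 6 → ℂ} (h : ∀ i ∈ s, RowApprox B S S' c (F i) (w i)) :
    RowApprox B S S' c (fun K b z => ∑ i ∈ s, F i K b z) (∑ i ∈ s, w i) := by
  classical
  induction s using Finset.induction with
  | empty => simpa using RowApprox.zero
  | insert a s ha ih =>
    simp only [Finset.sum_insert ha]
    exact (h a (by simp)).add (ih fun i hi => h i (by simp [hi]))

/-- The coefficients that `rowEval` depends on. -/
def rowPart (w : Fin 6 → ℂ) : Fin 6 → ℂ := ![w 0, 0, w 2, 0, w 4, w 5]

theorem norm_vec_le {w : Fin 6 → ℂ} (v : Fin 6 → ℂ) (h : ∀ i, v i = 0 ∨ v i = w i) :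
    ‖v‖ ≤ ‖w‖ := by
  refine (pi_norm_le_iff_of_nonneg (norm_nonneg _)).2 fun i => ?_
  rcases h i with h | h
  · rw [h, norm_zero]; exact norm_nonneg _
  · rw [h]; exact norm_le_pi_norm w i

theorem norm_rowPart_le (w : Fin 6 → ℂ) : ‖rowPart w‖ ≤ ‖w‖ :=
  norm_vec_le _ fun i => by fin_cases i <;> simp [rowPart]

/-- One step of the resolvent recursion. The part of the row carried by `K` is a jet times `K(b,
·)`, so multiplying by `e` is a jet product; the part carried by `secondKernel` is multiplied by
`e(b)`. Together they form the jet product with `rowPart`. Since `e` vanishes off `S`, the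
approximation of `F` is used on `S` only. -/
theorem RowApprox.sandwich (h : Nested S S' B δ R) {F : (ℂ → ℂ → ℂ) → ℂ → ℂ → ℂ}
    {w j : ℂ → Fin 6 → ℂ} (hF : RowApprox B S S' c F w)
    (hFm : ∀ K M ε, NearProjection B S' c K M ε → ∀ b, BddMeas (F K b)) {e : ℂ → ℂ}
    (he : BddMeas e) (heS : ∀ y ∉ S, e y = 0) (hj : HasJet S B (fun _ => e) j) :
    RowApprox B S S' c (fun K b z => ∫ s in B, F K b s * e s * K s z)
      (fun b => jetMul (rowPart (w b)) (j b)) := by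
  have hB := h.isCompact
  have := isFiniteMeasure_restrict_of_isCompact hB
  obtain ⟨A, hA, hw, hF⟩ := hF
  -- The row without its `secondKernel` part, as a polynomial in `s - b`.
  let w' : ℂ → Fin 6 → ℂ := fun b => ![w b 0, 0, w b 2, 0, 0, w b 5]
  have hw' : ∀ b ∈ S, ‖w' b‖ ≤ A := fun b hb =>
    (norm_vec_le _ fun i => by fin_cases i <;> simp [w']).trans (hw b hb)
  have hjet := (HasJet.of_eval (S := S) (B := B) ⟨A, hw'⟩).mul
    (fun b hb y hy => h.norm_sub_le hb hy) hj
  obtain ⟨C, hC⟩ := hjet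
  obtain ⟨C', hC'⟩ := hj
  obtain ⟨D, hD0, hD⟩ := he.norm_le
  rcases S.eq_empty_or_nonempty with hS | ⟨b₀, hb₀⟩
  · subst hS
    exact ⟨0, le_rfl, by simp, by simp⟩
  have hC0 : 0 ≤ C := (norm_nonneg _).trans (hC b₀ hb₀).1
  have hC0' : 0 ≤ C' := (norm_nonneg _).trans (hC' b₀ hb₀).1
  have hR0 : 0 ≤ R := (norm_nonneg _).trans (h.norm_le b₀ (h.subset_right (h.subset_left hb₀)))
  have hδ := h.pos
  -- `L` bounds both the value of `e` at `b` and its increments relative to `‖y - b‖`, since `‖y -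
  -- b‖ ≤ 2 R`.
  let L := C' * ((2 * R) ^ 2 + (3 + 3 * (2 * R)))
  have hL : C' ≤ L := by
    simp only [L]
    nlinarith [mul_nonneg hC0' hR0, mul_nonneg hC0' (sq_nonneg R)]
  -- `|c|` stands for `c`, whose sign is known only once a near projection is given.
  let Q := L * (3 * |c| + (2 * R) ^ 2 * |c| + (|c| + 1) / δ)
  have hL0 : 0 ≤ L := hC0'.trans hL
  have hQ : 0 ≤ Q := by positivity
  refine ⟨max (4 * (A * C')) (A * D * |c| + 6 * (1 + R) ^ 2 * C + A * Q),
    le_max_of_le_left (by positivity), fun b hb => ?_, fun K M ε hK b hb z hz => ?_⟩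
  · refine ((norm_jetMul_le _ _).trans ?_).trans (le_max_left _ _)
    have := mul_le_mul ((norm_rowPart_le _).trans (hw b hb)) (hC' b hb).1 (norm_nonneg _) hA
    linarith
  have hε := hK.eps_nonneg (h.subset_left hb)
  have hbS' := h.subset_left hb
  have hzS' := h.subset_left hz
  have hbB := h.subset_right hbS'
  have hc : c = |c| := (abs_of_nonneg hK.nonneg.2).symm
  refine le_trans ?_ (mul_le_mul_of_nonneg_right (le_max_right _ _) hε)
  have hjc : Continuous (fun y => jetEval (w' b) (y - b)) := by unfold jetEval; fun_prop
  obtain ⟨D', hD'⟩ := hB.exists_bound_of_continuousOn hjc.continuousOn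
  have hNm : BddMeas (secondKernel B K b) := by
    have := BddMeas.integral_right (f := fun p : ℂ × ℂ => K b p.2 *
        (B.indicator fun x => (x - b) * conj (x - b)) p.2 * K p.2 p.1)
      (((bddMeas_kernel hK.bddMeas measurable_const measurable_snd).mul
      ((bddMeas_indicator hB (by fun_prop)).comp measurable_snd)).mul
      (bddMeas_kernel hK.bddMeas measurable_snd measurable_fst)) (volume.restrict B)
    convert this using 1
    ext y
    exact setIntegral_congr_fun hB.measurableSet fun x hx => by
      simp only [Set.indicator_of_mem hx]
  have hrow : ∀ s, rowEval B K (w b) b s =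
      K b s * jetEval (w' b) (s - b) + w b 4 * secondKernel B K b s := by
    intro s
    simp only [rowEval, jetEval, w', Matrix.cons_val]
    ring
  have hi1 : IntegrableOn (fun s => (F K b s - rowEval B K (w b) b s) * e s * K s z) B := by
    have t1 := ((hFm K M ε hK b).mul (he.mul (hK.col_bddMeas z))).integrable (volume.restrict B)
    have t2 := integrable_mul_of_bound hB ((hK.row_bddMeas b).mul (he.mul (hK.col_bddMeas z)))
      hjc.measurable hD'
    have t3 := ((hNm.mul (he.mul (hK.col_bddMeas z))).integrable (volume.restrict B)).const_mul
      (w b 4)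
    refine ((t1.sub t2).sub t3).congr (Eventually.of_forall fun s => ?_)
    simp only [hrow, Pi.sub_apply]
    ring
  have hi2 : IntegrableOn (fun s => K b s * (jetEval (w' b) (s - b) * e s) * K s z) B :=
    hK.integrable_sandwich hB b z (hjc.measurable.mul he.measurable) (C := D' * D) fun y hy => by
      rw [norm_mul]
      exact mul_le_mul (hD' y hy) (hD y) (norm_nonneg _) ((norm_nonneg _).trans (hD' y hy))
  have hi3 : IntegrableOn (fun s => secondKernel B K b s * e s * K s z) B :=
    ((hNm.mul he).mul (hK.col_bddMeas z)).integrable _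
  have hsplit : (∫ s in B, F K b s * e s * K s z) =
      (∫ s in B, (F K b s - rowEval B K (w b) b s) * e s * K s z) +
      (∫ s in B, K b s * (jetEval (w' b) (s - b) * e s) * K s z) +
      w b 4 * ∫ s in B, secondKernel B K b s * e s * K s z := by
    rw [← integral_const_mul, ← integral_add hi1 hi2, ← integral_add (by exact hi1.add hi2)
      (hi3.const_mul _)]
    refine integral_congr_ae (Eventually.of_forall fun s => ?_)
    simp only [hrow]
    ring
  have hmul : rowEval B K (jetMul (rowPart (w b)) (j b)) b z =
      rowEval B K (jetMul (w' b) (j b)) b z + w b 4 * (j b 0 * secondKernel B K b z) := by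
    simp only [rowEval, jetMul, rowPart, w', Matrix.cons_val]
    ring
  have e1 : ‖∫ s in B, (F K b s - rowEval B K (w b) b s) * e s * K s z‖ ≤ A * ε * D * c := by
    have t : ‖∫ s in B, (F K b s - rowEval B K (w b) b s) * e s * K s z‖ ≤
        ∫ s in B, A * ε * D * ‖K s z‖ := by
      refine norm_integral_le_of_norm_le
        ((((hK.col_bddMeas z).integrable _).norm).const_mul _) (Eventually.of_forall fun s => ?_)
      rw [norm_mul, norm_mul]
      refine mul_le_mul_of_nonneg_right ?_ (norm_nonneg _)
      by_cases hs : s ∈ S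
      · exact mul_le_mul (hF K M ε hK b hb s hs) (hD s) (norm_nonneg _) (by positivity)
      · rw [heS s hs, norm_zero, mul_zero]
        positivity
    rw [integral_const_mul] at t
    exact t.trans (mul_le_mul_of_nonneg_left (hK.col z) (by positivity))
  have e2 := hK.norm_sandwich_jet_sub_le hB h.norm_le hbB hbS' hzS'
    (e := fun s => jetEval (w' b) (s - b) * e s) (hjc.measurable.mul he.measurable)
    (D := D' * D) (fun y hy => by
      rw [norm_mul]
      exact mul_le_mul (hD' y hy) (hD y) (norm_nonneg _) ((norm_nonneg _).trans (hD' y hy)))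
    (hC b hb).1 (hC b hb).2
  have e3 := hK.norm_secondKernel_sandwich_le h hb hz he (e₀ := j b 0) (C := L)
    (((norm_le_pi_norm _ _).trans (hC' b hb).1).trans hL) fun y hy => by
      have hd := h.norm_sub_le hb hy
      have t1 := (hC' b hb).2 y hy
      have t2 := norm_jetEval_sub_le (j b) hd
      have t3 : ‖e y - j b 0‖ ≤ ‖e y - jetEval (j b) (y - b)‖ +
          ‖jetEval (j b) (y - b) - j b 0‖ := by
        rw [← sub_add_sub_cancel (e y) (jetEval (j b) (y - b))]
        exact norm_add_le _ _
      have t4 : ‖y - b‖ ^ 3 ≤ (2 * R) ^ 2 * ‖y - b‖ := by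
        rw [pow_succ]
        exact mul_le_mul_of_nonneg_right (pow_le_pow_left₀ (norm_nonneg _) hd 2) (norm_nonneg _)
      have t5 := mul_le_mul_of_nonneg_left t4 hC0'
      have t6 : (2 + 3 * (2 * R)) * ‖j b‖ * ‖y - b‖ ≤ (2 + 3 * (2 * R)) * C' * ‖y - b‖ := by
        have := (hC' b hb).1
        gcongr
      have t7 : 0 ≤ C' * ‖y - b‖ := by positivity
      simp only [L]
      linarith
  beta_reduce
  rw [hsplit, hmul]
  have heq : ∀ a b' d p q : ℂ, a + b' + w b 4 * d - (p + w b 4 * q) =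
    a + (b' - p) + w b 4 * (d - q) := fun a b' d p q => by ring
  rw [heq]
  refine norm_add₃_le.trans ?_
  rw [norm_mul (w b 4)]
  have e4 := mul_le_mul ((norm_le_pi_norm (w b) 4).trans (hw b hb)) e3 (norm_nonneg _) hA
  rw [hc] at e1 e4
  calc _ ≤ A * ε * D * |c| + 6 * (1 + R) ^ 2 * C * ε +
        A * (L * (3 * |c| + (2 * R) ^ 2 * |c| + (|c| + 1) / δ) * ε) :=
        add_le_add (add_le_add e1 e2) e4
    _ = _ := by simp only [Q]; ring

end RowApprox

end DetCLT

namespace DetCLT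

open Finset.HasAntidiagonal (antidiagonal)

/-! ### Solution of the jet recursion and decay of the higher cumulants -/

section RowCoefficients

open PowerSeries (coeff X C)

/-- The exponential series `e^{a t}`. -/
noncomputable abbrev expSeries (a : ℂ) : PowerSeries ℂ :=
  PowerSeries.rescale a (PowerSeries.exp ℂ)

theorem succ_mul_coeff_expSeries (a : ℂ) (i : ℕ) :
    (i + 1) * coeff (i + 1) (expSeries a) = a * coeff i (expSeries a) := by
  rw [coeff_rescale_exp, coeff_rescale_exp, Nat.factorial_succ]
  have h1 : (i.factorial : ℂ) ≠ 0 := by exact_mod_cast i.factorial_ne_zero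
  have h2 : (i + 1 : ℂ) ≠ 0 := by exact_mod_cast i.succ_ne_zero
  push_cast
  field_simp
  ring

theorem expSeries_mul_neg (a : ℂ) : expSeries a * expSeries (-a) = 1 := by
  rw [expSeries, expSeries, PowerSeries.exp_mul_exp_eq_exp_add, add_neg_cancel]
  ext i
  rw [coeff_rescale_exp, PowerSeries.coeff_one]
  rcases i with _ | i <;> simp

/-- The jet of `g ^ i / i!`, where `v` is the jet of `g`. -/
noncomputable def jetPow (v : Fin 6 → ℂ) : ℕ → Fin 6 → ℂ
  | 0 => ![1, 0, 0, 0, 0, 0]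
  | i + 1 => fun l => jetMul (jetPow v i) v l / (i + 1)

theorem jetPow_zero_apply (v : Fin 6 → ℂ) (i : ℕ) : jetPow v i 0 = coeff i (expSeries (v 0)) := by
  induction i with
  | zero => simp [jetPow]
  | succ i ih =>
    have h2 : (i + 1 : ℂ) ≠ 0 := by exact_mod_cast i.succ_ne_zero
    have := succ_mul_coeff_expSeries (v 0) i
    rw [jetPow, div_eq_iff h2]
    simp only [jetMul, Matrix.cons_val, ih]
    linear_combination -this

/-- Serves both first order entries: `hl` is the Leibniz rule, and `p` the corresponding first
derivative. -/
theorem jetPow_linear {v : Fin 6 → ℂ} {l : Fin 6} {p : ℂ} (h0 : jetPow v 0 l = 0)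
    (hl : ∀ w, jetMul w v l = w 0 * p + w l * v 0) (i : ℕ) :
    jetPow v i l = coeff i (X * (C p * expSeries (v 0))) := by
  induction i with
  | zero => rw [h0, PowerSeries.coeff_zero_X_mul]
  | succ i ih =>
    have h2 : (i + 1 : ℂ) ≠ 0 := by exact_mod_cast i.succ_ne_zero
    rw [jetPow, div_eq_iff h2, hl, ih, jetPow_zero_apply, PowerSeries.coeff_succ_X_mul,
      PowerSeries.coeff_C_mul]
    cases i with
    | zero => simp [mul_comm]
    | succ n =>
      rw [PowerSeries.coeff_succ_X_mul, PowerSeries.coeff_C_mul]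
      have := succ_mul_coeff_expSeries (v 0) n
      push_cast
      linear_combination -p * this

theorem jetPow_one_apply (v : Fin 6 → ℂ) (i : ℕ) :
    jetPow v i 1 = coeff i (X * (C (v 1) * expSeries (v 0))) :=
  jetPow_linear (by simp [jetPow]) (fun w => by simp [jetMul]) i

theorem jetPow_two_apply (v : Fin 6 → ℂ) (i : ℕ) :
    jetPow v i 2 = coeff i (X * (C (v 2) * expSeries (v 0))) :=
  jetPow_linear (by simp [jetPow]) (fun w => by simp [jetMul]) i

/-- The jet form of `∂∂̄ exp(t f) = (t ∂∂̄f + t² ∂f ∂̄f) exp(t f)`. -/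
theorem jetPow_four_apply (v : Fin 6 → ℂ) (i : ℕ) :
    jetPow v i 4 = coeff i (X * (C (v 4) * expSeries (v 0) +
      X * (C (v 1 * v 2) * expSeries (v 0)))) := by
  induction i with
  | zero => simp [jetPow]
  | succ i ih =>
    have h2 : (i + 1 : ℂ) ≠ 0 := by exact_mod_cast i.succ_ne_zero
    rw [jetPow, div_eq_iff h2]
    simp only [jetMul, Matrix.cons_val]
    rw [ih, jetPow_zero_apply, jetPow_one_apply, jetPow_two_apply, PowerSeries.coeff_succ_X_mul]
    cases i with
    | zero =>
      have : PowerSeries.constantCoeff (expSeries (v 0)) = 1 := by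
        rw [← PowerSeries.coeff_zero_eq_constantCoeff_apply]
        simp
      simp [mul_comm, this]
    | succ n =>
      simp only [PowerSeries.coeff_succ_X_mul, map_add, PowerSeries.coeff_C_mul]
      have t1 := succ_mul_coeff_expSeries (v 0) n
      cases n with
      | zero =>
        simp only [PowerSeries.coeff_zero_X_mul]
        push_cast at t1 ⊢
        linear_combination -(v 4) * t1
      | succ n =>
        simp only [PowerSeries.coeff_succ_X_mul, PowerSeries.coeff_C_mul]
        have t2 := succ_mul_coeff_expSeries (v 0) n
        push_cast at t1 ⊢
        linear_combination -(v 4) * t1 - v 1 * v 2 * t2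

theorem HasJet.pow_div_factorial {S B : Set ℂ} {f : ℂ → ℂ} {v : ℂ → Fin 6 → ℂ} {d : ℝ}
    (hd : ∀ b ∈ S, ∀ y ∈ B, ‖y - b‖ ≤ d) (h : HasJet S B (fun _ => f) v) (i : ℕ) :
    HasJet S B (fun _ y => f y ^ i / i.factorial) (fun b => jetPow (v b) i) := by
  induction i with
  | zero =>
    refine ⟨1, fun b _ => ⟨?_, fun y _ => ?_⟩⟩
    · refine (pi_norm_le_iff_of_nonneg zero_le_one).2 fun l => ?_
      fin_cases l <;> simp [jetPow]
    · simp [jetPow, jetEval]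
  | succ i ih =>
    obtain ⟨C, hC⟩ := ih.mul hd h
    have h2 : (0 : ℝ) < i + 1 := by positivity
    have hn : ‖((i : ℂ) + 1)⁻¹‖ ≤ 1 := by
      rw [norm_inv]
      refine inv_le_one_of_one_le₀ ?_
      rw [show (i : ℂ) + 1 = ((i + 1 : ℕ) : ℂ) by push_cast; ring, Complex.norm_natCast]
      exact_mod_cast Nat.le_add_left 1 i
    have hsm : ∀ b, jetPow (v b) (i + 1) = ((i : ℂ) + 1)⁻¹ • jetMul (jetPow (v b) i) (v b) := by
      intro b
      ext l
      simp [jetPow, div_eq_inv_mul]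
    refine ⟨C, fun b hb => ⟨?_, fun y hy => ?_⟩⟩
    · beta_reduce
      rw [hsm, norm_smul]
      exact (mul_le_of_le_one_left (norm_nonneg _) hn).trans (hC b hb).1
    · have heq : f y ^ (i + 1) / (i + 1).factorial - jetEval (jetPow (v b) (i + 1)) (y - b) =
          ((i : ℂ) + 1)⁻¹ * (f y ^ i / i.factorial * f y -
            jetEval (jetMul (jetPow (v b) i) (v b)) (y - b)) := by
        rw [hsm, Nat.factorial_succ]
        have h1 : (i.factorial : ℂ) ≠ 0 := by exact_mod_cast i.factorial_ne_zero
        have h2 : (i + 1 : ℂ) ≠ 0 := by exact_mod_cast i.succ_ne_zero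
        simp only [jetEval, Pi.smul_apply, smul_eq_mul]
        push_cast
        field_simp
        ring
      rw [heq, norm_mul]
      exact (mul_le_of_le_one_left (norm_nonneg _) hn).trans ((hC b hb).2 y hy)

/-- The term that is missing from the Cauchy product is the constant coefficient of `D`; this is how
the `-1` of `exp(t f) - 1` enters. -/
theorem sum_antidiagonal_coeff_succ (A D : PowerSeries ℂ) (k : ℕ) :
    ∑ p ∈ antidiagonal k, coeff p.2 A * coeff (p.1 + 1) D =
      coeff (k + 1) (D * A) - coeff 0 D * coeff (k + 1) A := by
  rw [PowerSeries.coeff_mul, Finset.Nat.sum_antidiagonal_succ]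
  simp only [add_sub_cancel_left]
  exact Finset.sum_congr rfl fun p _ => mul_comm _ _

variable {B S S' : Set ℂ} {c δ R : ℝ} {f : ℂ → ℂ} {v : ℂ → Fin 6 → ℂ}

/-- With `E = exp(t v)` in the jet algebra, the coefficients satisfy `W = 1 - rowPart(W) (E - 1)`.
Entry 2 is tracked because it feeds entry 4. The others need no formula: entries 1 and 3 do not
occur in `rowEval`, and entry 5 goes with `h̄²`, which is zero on the diagonal. -/
theorem rowApprox_resolventCoeff (h : Nested S S' B δ R) (hf : BddMeas f)
    (hfS : ∀ y ∉ S, f y = 0) (hv : HasJet S B (fun _ => f) v) (k : ℕ) :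
    ∃ w : ℂ → Fin 6 → ℂ,
      RowApprox B S S' c (fun K => resolventCoeff (volume.restrict B) K f k) w ∧
      ∀ b, w b 0 = coeff k (expSeries (-v b 0)) ∧
        w b 2 = coeff k (-(X * (C (v b 2) * expSeries (-v b 0)))) ∧
        w b 4 = coeff k (-(X * (C (v b 4) * expSeries (-v b 0)))) := by
  have := isFiniteMeasure_restrict_of_isCompact h.isCompact
  induction k using Nat.strong_induction_on with
  | _ k ih =>
    cases k with
    | zero =>
      refine ⟨fun _ => ![1, 0, 0, 0, 0, 0], ⟨1, zero_le_one, fun b _ => ?_,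
        fun K M ε hK b hb z hz => ?_⟩, fun b => ⟨?_, ?_, ?_⟩⟩
      · refine (pi_norm_le_iff_of_nonneg zero_le_one).2 fun l => ?_
        fin_cases l <;> simp
      · have := hK.eps_nonneg (h.subset_left hb)
        simpa [resolventCoeff, rowEval] using this
      · simp
      · simp
      · simp
    | succ k =>
      choose! w hw hwc using ih
      refine ⟨-∑ p ∈ antidiagonal k, fun b => jetMul (rowPart (w p.2 b))
        (jetPow (v b) (p.1 + 1)), ?_, fun b => ?_⟩
      · have hsum : RowApprox B S S' c (fun K b z => -∑ p ∈ antidiagonal k,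
            ∫ s in B, resolventCoeff (volume.restrict B) K f p.2 b s *
              (f s ^ (p.1 + 1) / (p.1 + 1).factorial) * K s z) _ :=
          RowApprox.neg (RowApprox.sum fun p hp => RowApprox.sandwich h (hw p.2 (by
            rw [Finset.HasAntidiagonal.mem_antidiagonal] at hp; omega))
            (fun K M ε hK b => (bddMeas_resolventCoeff hK.bddMeas hf p.2).comp
              (measurable_const.prodMk measurable_id))
            (e := fun s => f s ^ (p.1 + 1) / (p.1 + 1).factorial) ((hf.pow _).div_const _)
            (fun y hy => by simp [hfS y hy])
            (hv.pow_div_factorial (fun b hb y hy => h.norm_sub_le hb hy) (p.1 + 1)))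
        convert hsum using 1
        ext K b z
        rw [resolventCoeff_eq, if_neg (by omega), Finset.Nat.sum_antidiagonal_succ]
        simp only [coeff_zero_expSubOne, mul_zero, zero_mul, integral_zero, zero_add,
          coeff_succ_expSubOne, zero_sub]
      · have hlt : ∀ p ∈ antidiagonal k, p.2 < k + 1 := fun p hp => by
          rw [Finset.HasAntidiagonal.mem_antidiagonal] at hp; omega
        have hU := expSeries_mul_neg (v b 0)
        have hU0 : coeff 0 (expSeries (v b 0)) = 1 := by simp
        simp only [Pi.neg_apply, Finset.sum_apply]
        refine ⟨?_, ?_, ?_⟩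
        · rw [Finset.sum_congr rfl fun p hp => show jetMul (rowPart (w p.2 b))
              (jetPow (v b) (p.1 + 1)) 0 = coeff p.2 (expSeries (-v b 0)) *
                coeff (p.1 + 1) (expSeries (v b 0)) by
            simp only [jetMul, rowPart, Matrix.cons_val, (hwc p.2 (hlt p hp) b).1,
              jetPow_zero_apply], sum_antidiagonal_coeff_succ, hU, hU0]
          simp [PowerSeries.coeff_one]
        · rw [Finset.sum_congr rfl fun p hp => show jetMul (rowPart (w p.2 b))
              (jetPow (v b) (p.1 + 1)) 2 = coeff p.2 (expSeries (-v b 0)) *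
                coeff (p.1 + 1) (X * (C (v b 2) * expSeries (v b 0))) +
                coeff p.2 (-(X * (C (v b 2) * expSeries (-v b 0)))) *
                coeff (p.1 + 1) (expSeries (v b 0)) by
            simp only [jetMul, rowPart, Matrix.cons_val, (hwc p.2 (hlt p hp) b).1,
              (hwc p.2 (hlt p hp) b).2.1, jetPow_zero_apply, jetPow_two_apply],
            Finset.sum_add_distrib, sum_antidiagonal_coeff_succ, sum_antidiagonal_coeff_succ, hU0,
            PowerSeries.coeff_zero_X_mul]
          have : X * (C (v b 2) * expSeries (v b 0)) * expSeries (-v b 0) +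
            expSeries (v b 0) * -(X * (C (v b 2) * expSeries (-v b 0))) = 0 := by ring
          have := congrArg (coeff (k + 1)) this
          rw [map_add, map_zero] at this
          linear_combination -this
        · rw [Finset.sum_congr rfl fun p hp => show jetMul (rowPart (w p.2 b))
              (jetPow (v b) (p.1 + 1)) 4 = coeff p.2 (expSeries (-v b 0)) *
                coeff (p.1 + 1) (X * (C (v b 4) * expSeries (v b 0) +
                  X * (C (v b 1 * v b 2) * expSeries (v b 0)))) +
                coeff p.2 (-(X * (C (v b 2) * expSeries (-v b 0)))) *
                coeff (p.1 + 1) (X * (C (v b 1) * expSeries (v b 0))) +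
                coeff p.2 (-(X * (C (v b 4) * expSeries (-v b 0)))) *
                coeff (p.1 + 1) (expSeries (v b 0)) by
            simp only [jetMul, rowPart, Matrix.cons_val, (hwc p.2 (hlt p hp) b).1,
              (hwc p.2 (hlt p hp) b).2.1, (hwc p.2 (hlt p hp) b).2.2, jetPow_zero_apply,
              jetPow_one_apply, jetPow_four_apply]
            ring,
            Finset.sum_add_distrib, Finset.sum_add_distrib, sum_antidiagonal_coeff_succ,
            sum_antidiagonal_coeff_succ, sum_antidiagonal_coeff_succ, hU0,
            PowerSeries.coeff_zero_X_mul, PowerSeries.coeff_zero_X_mul]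
          -- The terms in `t² v₁ v₂` cancel here. Without this, a multiple of `t²` would survive on
          -- the diagonal and the third cumulant would not be shown to vanish.
          have : X * (C (v b 4) * expSeries (v b 0) +
              X * (C (v b 1 * v b 2) * expSeries (v b 0))) * expSeries (-v b 0) +
              X * (C (v b 1) * expSeries (v b 0)) * -(X * (C (v b 2) * expSeries (-v b 0))) +
              expSeries (v b 0) * -(X * (C (v b 4) * expSeries (-v b 0))) = 0 := by
            rw [map_mul]
            ring
          have := congrArg (coeff (k + 1)) this
          rw [map_add, map_add, map_zero] at this
          linear_combination -this

/-- The scaled cumulants of order at least three are of the order of the error of a near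
projection. -/
theorem exists_norm_cumulantCoeff_le (h : Nested S S' B δ R) (hf : BddMeas f)
    (hfS : ∀ y ∉ S, f y = 0) (hv : HasJet S B (fun _ => f) v) (hv0 : ∀ b ∈ S, v b 0 = f b)
    {i : ℕ} (hi : 2 ≤ i) :
    ∃ A : ℝ, ∀ K M ε, NearProjection B S' c K M ε → 0 ≤ ε →
      ‖cumulantCoeff (volume.restrict B) K f i‖ ≤ A * ε := by
  have := isFiniteMeasure_restrict_of_isCompact h.isCompact
  choose w hw hwc using fun k => rowApprox_resolventCoeff (c := c) h hf hfS hv k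
  choose A hA hwA hAε using hw
  obtain ⟨D, hD0, hD⟩ := hf.norm_le
  let E := ∑ q ∈ antidiagonal i, D ^ (q.1 + 1) / q.1.factorial * A q.2
  have hE : 0 ≤ E := Finset.sum_nonneg fun q _ => by have := hA q.2; positivity
  refine ⟨E * (volume.restrict B).real Set.univ, fun K M ε hK hε => ?_⟩
  have hint : ∀ q ∈ antidiagonal i, Integrable (fun t => f t ^ (q.1 + 1) / q.1.factorial *
      resolventCoeff (volume.restrict B) K f q.2 t t) (volume.restrict B) := fun q _ =>
    (((hf.pow _).div_const _).mul ((bddMeas_resolventCoeff hK.bddMeas hf q.2).comp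
      (measurable_id.prodMk measurable_id))).integrable _
  rw [cumulantCoeff, ← integral_finsetSum _ hint]
  have key : ∀ t, ‖∑ q ∈ antidiagonal i, f t ^ (q.1 + 1) / q.1.factorial *
      resolventCoeff (volume.restrict B) K f q.2 t t‖ ≤ E * ε := by
    intro t
    by_cases ht : t ∈ S
    -- On the diagonal only entries 0 and 4 remain. Multiplied by `f exp(t f)` they become `f` and
    -- `-t v₄ f`, which have no coefficient of order two or more.
    · have hmain : ∑ q ∈ antidiagonal i, f t ^ (q.1 + 1) / q.1.factorial *
          rowEval B K (w q.2 t) t t = 0 := by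
        have e1 : ∑ q ∈ antidiagonal i, coeff q.1 (expSeries (v t 0)) *
            coeff q.2 (expSeries (-v t 0)) = 0 := by
          rw [← PowerSeries.coeff_mul, expSeries_mul_neg, PowerSeries.coeff_one, if_neg (by omega)]
        have e2 : ∑ q ∈ antidiagonal i, coeff q.1 (expSeries (v t 0)) *
            coeff q.2 (-(X * (C (v t 4) * expSeries (-v t 0)))) = 0 := by
          rw [← PowerSeries.coeff_mul, show expSeries (v t 0) *
            -(X * (C (v t 4) * expSeries (-v t 0))) =
            -(C (v t 4) * (X * (expSeries (v t 0) * expSeries (-v t 0)))) by ring,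
            expSeries_mul_neg, mul_one, map_neg, PowerSeries.coeff_C_mul, PowerSeries.coeff_X,
            if_neg (by omega), mul_zero, neg_zero]
        calc _ = ∑ q ∈ antidiagonal i, (f t * K t t * (coeff q.1 (expSeries (v t 0)) *
              coeff q.2 (expSeries (-v t 0))) + f t * secondKernel B K t t *
              (coeff q.1 (expSeries (v t 0)) *
              coeff q.2 (-(X * (C (v t 4) * expSeries (-v t 0)))))) := by
              refine Finset.sum_congr rfl fun q _ => ?_
              rw [rowEval, (hwc q.2 t).1, (hwc q.2 t).2.2, sub_self, map_zero,
                coeff_rescale_exp (v t 0), hv0 t ht]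
              ring
          _ = 0 := by
              rw [Finset.sum_add_distrib, ← Finset.mul_sum, ← Finset.mul_sum, e1, e2, mul_zero,
                mul_zero, add_zero]
      rw [← sub_zero (∑ q ∈ antidiagonal i, _), ← hmain, ← Finset.sum_sub_distrib]
      refine (norm_sum_le _ _).trans ?_
      rw [Finset.sum_mul]
      refine Finset.sum_le_sum fun q _ => ?_
      rw [← mul_sub, norm_mul, norm_div, norm_pow, Complex.norm_natCast, mul_assoc]
      exact mul_le_mul (by gcongr; exact hD t) (hAε q.2 K M ε hK t ht t ht) (norm_nonneg _)
        (by positivity)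
    · rw [Finset.sum_eq_zero fun q _ => by rw [hfS t ht]; simp, norm_zero]
      positivity
  refine (norm_integral_le_of_norm_le_const (Eventually.of_forall key)).trans ?_
  rw [mul_right_comm]

end RowCoefficients

end DetCLT

namespace DetCLT

open scoped ComplexConjugate

/-! ### Taylor expansion of test functions -/

section Taylor

/-- The coefficients of the second order Taylor polynomial of a real function on `ℂ` in terms of
`h` and `h̄`. -/
noncomputable def taylorJet (f : ℂ → ℝ) (b : ℂ) : Fin 6 → ℂ :=
  let D := fderiv ℝ f b
  let H := fderiv ℝ (fderiv ℝ f) b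
  ![f b, (D 1 - Complex.I * D Complex.I) / 2, (D 1 + Complex.I * D Complex.I) / 2,
    (H 1 1 - Complex.I * (H 1 Complex.I + H Complex.I 1) - H Complex.I Complex.I) / 8,
    (H 1 1 + H Complex.I Complex.I) / 4,
    (H 1 1 + Complex.I * (H 1 Complex.I + H Complex.I 1) - H Complex.I Complex.I) / 8]

theorem jetEval_taylorJet (f : ℂ → ℝ) (b h : ℂ) : jetEval (taylorJet f b) h =
    ((f b + fderiv ℝ f b h + fderiv ℝ (fderiv ℝ f) b h h / 2 : ℝ) : ℂ) := by
  have h1 : h = h.re • (1 : ℂ) + h.im • Complex.I := by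
    simp [Complex.re_add_im]
  have hh : h = h.re + h.im * Complex.I := (Complex.re_add_im h).symm
  have hc : conj h = h.re - h.im * Complex.I := by
    simp [Complex.ext_iff]
  have hD : fderiv ℝ f b h = h.re * fderiv ℝ f b 1 + h.im * fderiv ℝ f b Complex.I := by
    conv_lhs => rw [h1]
    simp only [map_add, map_smul, smul_eq_mul]
  have hH : fderiv ℝ (fderiv ℝ f) b h h = h.re * (h.re * fderiv ℝ (fderiv ℝ f) b 1 1 +
      h.im * fderiv ℝ (fderiv ℝ f) b 1 Complex.I) +
      h.im * (h.re * fderiv ℝ (fderiv ℝ f) b Complex.I 1 +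
      h.im * fderiv ℝ (fderiv ℝ f) b Complex.I Complex.I) := by
    conv_lhs => rw [h1]
    simp only [map_add, map_smul, smul_eq_mul, _root_.add_apply,
      _root_.smul_apply]
    ring
  rw [hD, hH, jetEval, hc]
  simp only [taylorJet, Matrix.cons_val]
  conv_lhs => rw [hh]
  push_cast
  have hI : Complex.I ^ 2 = -1 := Complex.I_sq
  simp only [Complex.add_re, Complex.ofReal_re, Complex.mul_re, Complex.I_re, mul_zero,
    Complex.ofReal_im, Complex.I_im, mul_one, sub_self, add_zero, Complex.add_im, Complex.mul_im,
    zero_add]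
  ring_nf
  simp only [hI]
  ring

theorem hasFDerivAt_half_symmetric {H : ℂ →L[ℝ] ℂ →L[ℝ] ℝ} (hH : ∀ u v, H u v = H v u) (b x : ℂ) :
    HasFDerivAt (fun x => H (x - b) (x - b) / 2) (H (x - b)) x := by
  have hid : HasFDerivAt (fun x : ℂ => x - b) (ContinuousLinearMap.id ℝ ℂ) x :=
    (hasFDerivAt_id x).sub_const b
  have h2 : HasFDerivAt (fun x : ℂ => H (x - b)) H x := by
    exact H.hasFDerivAt.comp x hid
  have h3 := (h2.clm_apply hid).const_mul (1 / 2 : ℝ)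
  have h4 : (1 / 2 : ℝ) • ((H (x - b)).comp (ContinuousLinearMap.id ℝ ℂ) + H.flip (x - b)) =
      H (x - b) := by
    ext u
    have := hH u (x - b)
    simp only [ContinuousLinearMap.comp_id, _root_.smul_apply, _root_.add_apply,
      ContinuousLinearMap.flip_apply, smul_eq_mul, this]
    ring
  rw [h4] at h3
  refine h3.congr_of_eventuallyEq (Eventually.of_forall fun u => ?_)
  simp only
  ring

/-- The mean value inequality is used twice on the ball of radius `‖y - b‖`, for `D` and then for
`f` minus its quadratic part, whose derivative is known by symmetry of `H b`. The sharper factor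
`1/6` is not needed. -/
theorem norm_sub_taylor_le {f : ℂ → ℝ} {D : ℂ → ℂ →L[ℝ] ℝ} {H : ℂ → ℂ →L[ℝ] ℂ →L[ℝ] ℝ}
    (hf : ∀ x, HasFDerivAt f (D x) x) (hD : ∀ x, HasFDerivAt D (H x) x) {L : ℝ≥0}
    (hL : LipschitzWith L H) (hH : ∀ b u v, H b u v = H b v u) (b y : ℂ) :
    ‖f y - (f b + D b (y - b) + H b (y - b) (y - b) / 2)‖ ≤ L * ‖y - b‖ ^ 3 := by
  set r := ‖y - b‖ with hr
  have hD1 : ∀ x ∈ Metric.closedBall b r, ‖D x - D b - H b (x - b)‖ ≤ L * r * r := by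
    intro x hx
    have hx' : ‖x - b‖ ≤ r := by rwa [mem_closedBall_iff_norm] at hx
    refine ((convex_closedBall b r).norm_image_sub_le_of_norm_hasFDerivWithin_le' (C := L * r)
      (fun u _ => (hD u).hasFDerivWithinAt) (fun u hu => ?_)
      (Metric.mem_closedBall_self (norm_nonneg _)) hx).trans
        (mul_le_mul_of_nonneg_left hx' (by positivity))
    rw [mem_closedBall_iff_norm] at hu
    exact (hL.norm_sub_le u b).trans (mul_le_mul_of_nonneg_left hu L.2)
  have key := (convex_closedBall b r).norm_image_sub_le_of_norm_hasFDerivWithin_le'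
    (fun x _ => ((hf x).sub (hasFDerivAt_half_symmetric (hH b) b x)).hasFDerivWithinAt)
    (φ := D b) (C := L * r * r)
    (fun x hx => by
      have := hD1 x hx
      rwa [sub_right_comm] at this)
    (Metric.mem_closedBall_self (norm_nonneg _)) (y := y) (by
      rw [mem_closedBall_iff_norm])
  simp only [Pi.sub_apply, sub_self, map_zero, zero_div, sub_zero] at key
  calc _ = ‖f y - H b (y - b) (y - b) / 2 - f b - D b (y - b)‖ := by
        congr 1; ring
    _ ≤ L * r * r * r := key
    _ = _ := by ring

theorem isSymmSndFDerivAt_of_contDiff_three {f : ℂ → ℝ} (hf : ContDiff ℝ 3 f) (b : ℂ) :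
    IsSymmSndFDerivAt ℝ f b := by
  have h2 : (2 : WithTop ℕ∞) ≤ 3 := by norm_num
  exact (hf.of_le h2).contDiffAt.isSymmSndFDerivAt (by rw [minSmoothness_of_isRCLikeNormedField])

theorem exists_norm_sub_taylor_le {f : ℂ → ℝ} (hf : ContDiff ℝ 3 f) (hfc : HasCompactSupport f) :
    ∃ L : ℝ, 0 ≤ L ∧ ∀ b y : ℂ,
      ‖f y - (f b + fderiv ℝ f b (y - b) + fderiv ℝ (fderiv ℝ f) b (y - b) (y - b) / 2)‖ ≤
        L * ‖y - b‖ ^ 3 := by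
  have hf1 : ContDiff ℝ 2 (fderiv ℝ f) := hf.fderiv_right (by norm_num)
  have hf2 : ContDiff ℝ 1 (fderiv ℝ (fderiv ℝ f)) := hf1.fderiv_right (by norm_num)
  obtain ⟨L, hL⟩ : ∃ L : ℝ≥0, LipschitzWith L (fderiv ℝ (fderiv ℝ f)) :=
    hf2.lipschitzWith_of_hasCompactSupport ((hfc.fderiv (𝕜 := ℝ)).fderiv (𝕜 := ℝ)) one_ne_zero
  have key : ∀ b y : ℂ,
      ‖f y - (f b + fderiv ℝ f b (y - b) + fderiv ℝ (fderiv ℝ f) b (y - b) (y - b) / 2)‖ ≤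
        L * ‖y - b‖ ^ 3 := norm_sub_taylor_le
    (fun x => ((hf.differentiable (by norm_num)) x).hasFDerivAt)
    (fun x => ((hf1.differentiable (by norm_num)) x).hasFDerivAt) hL
    fun b u v => isSymmSndFDerivAt_of_contDiff_three hf b u v
  exact ⟨L, L.coe_nonneg, key⟩

theorem hasJet_taylorJet {f : ℂ → ℝ} (hf : ContDiff ℝ 3 f) (hfc : HasCompactSupport f)
    {S B : Set ℂ} (hS : IsCompact S) : HasJet S B (fun _ y => (f y : ℂ)) (taylorJet f) := by
  obtain ⟨L, hL0, hL⟩ := exists_norm_sub_taylor_le hf hfc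
  have hf1 : ContDiff ℝ 2 (fderiv ℝ f) := hf.fderiv_right (by norm_num)
  have hf2 : ContDiff ℝ 1 (fderiv ℝ (fderiv ℝ f)) := hf1.fderiv_right (by norm_num)
  have c0 := hf.continuous
  have c1 := hf1.continuous
  have c2 := hf2.continuous
  have hc : Continuous (taylorJet f) := by
    refine continuous_pi fun i => ?_
    fin_cases i <;> simp only [taylorJet] <;> simp <;> fun_prop
  obtain ⟨C, hC⟩ := hS.exists_bound_of_continuousOn hc.continuousOn
  refine ⟨max C L, fun b hb => ⟨(hC b hb).trans (le_max_left _ _), fun y _ => ?_⟩⟩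
  rw [jetEval_taylorJet, ← Complex.ofReal_sub, Complex.norm_real]
  exact (hL b y).trans (mul_le_mul_of_nonneg_right (le_max_right _ _) (by positivity))

end Taylor

end DetCLT

namespace DetCLT

/-! ### Moments of centred normal laws -/

section GaussianMoments

/-- The moments of the centred normal law of variance `v`. -/
def gaussMoment (v : ℝ) : ℕ → ℝ
  | 0 => 1
  | 1 => 0
  | k + 2 => (k + 1) * v * gaussMoment v k

theorem continuous_gaussMoment (k : ℕ) : Continuous fun v => gaussMoment v k := by
  induction k using Nat.twoStepInduction with
  | zero => exact continuous_const
  | one => exact continuous_const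
  | more k ih _ => simp only [gaussMoment]; fun_prop

/-- Gives the growth of even moments against `(2 k)!`, by which the Taylor remainders of the normal
characteristic function tend to zero. -/
theorem gaussMoment_two_mul (v : ℝ) (k : ℕ) :
    gaussMoment v (2 * k) / (2 * k).factorial = (v / 2) ^ k / k.factorial := by
  induction k with
  | zero => simp [gaussMoment]
  | succ k ih =>
    have h1 : ((2 * k).factorial : ℝ) ≠ 0 := by exact_mod_cast (2 * k).factorial_ne_zero
    have h2 : (k.factorial : ℝ) ≠ 0 := by exact_mod_cast k.factorial_ne_zero
    rw [div_eq_div_iff h1 h2] at ih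
    rw [show 2 * (k + 1) = 2 * k + 2 by ring, gaussMoment, Nat.factorial_succ, Nat.factorial_succ,
      Nat.factorial_succ]
    have h3 : (k + 1 : ℝ) ≠ 0 := by positivity
    have h4 : (2 * k + 1 : ℝ) ≠ 0 := by positivity
    push_cast
    rw [div_eq_div_iff (by positivity) (by positivity)]
    linear_combination (2 * (k : ℝ) + 1) * v * (k + 1) * ih

theorem integrable_pow_gaussianReal (v : ℝ≥0) (k : ℕ) :
    Integrable (fun x : ℝ => x ^ k) (gaussianReal 0 v) := by
  have := integrable_pow_of_mem_interior_integrableExpSet (X := id) (μ := gaussianReal 0 v)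
    (by simp) k
  simpa using this

/-- The moment generating function satisfies `F' = v t F`; differentiating this repeatedly and
setting `t = 0` gives the recursion that defines `gaussMoment`. -/
theorem integral_pow_gaussianReal (v : ℝ≥0) (k : ℕ) :
    ∫ x, x ^ k ∂(gaussianReal 0 v) = gaussMoment v k := by
  set F : ℝ → ℝ := mgf id (gaussianReal 0 v) with hF
  have hFe : F = fun t => Real.exp (v * t ^ 2 / 2) := by
    rw [hF, mgf_id_gaussianReal]
    simp
  have hFc : ContDiff ℝ ⊤ F := by rw [hFe]; fun_prop
  have hFd : ∀ n : ℕ, Differentiable ℝ (iteratedDeriv n F) := fun n =>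
    hFc.differentiable_iteratedDeriv n (by simp)
  have h1 : ∀ t, iteratedDeriv 1 F t = v * t * F t := by
    intro t
    rw [iteratedDeriv_one, hFe]
    have : HasDerivAt (fun t : ℝ => v * t ^ 2 / 2) (v * t) t := by
      have := ((hasDerivAt_pow 2 t).const_mul (v : ℝ)).div_const 2
      refine this.congr_deriv ?_
      simp
      ring
    rw [this.exp.deriv]
    ring
  have h2 : ∀ n : ℕ, ∀ t, iteratedDeriv (n + 2) F t =
      v * t * iteratedDeriv (n + 1) F t + (n + 1) * v * iteratedDeriv n F t := by
    intro n
    induction n with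
    | zero =>
      intro t
      rw [iteratedDeriv_succ, zero_add, show iteratedDeriv 1 F = fun t => v * t * F t from funext h1]
      have hd : HasDerivAt (fun t : ℝ => (v : ℝ) * t) v t := by
        simpa using (hasDerivAt_id t).const_mul (v : ℝ)
      have hF' : HasDerivAt F (v * t * F t) t := by
        have := (hFd 0 t).hasDerivAt
        rw [iteratedDeriv_zero] at this
        rwa [← iteratedDeriv_one, h1] at this
      refine (hd.mul hF').deriv.trans ?_
      simp
      ring
    | succ n ih =>
      intro t
      rw [iteratedDeriv_succ, show iteratedDeriv (n + 2) F = fun t => v * t *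
        iteratedDeriv (n + 1) F t + (n + 1) * v * iteratedDeriv n F t from funext ih]
      have hd : HasDerivAt (fun t : ℝ => (v : ℝ) * t) v t := by
        simpa using (hasDerivAt_id t).const_mul (v : ℝ)
      have e1 : HasDerivAt (iteratedDeriv (n + 1) F) (iteratedDeriv (n + 2) F t) t := by
        rw [iteratedDeriv_succ (n := n + 1)]
        exact (hFd (n + 1) t).hasDerivAt
      have e2 : HasDerivAt (iteratedDeriv n F) (iteratedDeriv (n + 1) F t) t := by
        rw [iteratedDeriv_succ]
        exact (hFd n t).hasDerivAt
      refine ((hd.mul e1).add (e2.const_mul _)).deriv.trans ?_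
      rw [ih t]
      push_cast
      ring
  have h3 : ∀ n : ℕ, iteratedDeriv n F 0 = gaussMoment v n := by
    intro n
    induction n using Nat.twoStepInduction with
    | zero => simp [gaussMoment, hFe]
    | one => simp [gaussMoment, h1]
    | more n ih _ => rw [h2, ih, gaussMoment]; simp
  rw [← h3, hF, iteratedDeriv_mgf_zero (by simp)]
  simp

end GaussianMoments

/-! ### From convergence of moments to weak convergence -/

section CharFun

open Complex (I)

theorem norm_exp_mul_I_sub_sum_le (n : ℕ) (x : ℝ) :
    ‖Complex.exp (x * I) - ∑ j ∈ Finset.range n, (x * I) ^ j / j.factorial‖ ≤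
      |x| ^ n / n.factorial := by
  have hnn : ∀ n : ℕ, ∀ x : ℝ, 0 ≤ x →
      ‖Complex.exp (x * I) - ∑ j ∈ Finset.range n, (x * I) ^ j / j.factorial‖ ≤
        x ^ n / n.factorial := by
    intro n
    induction n with
    | zero =>
      intro x _
      simp [Complex.norm_exp_ofReal_mul_I]
    | succ n ih =>
      intro x hx
      have hd : ∀ y : ℝ, HasDerivAt (fun y : ℝ => Complex.exp (y * I) -
          ∑ j ∈ Finset.range (n + 1), (y * I) ^ j / j.factorial)
          (I * (Complex.exp (y * I) - ∑ j ∈ Finset.range n, (y * I) ^ j / j.factorial)) y := by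
        intro y
        have hy : HasDerivAt (fun y : ℝ => (y * I : ℂ)) I y := by
          simpa using (Complex.ofRealCLM.hasDerivAt (x := y)).mul_const I
        have hs : HasDerivAt (fun y : ℝ => ∑ j ∈ Finset.range (n + 1),
            (y * I : ℂ) ^ j / j.factorial)
            (∑ j ∈ Finset.range (n + 1), (j * (y * I : ℂ) ^ (j - 1) * I) / j.factorial) y := by
          have := HasDerivAt.fun_sum (u := Finset.range (n + 1)) (x := y)
            (A := fun j (y : ℝ) => (y * I : ℂ) ^ j / (j.factorial : ℂ))
            (A' := fun j => (j * (y * I : ℂ) ^ (j - 1) * I) / j.factorial)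
            fun j _ => (hy.pow j).div_const _
          exact this
        refine (hy.cexp.sub hs).congr_deriv ?_
        rw [Finset.sum_range_succ', mul_sub, Finset.mul_sum, mul_comm I]
        simp only [Nat.cast_zero, zero_mul, zero_div, add_zero]
        congr 1
        refine Finset.sum_congr rfl fun j _ => ?_
        have h1 : (j.factorial : ℂ) ≠ 0 := by exact_mod_cast j.factorial_ne_zero
        have h2 : (j + 1 : ℂ) ≠ 0 := by exact_mod_cast j.succ_ne_zero
        rw [Nat.factorial_succ]
        push_cast
        field_simp
      have hB : ∀ y : ℝ, HasDerivAt (fun y : ℝ => y ^ (n + 1) / ((n + 1).factorial : ℝ))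
          (y ^ n / n.factorial) y := by
        intro y
        refine ((hasDerivAt_pow (n + 1) y).div_const _).congr_deriv ?_
        have h1 : (n.factorial : ℝ) ≠ 0 := by exact_mod_cast n.factorial_ne_zero
        have h2 : (n + 1 : ℝ) ≠ 0 := by exact_mod_cast n.succ_ne_zero
        rw [Nat.factorial_succ]
        push_cast
        field_simp
      refine image_norm_le_of_norm_deriv_right_le_deriv_boundary (a := 0) (b := x)
        (fun y _ => (hd y).continuousAt.continuousWithinAt)
        (fun y _ => (hd y).hasDerivWithinAt) ?_ hB (fun y hy => ?_) ⟨hx, le_rfl⟩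
      · simp [Finset.sum_range_succ']
      · rw [norm_mul, Complex.norm_I, one_mul]
        exact ih y hy.1
  rcases le_total 0 x with hx | hx
  · rw [abs_of_nonneg hx]
    exact hnn n x hx
  · rw [abs_of_nonpos hx]
    refine le_trans (le_of_eq ?_) (hnn n (-x) (by linarith))
    rw [← RCLike.norm_conj]
    congr 1
    rw [map_sub, map_sum, ← Complex.exp_conj]
    simp

/-- The order `2 * n` is even so that the absolute moment in the remainder is an ordinary moment. -/
theorem norm_charFun_sub_sum_le {μ : Measure ℝ} [IsProbabilityMeasure μ]
    (hμ : ∀ k : ℕ, Integrable (fun x : ℝ => x ^ k) μ) (n : ℕ) (t : ℝ) :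
    ‖charFun μ t - ∑ j ∈ Finset.range (2 * n), (t * I) ^ j / j.factorial *
      ((∫ x, x ^ j ∂μ : ℝ) : ℂ)‖ ≤ t ^ (2 * n) / (2 * n).factorial * ∫ x, x ^ (2 * n) ∂μ := by
  have hi : ∀ j ∈ Finset.range (2 * n), Integrable
      (fun x : ℝ => (t * I) ^ j / j.factorial * ((x ^ j : ℝ) : ℂ)) μ := fun j _ =>
    ((hμ j).ofReal).const_mul _
  have he : Integrable (fun x : ℝ => Complex.exp (t * x * I)) μ := by
    refine Integrable.of_bound (by fun_prop) 1 (Eventually.of_forall fun x => ?_)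
    rw [← Complex.ofReal_mul, Complex.norm_exp_ofReal_mul_I]
  have heq : charFun μ t - ∑ j ∈ Finset.range (2 * n), (t * I) ^ j / j.factorial *
      ((∫ x, x ^ j ∂μ : ℝ) : ℂ) = ∫ x, (Complex.exp (t * x * I) -
        ∑ j ∈ Finset.range (2 * n), (t * I) ^ j / j.factorial * ((x ^ j : ℝ) : ℂ)) ∂μ := by
    rw [integral_sub he (integrable_finsetSum _ hi), integral_finsetSum _ hi, charFun_apply_real]
    congr 1
    refine Finset.sum_congr rfl fun j _ => ?_
    rw [integral_const_mul]
    exact congrArg _ (integral_ofReal (𝕜 := ℂ)).symm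
  rw [heq, ← integral_const_mul]
  refine norm_integral_le_of_norm_le ((hμ _).const_mul _) (Eventually.of_forall fun x => ?_)
  have := norm_exp_mul_I_sub_sum_le (2 * n) (t * x)
  rw [Even.pow_abs (by simp), mul_pow, ← div_mul_eq_mul_div] at this
  refine le_trans (le_of_eq ?_) this
  congr 2
  · push_cast
    rfl
  · refine Finset.sum_congr rfl fun j _ => ?_
    push_cast
    ring

/-- Convergence of all moments to those of a centred normal law implies convergence of the
characteristic functions. -/
theorem tendsto_charFun_of_tendsto_moments {μ : ℕ → Measure ℝ} [∀ n, IsProbabilityMeasure (μ n)]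
    (hμ : ∀ᶠ n in atTop, ∀ k : ℕ, Integrable (fun x : ℝ => x ^ k) (μ n)) (v : ℝ≥0)
    (hm : ∀ k : ℕ, Tendsto (fun n => ∫ x, x ^ k ∂(μ n)) atTop (𝓝 (gaussMoment v k))) (t : ℝ) :
    Tendsto (fun n => charFun (μ n) t) atTop (𝓝 (charFun (gaussianReal 0 v) t)) := by
  have hlim : Tendsto (fun n : ℕ => t ^ (2 * n) / (2 * n).factorial * gaussMoment v (2 * n)) atTop
      (𝓝 0) := by
    have : (fun n : ℕ => t ^ (2 * n) / (2 * n).factorial * gaussMoment v (2 * n)) =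
        fun n : ℕ => (t ^ 2 * (v / 2)) ^ n / n.factorial := by
      ext n
      rw [div_mul_eq_mul_div, mul_div_assoc, gaussMoment_two_mul, mul_pow, pow_mul, mul_div_assoc]
    rw [this]
    exact FloorSemiring.tendsto_pow_div_factorial_atTop _
  rw [tendsto_iff_norm_sub_tendsto_zero, Metric.tendsto_atTop]
  intro ε hε
  -- `N` is chosen from the normal remainder alone. Convergence of the single moment of order `2 *
  -- N` then bounds the remainder for `μ n`, for large `n`.
  obtain ⟨N, hN⟩ := (hlim.eventually (gt_mem_nhds (show 0 < ε / 3 by positivity))).exists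
  have hsum : Tendsto (fun n => ∑ j ∈ Finset.range (2 * N), (t * I) ^ j / j.factorial *
      ((∫ x, x ^ j ∂(μ n) : ℝ) : ℂ)) atTop (𝓝 (∑ j ∈ Finset.range (2 * N),
        (t * I) ^ j / j.factorial * ((∫ x, x ^ j ∂(gaussianReal 0 v) : ℝ) : ℂ))) := by
    refine tendsto_finsetSum _ fun j _ => Tendsto.const_mul _ ?_
    rw [integral_pow_gaussianReal]
    exact (Complex.continuous_ofReal.tendsto _).comp (hm j)
  have hmom := (hm (2 * N)).const_mul (t ^ (2 * N) / (2 * N).factorial)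
  have e1 := hmom.eventually (gt_mem_nhds hN)
  have e2 := (tendsto_iff_norm_sub_tendsto_zero.1 hsum).eventually
    (gt_mem_nhds (show 0 < ε / 3 by positivity))
  obtain ⟨n₀, hn₀⟩ := eventually_atTop.1 (hμ.and (e1.and e2))
  refine ⟨n₀, fun n hn => ?_⟩
  obtain ⟨hi, h1, h2⟩ := hn₀ n hn
  have b1 := norm_charFun_sub_sum_le hi N t
  have b2 := norm_charFun_sub_sum_le (integrable_pow_gaussianReal v) N t
  rw [integral_pow_gaussianReal v (2 * N)] at b2
  rw [Real.dist_eq, sub_zero, abs_of_nonneg (norm_nonneg _)]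
  set a := ∑ j ∈ Finset.range (2 * N), (t * I) ^ j / j.factorial *
      ((∫ x, x ^ j ∂(μ n) : ℝ) : ℂ)
  set a' := ∑ j ∈ Finset.range (2 * N), (t * I) ^ j / j.factorial *
      ((∫ x, x ^ j ∂(gaussianReal 0 v) : ℝ) : ℂ)
  have heq : charFun (μ n) t - charFun (gaussianReal 0 v) t =
      (charFun (μ n) t - a) + (a - a') - (charFun (gaussianReal 0 v) t - a') := by ring
  rw [heq]
  have := norm_sub_le ((charFun (μ n) t - a) + (a - a')) (charFun (gaussianReal 0 v) t - a')
  have := norm_add_le (charFun (μ n) t - a) (a - a')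
  linarith

theorem tendsto_integral_of_tendsto_moments {μ : ℕ → Measure ℝ} [∀ n, IsProbabilityMeasure (μ n)]
    (hμ : ∀ᶠ n in atTop, ∀ k : ℕ, Integrable (fun x : ℝ => x ^ k) (μ n)) (v : ℝ≥0)
    (hm : ∀ k : ℕ, Tendsto (fun n => ∫ x, x ^ k ∂(μ n)) atTop (𝓝 (gaussMoment v k)))
    (g : ℝ →ᵇ ℝ) :
    Tendsto (fun n => ∫ x, g x ∂(μ n)) atTop (𝓝 (∫ x, g x ∂(gaussianReal 0 v))) := by
  have h := ProbabilityMeasure.tendsto_of_tendsto_charFun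
    (μ := fun n => (⟨μ n, inferInstance⟩ : ProbabilityMeasure ℝ))
    (μ₀ := ⟨gaussianReal 0 v, inferInstance⟩)
    (fun t => tendsto_charFun_of_tendsto_moments hμ v hm t)
  exact ProbabilityMeasure.tendsto_iff_forall_integral_tendsto.1 h g

/-- If the moments of `μ_i` are asymptotically those of centred normal laws with bounded
variances, then the two families of laws are weakly asymptotic. -/
theorem tendsto_integral_sub_of_tendsto_moments_sub {ι : Type*} {l : Filter ι}
    [l.IsCountablyGenerated] {μ : ι → Measure ℝ} [∀ i, IsProbabilityMeasure (μ i)] {v : ι → ℝ≥0}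
    {C : ℝ≥0} (hμ : ∀ᶠ i in l, ∀ k : ℕ, Integrable (fun x : ℝ => x ^ k) (μ i))
    (hv : ∀ᶠ i in l, v i ≤ C)
    (hm : ∀ k : ℕ, Tendsto (fun i => ∫ x, x ^ k ∂(μ i) - gaussMoment (v i) k) l (𝓝 0))
    (g : ℝ →ᵇ ℝ) :
    Tendsto (fun i => ∫ x, g x ∂(μ i) - ∫ x, g x ∂(gaussianReal 0 (v i))) l (𝓝 0) := by
  -- Along any sequence the bounded variances have a subsequence with some limit `w`, and there both
  -- families converge weakly to the normal law of variance `w`. The shift by `N` makes the bound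
  -- hold for every term.
  refine tendsto_of_subseq_tendsto fun ns hns => ?_
  obtain ⟨N, hN⟩ := eventually_atTop.1 (hns.eventually hv)
  obtain ⟨w, -, φ, hφ, hw⟩ := (isCompact_Icc (a := (0 : ℝ≥0)) (b := C)).tendsto_subseq
    (x := fun n => v (ns (n + N))) fun n => ⟨bot_le, hN _ (Nat.le_add_left N n)⟩
  have hms : Tendsto (fun n => φ n + N) atTop atTop :=
    (tendsto_add_atTop_nat N).comp hφ.tendsto_atTop
  refine ⟨fun n => φ n + N, ?_⟩
  have hsub : Tendsto (fun n => ns (φ n + N)) atTop l := hns.comp hms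
  have hgm : ∀ k, Tendsto (fun n => gaussMoment (v (ns (φ n + N))) k) atTop
      (𝓝 (gaussMoment w k)) := fun k =>
    ((continuous_gaussMoment k).tendsto _).comp ((NNReal.continuous_coe.tendsto w).comp hw)
  have t1 := tendsto_integral_of_tendsto_moments (μ := fun n => μ (ns (φ n + N)))
    (hsub.eventually hμ) w (fun k => by
      have := ((hm k).comp hsub).add (hgm k)
      simpa using this) g
  have t2 := tendsto_integral_of_tendsto_moments (μ := fun n => gaussianReal 0 (v (ns (φ n + N))))
    (Eventually.of_forall fun n k => integrable_pow_gaussianReal _ k) w (fun k => by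
      simpa only [integral_pow_gaussianReal] using hgm k) g
  simpa using t1.sub t2

end CharFun

end DetCLT

namespace DetCLT

open Finset.HasAntidiagonal (antidiagonal)

/-! ### The moment–cumulant recursion, centring and scaling -/

section MomentRecursion

open Asymptotics

/-- `y i k` is meant as the `k`-th moment over `k!`. By induction the lower `y` are bounded, so
every term of the recursion except the one with `q i 1` is negligible; replacing `q i 1` by `w i`
leaves the recursion of `gaussMoment`. -/
theorem tendsto_sub_gaussMoment {ι : Type*} {l : Filter ι} {y q : ι → ℕ → ℝ} {w : ι → ℝ} {C : ℝ}
    (hy0 : ∀ᶠ i in l, y i 0 = 1)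
    (hy : ∀ᶠ i in l, ∀ k : ℕ, (k + 1) * y i (k + 1) = ∑ p ∈ antidiagonal k, q i p.1 * y i p.2)
    (hq0 : ∀ᶠ i in l, q i 0 = 0) (hq1 : Tendsto (fun i => q i 1 - w i) l (𝓝 0))
    (hq : ∀ j, 2 ≤ j → Tendsto (fun i => q i j) l (𝓝 0)) (hw : ∀ᶠ i in l, |w i| ≤ C) (k : ℕ) :
    Tendsto (fun i => y i k - gaussMoment (w i) k / k.factorial) l (𝓝 0) := by
  induction k using Nat.strong_induction_on with
  | _ k ih =>
    have hbdd : ∀ m < k, (fun i => y i m) =O[l] (fun _ => (1 : ℝ)) := by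
      intro m hm
      have h1 : (fun i => gaussMoment (w i) m / m.factorial) =O[l] (fun _ => (1 : ℝ)) := by
        obtain ⟨D, hD⟩ := (isCompact_Icc (a := -C) (b := C)).exists_bound_of_continuousOn
          ((continuous_gaussMoment m).div_const (m.factorial : ℝ)).continuousOn
        exact IsBigO.of_bound D (hw.mono fun i hi => by simpa using hD _ (abs_le.1 hi))
      have h2 := ((isLittleO_one_iff ℝ).2 (ih m hm)).isBigO.add h1
      simpa using h2
    match k with
    | 0 =>
      refine Tendsto.congr' ?_ tendsto_const_nhds
      filter_upwards [hy0] with i h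
      simp [h, gaussMoment]
    | 1 =>
      refine Tendsto.congr' ?_ tendsto_const_nhds
      filter_upwards [hy, hq0] with i h h0
      have := h 0
      simp only [Finset.HasAntidiagonal.antidiagonal_zero, Finset.sum_singleton, h0, zero_mul,
        Nat.cast_zero, zero_add, one_mul] at this
      simp [this, gaussMoment]
    | k + 2 =>
      have hr : ∀ j, Tendsto (fun i => q i j - if j = 1 then w i else 0) l (𝓝 0) := by
        intro j
        match j with
        | 0 =>
          refine Tendsto.congr' ?_ tendsto_const_nhds
          filter_upwards [hq0] with i h
          simp [h]
        | 1 => simpa using hq1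
        | j + 2 => simpa using hq (j + 2) (by omega)
      have hsum : Tendsto (fun i => ∑ p ∈ antidiagonal (k + 1),
          (q i p.1 - if p.1 = 1 then w i else 0) * y i p.2) l (𝓝 0) := by
        rw [← Finset.sum_const_zero (s := antidiagonal (k + 1))]
        refine tendsto_finsetSum _ fun p hp => ?_
        rw [Finset.HasAntidiagonal.mem_antidiagonal] at hp
        have := ((isLittleO_one_iff ℝ).2 (hr p.1)).mul_isBigO (hbdd p.2 (by omega))
        simpa [isLittleO_one_iff] using this
      have hprev : Tendsto (fun i => w i * (y i k - gaussMoment (w i) k / k.factorial)) l (𝓝 0) := by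
        have := (IsBigO.of_bound C (hw.mono fun i hi => by simpa using hi) :
          w =O[l] (fun _ => (1 : ℝ))).mul_isLittleO ((isLittleO_one_iff ℝ).2 (ih k (by omega)))
        simpa [isLittleO_one_iff] using this
      have := (hsum.add hprev).const_mul ((k + 2 : ℝ)⁻¹)
      rw [add_zero, mul_zero] at this
      refine this.congr' ?_
      filter_upwards [hy] with i h
      have h1 := h (k + 1)
      have h2 : ∑ p ∈ antidiagonal (k + 1), (if p.1 = 1 then w i else 0) * y i p.2 =
          w i * y i k := by
        rw [Finset.sum_eq_single (1, k)]
        · simp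
        · intro p hp hne
          rw [Finset.HasAntidiagonal.mem_antidiagonal] at hp
          rw [if_neg fun h1 => hne (by ext <;> simp <;> omega), zero_mul]
        · intro hn
          exact absurd (by rw [Finset.HasAntidiagonal.mem_antidiagonal]; omega) hn
      simp only [sub_mul, Finset.sum_sub_distrib]
      rw [h2, ← h1, gaussMoment, Nat.factorial_succ, Nat.factorial_succ]
      have h3 : (k.factorial : ℝ) ≠ 0 := by exact_mod_cast k.factorial_ne_zero
      push_cast
      field_simp
      ring

variable {Ω : Type*} [MeasurableSpace Ω] {P : Measure Ω} {X : Ω → ℝ}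

theorem integrable_sub_div_pow (hX : ∀ k : ℕ, Integrable (fun ω => X ω ^ k) P) (c s : ℝ) (k : ℕ) :
    Integrable (fun ω => ((X ω - c) / s) ^ k) P := by
  simp only [div_pow, sub_eq_add_neg, add_pow]
  exact (integrable_finsetSum _ fun j _ => ((hX j).mul_const _).mul_const _).div_const _

theorem integral_sub_pow_div_factorial (hX : ∀ k : ℕ, Integrable (fun ω => X ω ^ k) P) (c : ℝ)
    (k : ℕ) : (∫ ω, (X ω - c) ^ k ∂P) / k.factorial =
      PowerSeries.coeff k (PowerSeries.rescale (-c) (PowerSeries.exp ℝ) *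
        PowerSeries.mk fun j => (∫ ω, X ω ^ j ∂P) / j.factorial) := by
  rw [mul_comm, PowerSeries.coeff_mul, Finset.Nat.sum_antidiagonal_eq_sum_range_succ_mk]
  simp only [sub_eq_add_neg, add_pow]
  rw [integral_finsetSum _ fun j _ => ((hX j).mul_const _).mul_const _, Finset.sum_div]
  refine Finset.sum_congr rfl fun j hj => ?_
  rw [integral_mul_const, integral_mul_const, PowerSeries.coeff_mk, PowerSeries.coeff_rescale,
    PowerSeries.coeff_exp, Nat.cast_choose ℝ (Finset.mem_range_succ_iff.1 hj)]
  have h1 : (k.factorial : ℝ) ≠ 0 := by exact_mod_cast k.factorial_ne_zero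
  have h2 : (j.factorial : ℝ) ≠ 0 := by exact_mod_cast j.factorial_ne_zero
  have h3 : ((k - j).factorial : ℝ) ≠ 0 := by exact_mod_cast (k - j).factorial_ne_zero
  simp
  field_simp

/-- The sequence `q` consists of the scaled cumulants `κ_{i+1} / i!` of `X`, in the sense that the
moments satisfy the moment-cumulant recursion. -/
structure MomentRecursion (P : Measure Ω) (X : Ω → ℝ) (q : ℕ → ℝ) : Prop where
  integrable : ∀ k : ℕ, Integrable (fun ω => X ω ^ k) P
  recursion : ∀ k : ℕ, (k + 1) * ((∫ ω, X ω ^ (k + 1) ∂P) / (k + 1).factorial) =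
    ∑ p ∈ antidiagonal k, q p.1 * ((∫ ω, X ω ^ p.2 ∂P) / p.2.factorial)

variable [IsProbabilityMeasure P]

theorem MomentRecursion.zero_eq {q : ℕ → ℝ} (h : MomentRecursion P X q) : q 0 = ∫ ω, X ω ∂P := by
  have := h.recursion 0
  simp at this
  exact this.symm

/-- With `A` the exponential generating series of the moments, the recursion is `A' = q A`. Centring
multiplies `A` by `exp(-c t)`, which subtracts `c = q 0` from the constant coefficient of `q`;
scaling divides the coefficient of index `i` by `s ^ (i + 1)`. -/
theorem MomentRecursion.centered {q : ℕ → ℝ} (h : MomentRecursion P X q) {s : ℝ} (hs : s ≠ 0) :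
    MomentRecursion P (fun ω => (X ω - ∫ ω', X ω' ∂P) / s)
      (fun i => if i = 0 then 0 else q i / s ^ (i + 1)) := by
  refine ⟨integrable_sub_div_pow h.integrable _ _, ?_⟩
  set c := ∫ ω', X ω' ∂P with hc
  set E : PowerSeries ℝ := PowerSeries.rescale (-c) (PowerSeries.exp ℝ) with hE
  set A : PowerSeries ℝ := PowerSeries.mk fun j => (∫ ω, X ω ^ j ∂P) / j.factorial with hA
  have hdA : PowerSeries.derivative ℝ A = PowerSeries.mk q * A := by
    ext k
    rw [PowerSeries.coeff_derivative, PowerSeries.coeff_mul, hA, PowerSeries.coeff_mk, mul_comm,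
      h.recursion]
    simp only [PowerSeries.coeff_mk]
  have hdE : PowerSeries.derivative ℝ E = PowerSeries.C (-c) * E := by
    ext k
    rw [PowerSeries.coeff_derivative, PowerSeries.coeff_C_mul, hE, PowerSeries.coeff_rescale,
      PowerSeries.coeff_rescale, PowerSeries.coeff_exp, PowerSeries.coeff_exp,
      Nat.factorial_succ]
    have h2 : (k.factorial : ℝ) ≠ 0 := by exact_mod_cast k.factorial_ne_zero
    simp
    field_simp
    ring
  have hd : PowerSeries.derivative ℝ (E * A) =
      PowerSeries.mk (fun i => if i = 0 then 0 else q i) * (E * A) := by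
    rw [Derivation.leibniz, hdA, hdE]
    have : PowerSeries.mk (fun i => if i = 0 then 0 else q i) =
        PowerSeries.mk q + PowerSeries.C (-c) := by
      ext i
      rw [map_add, PowerSeries.coeff_mk, PowerSeries.coeff_mk, PowerSeries.coeff_C]
      split_ifs with hi
      · rw [hi, h.zero_eq, ← hc]; ring
      · ring
    rw [this]
    simp only [smul_eq_mul]
    ring
  have hmom : ∀ k : ℕ, (∫ ω, ((X ω - c) / s) ^ k ∂P) / k.factorial =
      PowerSeries.coeff k (E * A) / s ^ k := by
    intro k
    rw [← integral_sub_pow_div_factorial h.integrable]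
    simp only [div_pow]
    rw [integral_div]
    ring
  intro k
  have := congrArg (PowerSeries.coeff k) hd
  rw [PowerSeries.coeff_derivative, PowerSeries.coeff_mul k] at this
  rw [hmom, mul_div_assoc', mul_comm _ (PowerSeries.coeff _ _), this, Finset.sum_div]
  refine Finset.sum_congr rfl fun p hp => ?_
  rw [Finset.HasAntidiagonal.mem_antidiagonal] at hp
  rw [hmom, PowerSeries.coeff_mk, ← hp]
  split_ifs with h0
  · simp
  · rw [show p.1 + p.2 + 1 = (p.1 + 1) + p.2 by ring, pow_add _ (p.1 + 1)]
    field_simp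

theorem MomentRecursion.one_eq {q : ℕ → ℝ} (h : MomentRecursion P X q) (hX : AEMeasurable X P) :
    q 1 = Var[X; P] := by
  have h1 := (h.centered one_ne_zero).recursion 1
  rw [variance_eq_integral hX]
  simp only [div_one, Finset.Nat.sum_antidiagonal_succ] at h1
  simp at h1
  linarith

end MomentRecursion

/-! ### The method of moments for the normalised variables -/

section Normality

/-- The method of moments: if the cumulants of order at least three tend to zero, then the centred
and scaled variables are asymptotically normal. -/
theorem asymptotically_normal_of_momentRecursion {ι : Type*} {l : Filter ι}
    [l.IsCountablyGenerated] {Ω : ι → Type*} [∀ i, MeasurableSpace (Ω i)] {P : ∀ i, Measure (Ω i)}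
    [∀ i, IsProbabilityMeasure (P i)] {X : ∀ i, Ω i → ℝ} (hX : ∀ i, Measurable (X i))
    {q : ι → ℕ → ℝ} (hrec : ∀ᶠ i in l, MomentRecursion (P i) (X i) (q i))
    (hq : ∀ j, 2 ≤ j → Tendsto (fun i => q i j) l (𝓝 0)) {s : ι → ℝ} {δ : ℝ} (hδ : 0 < δ)
    (hs : ∀ᶠ i in l, δ ≤ s i) {w : ι → ℝ≥0} {C : ℝ≥0} (hw : ∀ᶠ i in l, w i ≤ C)
    (hvar : Tendsto (fun i => Var[X i; P i] / s i ^ 2 - w i) l (𝓝 0)) :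
    (∀ g : ℝ →ᵇ ℝ, Tendsto (fun i => ∫ ω, g ((X i ω - ∫ ω', X i ω' ∂(P i)) / s i) ∂(P i) -
      ∫ x, g x ∂(gaussianReal 0 (w i))) l (𝓝 0)) ∧
    ∀ k : ℕ, (∀ᶠ i in l,
      Integrable (fun ω => ((X i ω - ∫ ω', X i ω' ∂(P i)) / s i) ^ k) (P i)) ∧
      Tendsto (fun i => ∫ ω, ((X i ω - ∫ ω', X i ω' ∂(P i)) / s i) ^ k ∂(P i) -
        ∫ x, x ^ k ∂(gaussianReal 0 (w i))) l (𝓝 0) := by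
  let Y : ∀ i, Ω i → ℝ := fun i ω => (X i ω - ∫ ω', X i ω' ∂(P i)) / s i
  have hYm : ∀ i, Measurable (Y i) := fun i => ((hX i).sub_const _).div_const _
  have hint : ∀ᶠ i in l, ∀ k : ℕ, Integrable (fun ω => Y i ω ^ k) (P i) :=
    hrec.mono fun i h => integrable_sub_div_pow h.integrable _ _
  have hs0 : ∀ᶠ i in l, s i ≠ 0 := hs.mono fun i h => (hδ.trans_le h).ne'
  have hmom : ∀ k : ℕ, Tendsto (fun i => ∫ ω, Y i ω ^ k ∂(P i) - gaussMoment (w i) k) l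
      (𝓝 0) := by
    intro k
    have key := tendsto_sub_gaussMoment (l := l)
      (y := fun i k => (∫ ω, Y i ω ^ k ∂(P i)) / k.factorial)
      (q := fun i j => if j = 0 then 0 else q i j / s i ^ (j + 1)) (w := fun i => (w i : ℝ))
      (C := C) (Eventually.of_forall fun i => by simp)
      (by
        filter_upwards [hrec, hs0] with i h h0
        exact (h.centered h0).recursion)
      (Eventually.of_forall fun i => by simp)
      (by
        refine hvar.congr' ?_
        filter_upwards [hrec] with i h
        simp [h.one_eq (hX i).aemeasurable])
      (fun j hj => by
        have hj0 : j ≠ 0 := by omega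
        simp only [if_neg hj0]
        have h1 := ((hq j hj).abs).div_const (δ ^ (j + 1))
        rw [abs_zero, zero_div] at h1
        refine squeeze_zero_norm' ?_ h1
        filter_upwards [hs] with i hi
        rw [Real.norm_eq_abs, abs_div, abs_of_nonneg (pow_nonneg (hδ.le.trans hi) _)]
        gcongr)
      (hw.mono fun i hi => by
        rw [abs_of_nonneg (NNReal.coe_nonneg _)]
        exact_mod_cast hi) k
    have h1 := key.mul_const (k.factorial : ℝ)
    rw [zero_mul] at h1
    refine h1.congr fun i => ?_
    have h2 : (k.factorial : ℝ) ≠ 0 := by exact_mod_cast k.factorial_ne_zero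
    field_simp
  refine ⟨fun g => ?_, fun k => ⟨hint.mono fun i h => h k, ?_⟩⟩
  · have : ∀ i, IsProbabilityMeasure ((P i).map (Y i)) := fun i =>
      Measure.isProbabilityMeasure_map (hYm i).aemeasurable
    have hmap : ∀ i, ∀ k : ℕ, ∫ x, x ^ k ∂((P i).map (Y i)) = ∫ ω, Y i ω ^ k ∂(P i) := fun i k =>
      integral_map (hYm i).aemeasurable (by fun_prop)
    have := tendsto_integral_sub_of_tendsto_moments_sub (μ := fun i => (P i).map (Y i))
      (hint.mono fun i h k => (integrable_map_measure (by fun_prop) (hYm i).aemeasurable).2 (h k))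
      hw (fun k => by simpa only [hmap] using hmom k) g
    refine this.congr fun i => ?_
    rw [integral_map (hYm i).aemeasurable g.continuous.aestronglyMeasurable]
  · simpa only [integral_pow_gaussianReal] using hmom k

end Normality

end DetCLT

namespace DetCLT

open Finset.HasAntidiagonal (antidiagonal)
open scoped ComplexConjugate

/-! ### From the asymptotic assumptions to near projections -/

section Kernel

variable {B : Set ℂ}

open scoped Classical in
/-- The kernel `K` on `B × B`, extended by zero. -/
noncomputable def truncKernel (B : Set ℂ) (K : ℂ → ℂ → ℂ) (x y : ℂ) : ℂ :=
  if x ∈ B ∧ y ∈ B then K x y else 0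

theorem truncKernel_of_mem {K : ℂ → ℂ → ℂ} {x y : ℂ} (hx : x ∈ B) (hy : y ∈ B) :
    truncKernel B K x y = K x y := if_pos ⟨hx, hy⟩

theorem truncKernel_of_notMem {K : ℂ → ℂ → ℂ} {x y : ℂ} (h : ¬(x ∈ B ∧ y ∈ B)) :
    truncKernel B K x y = 0 := if_neg h

theorem measurable_truncKernel (hB : MeasurableSet B) {K : ℂ → ℂ → ℂ}
    (hK : Measurable (fun p : B × B => K p.1 p.2)) :
    Measurable (Function.uncurry (truncKernel B K)) := by
  have he : MeasurableEmbedding (Prod.map Subtype.val Subtype.val : B × B → ℂ × ℂ) :=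
    (MeasurableEmbedding.subtype_coe hB).prodMap (MeasurableEmbedding.subtype_coe hB)
  have h := he.measurable_extend hK (measurable_const (a := (0 : ℂ)))
  convert h using 1
  ext ⟨x, y⟩
  by_cases hxy : x ∈ B ∧ y ∈ B
  · have h1 : (x, y) = (Prod.map Subtype.val Subtype.val : B × B → ℂ × ℂ)
        (⟨x, hxy.1⟩, ⟨y, hxy.2⟩) := rfl
    conv_rhs => rw [h1]
    rw [he.injective.extend_apply]
    exact truncKernel_of_mem hxy.1 hxy.2
  · rw [Function.extend_apply' _ _ _ (by
      rintro ⟨⟨a, b⟩, hab⟩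
      rw [Prod.map_apply, Prod.mk.injEq] at hab
      exact hxy ⟨hab.1 ▸ a.2, hab.2 ▸ b.2⟩)]
    exact truncKernel_of_notMem hxy

theorem norm_truncKernel_comm {K : ℂ → ℂ → ℂ}
    (hK : ∀ x ∈ B, ∀ y ∈ B, K x y = star (K y x)) (x y : ℂ) :
    ‖truncKernel B K x y‖ = ‖truncKernel B K y x‖ := by
  by_cases hxy : x ∈ B ∧ y ∈ B
  · rw [truncKernel_of_mem hxy.1 hxy.2, truncKernel_of_mem hxy.2 hxy.1, hK x hxy.1 y hxy.2,
      norm_star]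
  · rw [truncKernel_of_notMem hxy, truncKernel_of_notMem fun h => hxy h.symm]

theorem norm_truncKernel_le {K : ℂ → ℂ → ℂ} {M : ℝ} (hM : 0 ≤ M)
    (hK : ∀ x ∈ B, ∀ y ∈ B, ‖K x y‖ ≤ M) (x y : ℂ) : ‖truncKernel B K x y‖ ≤ M := by
  by_cases hxy : x ∈ B ∧ y ∈ B
  · rw [truncKernel_of_mem hxy.1 hxy.2]
    exact hK x hxy.1 y hxy.2
  · rw [truncKernel_of_notMem hxy, norm_zero]
    exact hM

/-- Weighted `L¹` norms of the rows of a kernel dominated by a translation kernel. -/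
theorem integral_norm_truncKernel_mul_le (hB : IsCompact B) {K : ℂ → ℂ → ℂ}
    {ψ : ℂ → ℝ} (hK : ∀ x ∈ B, ∀ y ∈ B, ‖K x y‖ ≤ ψ (x - y)) {n : ℕ}
    (hψ : Integrable (fun y : ℂ => ‖y‖ ^ n * ψ y)) (x : ℂ) :
    ∫ y in B, ‖truncKernel B K x y‖ * ‖y - x‖ ^ n ≤ ∫ y, ‖(‖y‖ ^ n * ψ y)‖ := by
  have := isFiniteMeasure_restrict_of_isCompact hB
  have h1 : Integrable (fun y => ‖(‖x - y‖ ^ n * ψ (x - y))‖) := (hψ.comp_sub_left x).norm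
  calc ∫ y in B, ‖truncKernel B K x y‖ * ‖y - x‖ ^ n
      ≤ ∫ y in B, ‖(‖x - y‖ ^ n * ψ (x - y))‖ := by
        refine integral_mono_of_nonneg (Eventually.of_forall fun y => by positivity)
          h1.integrableOn (Eventually.of_forall fun y => ?_)
        simp only
        by_cases hxy : x ∈ B ∧ y ∈ B
        · rw [truncKernel_of_mem hxy.1 hxy.2, norm_sub_rev, norm_mul, mul_comm, norm_pow,
            norm_norm]
          exact mul_le_mul_of_nonneg_left ((hK x hxy.1 y hxy.2).trans (le_abs_self _))
            (by positivity)
        · rw [truncKernel_of_notMem hxy, norm_zero, zero_mul]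
          exact norm_nonneg _
    _ ≤ ∫ y, ‖(‖x - y‖ ^ n * ψ (x - y))‖ :=
        setIntegral_le_integral h1 (Eventually.of_forall fun y => norm_nonneg _)
    _ = _ := integral_sub_left_eq_self (fun y => ‖(‖y‖ ^ n * ψ y)‖) volume x

theorem exists_nested (hB : IsCompact B) {S : Set ℂ} (hS : IsCompact S) (hSB : S ⊆ interior B) :
    ∃ S' δ R, IsCompact S' ∧ S' ⊆ interior B ∧ Nested S S' B δ R := by
  obtain ⟨S', hS', hSS', hS'B⟩ := exists_compact_between hS isOpen_interior hSB
  obtain ⟨δ, hδ, hδS⟩ := hS.exists_cthickening_subset_open isOpen_interior hSS'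
  obtain ⟨R, hR⟩ := hB.isBounded.exists_norm_le
  refine ⟨S', δ, R, hS', hS'B, hB, hSS'.trans interior_subset, hS'B.trans interior_subset, hδ,
    fun b hb y _ hyS => ?_, hR⟩
  by_contra hlt
  refine hyS (interior_subset (hδS (Metric.thickening_subset_cthickening _ _ ?_)))
  rw [Metric.mem_thickening_iff]
  exact ⟨b, hb, by rw [dist_eq_norm]; exact not_le.1 hlt⟩

variable {R : Set ℝ} {K : R → ℂ → ℂ → ℂ} {φ : R → ℂ → ℝ}

theorem eventually_toInfty_pos (R : Set ℝ) : ∀ᶠ ρ : R in toInfty R, 0 < (ρ : ℝ) :=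
  tendsto_comap.eventually (eventually_gt_atTop 0)

theorem eventually_bddMeas_truncKernel (hB : IsCompact B) (hK : IsHermitianKernelFamily B K)
    (hUB : UB B K) :
    ∀ᶠ ρ in toInfty R, BddMeas (Function.uncurry (truncKernel B (K ρ))) := by
  obtain ⟨c, hc⟩ := hUB
  filter_upwards [hc] with ρ h
  refine ⟨measurable_truncKernel hB.measurableSet (hK.2 ρ), |c * ρ|, fun p => ?_⟩
  exact norm_truncKernel_le (abs_nonneg _) (fun x hx y hy => (h x hx y hy).trans (le_abs_self _))
    p.1 p.2

/-- `M` is of order `ρ` by (UB), so (ID) bounds the quantity in `cubic` by `O(ρ) · o(1/ρ)`. The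
constant `c` does not depend on `S'` or `ε`, so the constants derived from it stay fixed when `ε` is
made small. -/
theorem exists_eventually_nearProjection (hB : IsCompact B) (hK : IsHermitianKernelFamily B K)
    (hUB : UB B K) (hL1B : L1B B K φ) (hID : ID φ) (hLLAP : LLAP B K) :
    ∃ c : ℝ, ∀ S' : Set ℂ, IsCompact S' → S' ⊆ interior B → ∀ ε > 0,
      ∀ᶠ ρ in toInfty R, ∃ M, NearProjection B S' c (truncKernel B (K ρ)) M ε := by
  obtain ⟨a, ha⟩ := hUB
  obtain ⟨c, hc⟩ := hL1B
  refine ⟨c, fun S' hS' hS'B ε hε => ?_⟩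
  have hL : ∀ᶠ ρ in toInfty R, ∀ p ∈ Finset.range 3, ∀ x ∈ S', ∀ z ∈ S',
      ‖x ^ p * K ρ x z - ∫ y in B, K ρ x y * y ^ p * K ρ y z‖ ≤ ε ∧
      ‖K ρ x z * (star z) ^ p - ∫ y in B, K ρ x y * (star y) ^ p * K ρ y z‖ ≤ ε :=
    (Filter.eventually_all_finset _).2 fun p hp =>
      hLLAP S' hS' hS'B p (by rw [Finset.mem_range] at hp; omega) ε hε
  -- The factor `|a|` of `M` is to be absorbed; adding one avoids division by zero.
  have hI := hID.2.bound (show 0 < ε / (|a| + 1) by positivity)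
  filter_upwards [ha, hc, hL, hI, hID.1, eventually_toInfty_pos R] with ρ ha hc hL hI hI' hρ
  have hMK : ∀ x y, ‖truncKernel B (K ρ) x y‖ ≤ |a| * ρ := norm_truncKernel_le (by positivity)
    fun x hx y hy => (ha x hx y hy).trans (mul_le_mul_of_nonneg_right (le_abs_self a) hρ.le)
  have hm := measurable_truncKernel hB.measurableSet (hK.2 ρ)
  have hrow : ∀ x, ∫ y in B, ‖truncKernel B (K ρ) x y‖ ≤ c := by
    intro x
    have := integral_norm_truncKernel_mul_le hB hc.1 (n := 0) (by simpa using hc.2.1) x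
    simp only [pow_zero, mul_one, one_mul] at this
    exact this.trans hc.2.2
  have hS'B' : S' ⊆ B := hS'B.trans interior_subset
  have hint : ∀ (q : ℂ → ℂ), ∀ x ∈ S', ∀ z ∈ S',
      ∫ y in B, truncKernel B (K ρ) x y * q y * truncKernel B (K ρ) y z =
        ∫ y in B, K ρ x y * q y * K ρ y z := fun q x hx z hz =>
    setIntegral_congr_fun hB.measurableSet fun y hy => by
      simp only [truncKernel_of_mem (hS'B' hx) hy, truncKernel_of_mem hy (hS'B' hz)]
  refine ⟨|a| * ρ, ⟨hm, _, fun p => hMK p.1 p.2⟩, hMK, hrow, fun y => ?_, fun x hx => ?_,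
    fun p hp x hx z hz => ?_, fun p hp x hx z hz => ?_⟩
  · simp_rw [fun x => norm_truncKernel_comm (hK.1 ρ) x y]
    exact hrow y
  · have h1 := integral_norm_truncKernel_mul_le hB hc.1 (n := 3) hI' x
    rw [Real.norm_of_nonneg (integral_nonneg fun _ => norm_nonneg _), norm_inv,
      Real.norm_of_nonneg hρ.le] at hI
    calc |a| * ρ * ∫ y in B, ‖truncKernel B (K ρ) x y‖ * ‖y - x‖ ^ 3
        ≤ |a| * ρ * (ε / (|a| + 1) * (ρ : ℝ)⁻¹) :=
          mul_le_mul_of_nonneg_left (h1.trans hI) (by positivity)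
      _ = ε * (|a| / (|a| + 1)) := by field_simp
      _ ≤ ε * 1 := by
          refine mul_le_mul_of_nonneg_left ?_ hε.le
          rw [div_le_one (by positivity)]
          linarith
      _ = ε := mul_one ε
  · rw [hint (fun y => y ^ p) x hx z hz, truncKernel_of_mem (hS'B' hx) (hS'B' hz)]
    exact (hL p (by rw [Finset.mem_range]; omega) x hx z hz).1
  · rw [hint (fun y => conj y ^ p) x hx z hz, truncKernel_of_mem (hS'B' hx) (hS'B' hz)]
    exact (hL p (by rw [Finset.mem_range]; omega) x hx z hz).2

end Kernel

/-! ### Moments and cumulants of linear statistics -/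

section LinearStatistics

variable {Ω : Type*} [MeasurableSpace Ω] {B : Set ℂ} {K : ℂ → ℂ → ℂ} {P : Measure Ω}
  {Z : Ω → Finset ℂ}

theorem measurable_linStat (h : IsDeterminantal B K P Z) (hB : MeasurableSet B) {f : ℂ → ℝ}
    (hf : Continuous f) : Measurable (linStat Z f) := by
  have := Complex.measurable_re.comp
    (measurable_sum_points h hB (g := fun z => (f z : ℂ)) (by fun_prop))
  convert this using 1
  ext ω
  simp [linStat]

theorem momentRecursion_linStat (h : IsDeterminantal B K P Z) (hB : IsCompact B)
    (hK : BddMeas (Function.uncurry K)) {f : ℂ → ℝ} (hf : Continuous f)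
    (hfb : ∃ C, ∀ z, ‖(f z : ℂ)‖ ≤ C) :
    MomentRecursion P (linStat Z f) fun i =>
      (cumulantCoeff (volume.restrict B) K (fun z => (f z : ℂ)) i).re := by
  have := isFiniteMeasure_restrict_of_isCompact hB
  have hfc : Continuous (fun z => (f z : ℂ)) := by fun_prop
  have hm := fun k => moment_sum_points h hB hK hfc hfb k
  have hcast : ∀ k ω, (∑ z ∈ Z ω, (f z : ℂ)) ^ k = ((linStat Z f ω ^ k : ℝ) : ℂ) := by
    intro k ω
    simp [linStat]
  simp only [hcast] at hm
  have hm' : ∀ k : ℕ, momentCoeff (volume.restrict B) K (fun z => (f z : ℂ)) k =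
      (((∫ ω, linStat Z f ω ^ k ∂P) / k.factorial : ℝ) : ℂ) := by
    intro k
    rw [← (hm k).2, integral_complex_ofReal]
    push_cast
    rfl
  refine ⟨fun k => by simpa only [RCLike.re_eq_complex_re, Complex.ofReal_re] using (hm k).1.re,
    fun k => ?_⟩
  have h1 := congrArg Complex.re (momentCoeff_succ hK ⟨hfc.measurable, hfb⟩ k
    (μ := volume.restrict B))
  rw [Complex.re_sum] at h1
  simp only [hm', Complex.re_mul_ofReal] at h1
  rw [← h1, ← Complex.ofReal_natCast, ← Complex.ofReal_one, ← Complex.ofReal_add,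
    Complex.ofReal_re]

/-- Each factor is at most a constant times the number of points, all of whose powers are
integrable. -/
theorem integrable_prod_linStat (h : IsDeterminantal B K P Z) (hB : IsCompact B)
    (hK : BddMeas (Function.uncurry K)) {ι : Type*} (S : Finset ι) {f : ι → ℂ → ℝ}
    (hf : ∀ i, Continuous (f i)) (hfb : ∀ i, ∃ C, ∀ z, |f i z| ≤ C) :
    Integrable (fun ω => ∏ i ∈ S, linStat Z (f i) ω) P := by
  choose C hC using hfb
  have h1 := ((momentRecursion_linStat h hB hK (f := fun _ => 1) continuous_const
    ⟨1, by simp⟩).integrable S.card).const_mul (∏ i ∈ S, C i)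
  refine h1.mono' (Finset.measurable_prod _ fun i _ =>
    measurable_linStat h hB.measurableSet (hf i)).aestronglyMeasurable
    (Eventually.of_forall fun ω => ?_)
  rw [norm_prod, ← Finset.prod_const, ← Finset.prod_mul_distrib]
  refine Finset.prod_le_prod (fun i _ => norm_nonneg _) fun i _ => ?_
  rw [linStat, linStat, Finset.mul_sum]
  refine (norm_sum_le _ _).trans (Finset.sum_le_sum fun z _ => ?_)
  rw [mul_one]
  exact hC i z

theorem linStat_sum {Ω : Type*} {Z : Ω → Finset ℂ} {ι : Type*} (s : Finset ι) (c : ι → ℝ) (f : ι → ℂ → ℝ) (ω : Ω) :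
    linStat Z (fun z => ∑ j ∈ s, c j * f j z) ω = ∑ j ∈ s, c j * linStat Z (f j) ω := by
  simp only [linStat, Finset.mul_sum]
  exact Finset.sum_comm

theorem MomentRecursion.jointCumulant_eq [IsProbabilityMeasure P] {X : Ω → ℝ} {q : ℕ → ℝ} (h : MomentRecursion P X q)
    (k : ℕ) : jointCumulant P (fun _ : Fin (k + 1) => X) = k.factorial * q k := by
  -- The cumulant of order `j` is `(j - 1)! q (j - 1)`. The spurious value at `j = 0` plays no role,
  -- as the index set is nonempty.
  rw [jointCumulant_eq_setCumulant, setCumulant_eq_of_card _ (fun k => ∫ ω, X ω ^ k ∂P)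
    (fun k => (k - 1).factorial * q (k - 1)) (fun S => by simp) (by simp) _ _
    Finset.univ_nonempty]
  · simp
  · intro k
    have h1 := h.recursion k
    have h2 : (k.factorial : ℝ) ≠ 0 := by exact_mod_cast k.factorial_ne_zero
    have h3 : ∫ ω, X ω ^ (k + 1) ∂P = k.factorial *
        ((k + 1) * ((∫ ω, X ω ^ (k + 1) ∂P) / (k + 1).factorial)) := by
      rw [Nat.factorial_succ]
      push_cast
      field_simp
    rw [h3, h1, Finset.Nat.sum_antidiagonal_eq_sum_range_succ_mk, Finset.mul_sum]
    refine Finset.sum_congr rfl fun i hi => ?_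
    rw [Nat.cast_choose ℝ (Finset.mem_range_succ_iff.1 hi)]
    have h4 : (i.factorial : ℝ) ≠ 0 := by exact_mod_cast i.factorial_ne_zero
    have h5 : ((k - i).factorial : ℝ) ≠ 0 := by exact_mod_cast (k - i).factorial_ne_zero
    simp only [add_tsub_cancel_right]
    field_simp

end LinearStatistics

section TestFunctions

variable {B : Set ℂ}

theorem IsTestFunction.exists_abs_le {f : ℂ → ℝ} (hf : IsTestFunction B f) :
    ∃ C, ∀ z, |f z| ≤ C :=
  hf.1.continuous.bounded_above_of_compact_support hf.2.1

theorem IsTestFunction.sum {ι : Type*} (s : Finset ι) (c : ι → ℝ) {f : ι → ℂ → ℝ}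
    (hf : ∀ j, IsTestFunction B (f j)) : IsTestFunction B (fun z => ∑ j ∈ s, c j * f j z) := by
  have hsub : tsupport (fun z => ∑ j ∈ s, c j * f j z) ⊆ ⋃ j ∈ s, tsupport (f j) := by
    refine closure_minimal (fun z hz => ?_) (s.finite_toSet.isClosed_biUnion fun j _ =>
      isClosed_tsupport _)
    obtain ⟨j, hj, hne⟩ := Finset.exists_ne_zero_of_sum_ne_zero hz
    exact Set.mem_biUnion hj (subset_tsupport _ (right_ne_zero_of_mul hne))
  have hc : IsCompact (⋃ j ∈ s, tsupport (f j)) :=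
    s.isCompact_biUnion fun j _ => (hf j).2.1
  exact ⟨ContDiff.sum fun j _ => contDiff_const.mul (hf j).1,
    hc.of_isClosed_subset (isClosed_tsupport _) hsub,
    hsub.trans (Set.iUnion₂_subset fun j _ => (hf j).2.2)⟩

end TestFunctions

/-! ### Limits along the family of processes -/

section Family

variable {B : Set ℂ} {R : Set ℝ} {K : R → ℂ → ℂ → ℂ} {φ : R → ℂ → ℝ}

instance (R : Set ℝ) : (toInfty R).IsCountablyGenerated := by
  unfold toInfty
  infer_instance

/-- The scaled cumulants `κ_{i+1} / i!` of the linear statistic of `f`. -/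
noncomputable def scaledCumulant (B : Set ℂ) (K : R → ℂ → ℂ → ℂ) (f : ℂ → ℝ) (ρ : R) (i : ℕ) : ℝ :=
  (cumulantCoeff (volume.restrict B) (truncKernel B (K ρ)) (fun z => (f z : ℂ)) i).re

theorem tendsto_scaledCumulant (hB : IsCompact B) (hK : IsHermitianKernelFamily B K)
    (hUB : UB B K) (hL1B : L1B B K φ) (hID : ID φ) (hLLAP : LLAP B K) {f : ℂ → ℝ}
    (hf : IsTestFunction B f) {i : ℕ} (hi : 2 ≤ i) :
    Tendsto (fun ρ => scaledCumulant B K f ρ i) (toInfty R) (𝓝 0) := by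
  obtain ⟨c, hc⟩ := exists_eventually_nearProjection hB hK hUB hL1B hID hLLAP
  obtain ⟨S', δ, D, hS', hS'B, hnest⟩ := exists_nested hB hf.2.1.isCompact hf.2.2
  obtain ⟨C, hC⟩ := hf.exists_abs_le
  have hfc : Continuous (fun z => (f z : ℂ)) := by
    have := hf.1.continuous
    fun_prop
  obtain ⟨A, hA⟩ := exists_norm_cumulantCoeff_le (c := c) hnest
    (f := fun z => (f z : ℂ)) ⟨hfc.measurable, C, fun z => by simpa using hC z⟩
    (fun y hy => by simp [image_eq_zero_of_notMem_tsupport hy])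
    (hasJet_taylorJet hf.1 hf.2.1 hf.2.1.isCompact) (fun b _ => by simp [taylorJet]) hi
  rw [Metric.tendsto_nhds]
  intro η hη
  filter_upwards [hc S' hS' hS'B (η / (|A| + 1)) (by positivity)] with ρ ⟨M, hM⟩
  rw [dist_zero_right, Real.norm_eq_abs]
  have h1 := hA _ M _ hM (by positivity)
  calc |scaledCumulant B K f ρ i| ≤ A * (η / (|A| + 1)) := (Complex.abs_re_le_norm _).trans h1
    _ ≤ |A| * (η / (|A| + 1)) := mul_le_mul_of_nonneg_right (le_abs_self A) (by positivity)
    _ < (|A| + 1) * (η / (|A| + 1)) := mul_lt_mul_of_pos_right (by linarith) (by positivity)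
    _ = η := by field_simp

variable {Ω : R → Type*} [∀ ρ, MeasurableSpace (Ω ρ)] {P : ∀ ρ, Measure (Ω ρ)}
  {Z : ∀ ρ, Ω ρ → Finset ℂ}

theorem eventually_momentRecursion (hB : IsCompact B) (hK : IsHermitianKernelFamily B K)
    (hUB : UB B K) (hZ : ∀ ρ, IsDeterminantal B (K ρ) (P ρ) (Z ρ)) {f : ℂ → ℝ}
    (hf : IsTestFunction B f) :
    ∀ᶠ ρ in toInfty R, MomentRecursion (P ρ) (linStat (Z ρ) f) (scaledCumulant B K f ρ) := by
  obtain ⟨C, hC⟩ := hf.exists_abs_le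
  filter_upwards [eventually_bddMeas_truncKernel hB hK hUB] with ρ h
  exact momentRecursion_linStat ((hZ ρ).congr fun x hx y hy => (truncKernel_of_mem hx hy).symm) hB
    h hf.1.continuous ⟨C, fun z => by simpa using hC z⟩

theorem eventually_integrable_prod_linStat (hB : IsCompact B) (hK : IsHermitianKernelFamily B K)
    (hUB : UB B K) (hZ : ∀ ρ, IsDeterminantal B (K ρ) (P ρ) (Z ρ)) {k : ℕ} {f : Fin k → ℂ → ℝ}
    (hf : ∀ j, IsTestFunction B (f j)) :
    ∀ᶠ ρ in toInfty R, ∀ (c : Fin k → Fin k → ℝ) (S : Finset (Fin k)),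
      Integrable (fun ω => ∏ i ∈ S, ∑ j, c i j * linStat (Z ρ) (f j) ω) (P ρ) := by
  filter_upwards [eventually_bddMeas_truncKernel hB hK hUB] with ρ h c S
  have hf' := fun i => IsTestFunction.sum Finset.univ (c i) hf
  simp only [← linStat_sum]
  exact integrable_prod_linStat
    ((hZ ρ).congr fun x hx y hy => (truncKernel_of_mem hx hy).symm) hB h S
    (fun i => (hf' i).1.continuous) fun i => (hf' i).exists_abs_le

variable [∀ ρ, IsProbabilityMeasure (P ρ)]

/-- Polarization leaves cumulants of single statistics of the sums of `f j` over `j ∈ s`, and such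
sums are again test functions. -/
theorem tendsto_jointCumulant (hB : IsCompact B) (hK : IsHermitianKernelFamily B K)
    (hUB : UB B K) (hL1B : L1B B K φ) (hID : ID φ) (hLLAP : LLAP B K)
    (hZ : ∀ ρ, IsDeterminantal B (K ρ) (P ρ) (Z ρ)) {k : ℕ} (hk : 3 ≤ k) {f : Fin k → ℂ → ℝ}
    (hf : ∀ j, IsTestFunction B (f j)) :
    Tendsto (fun ρ => jointCumulant (P ρ) (fun j => linStat (Z ρ) (f j))) (toInfty R) (𝓝 0) := by
  obtain ⟨k, rfl⟩ : ∃ m, k = m + 1 := ⟨k - 1, by omega⟩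
  have hf' := fun s : Finset (Fin (k + 1)) => IsTestFunction.sum s (fun _ => 1) hf
  have hone : ∀ s : Finset (Fin (k + 1)), Tendsto (fun ρ => jointCumulant (P ρ)
      (fun (_ : Fin (k + 1)) ω => ∑ j ∈ s, linStat (Z ρ) (f j) ω)) (toInfty R) (𝓝 0) := by
    intro s
    have h1 := (tendsto_scaledCumulant hB hK hUB hL1B hID hLLAP (hf' s)
      (show 2 ≤ k by omega)).const_mul (k.factorial : ℝ)
    rw [mul_zero] at h1
    refine h1.congr' ?_
    filter_upwards [eventually_momentRecursion hB hK hUB hZ (hf' s)] with ρ h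
    rw [← h.jointCumulant_eq k]
    congr 1
    ext _ ω
    rw [linStat_sum]
    simp
  have hsum : Tendsto (fun ρ => ((k + 1).factorial : ℝ)⁻¹ * ∑ s : Finset (Fin (k + 1)),
      (-1 : ℝ) ^ sᶜ.card * jointCumulant (P ρ)
        (fun (_ : Fin (k + 1)) ω => ∑ j ∈ s, linStat (Z ρ) (f j) ω)) (toInfty R) (𝓝 0) := by
    have := (tendsto_finsetSum Finset.univ fun (s : Finset (Fin (k + 1))) _ =>
      (hone s).const_mul ((-1 : ℝ) ^ sᶜ.card)).const_mul (((k + 1).factorial : ℝ)⁻¹)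
    simpa using this
  refine hsum.congr' ?_
  filter_upwards [eventually_integrable_prod_linStat hB hK hUB hZ hf] with ρ h
  rw [← jointCumulant_polarization (P ρ) (fun j => linStat (Z ρ) (f j)) h]
  have : ((k + 1).factorial : ℝ) ≠ 0 := by exact_mod_cast (k + 1).factorial_ne_zero
  field_simp

theorem tendsToNormalWithMoments_of_tendsto {Y : ∀ ρ, Ω ρ → ℝ} (hY : ∀ ρ, Measurable (Y ρ))
    {v : ℝ≥0} (h : IsAsymptoticToNormals P Y fun _ => v) : TendsToNormalWithMoments P Y v := by
  refine ⟨⟨fun ρ => (hY ρ).aemeasurable, aemeasurable_id, ?_⟩,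
    fun k => ⟨(h.2 k).1, by simpa using (h.2 k).2.add_const (∫ x, x ^ k ∂(gaussianReal 0 v))⟩⟩
  refine ProbabilityMeasure.tendsto_iff_forall_integral_tendsto.2 fun g => ?_
  have h1 := (h.1 g).add_const (∫ x, g x ∂(gaussianReal 0 v))
  simp only [sub_add_cancel, zero_add] at h1
  have h2 : ∫ x, g x ∂((gaussianReal 0 v).map id) = ∫ x, g x ∂(gaussianReal 0 v) := by
    rw [Measure.map_id]
  refine (h2 ▸ h1).congr fun ρ => ?_
  exact (integral_map (hY ρ).aemeasurable g.continuous.aestronglyMeasurable).symm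

end Family

end DetCLT

/-! ### Assembly of the theorem -/

theorem mainTheorem2
    (B : Set ℂ) (hB : IsCompact B)
    (R : Set ℝ) (hRpos : R ⊆ Set.Ioi 0) (hRunb : ¬ BddAbove R)
    (K : R → ℂ → ℂ → ℂ) (hK : DetCLT.IsHermitianKernelFamily B K)
    (φ : R → ℂ → ℝ)
    (hUB : DetCLT.UB B K) (hL1B : DetCLT.L1B B K φ) (hID : DetCLT.ID φ) (hLLAP : DetCLT.LLAP B K)
    (Ω : R → Type*) [∀ ρ, MeasurableSpace (Ω ρ)]
    (P : ∀ ρ, Measure (Ω ρ)) [∀ ρ, IsProbabilityMeasure (P ρ)]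
    (Z : ∀ ρ, Ω ρ → Finset ℂ)
    (hZ : ∀ ρ, DetCLT.IsDeterminantal B (K ρ) (P ρ) (Z ρ))
    (hCO : DetCLT.CO B P Z) :
    -- all joint cumulants of order at least three vanish asymptotically
    (∀ (k : ℕ), 3 ≤ k → ∀ f : Fin k → ℂ → ℝ, (∀ j, DetCLT.IsTestFunction B (f j)) →
      (∀ᶠ ρ in DetCLT.toInfty R, ∀ S : Finset (Fin k),
        Integrable (fun ω => ∏ j ∈ S, DetCLT.linStat (Z ρ) (f j) ω) (P ρ)) ∧
      Tendsto (fun ρ => DetCLT.jointCumulant (P ρ) (fun j => DetCLT.linStat (Z ρ) (f j)))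
        (DetCLT.toInfty R) (𝓝 0)) ∧
    ∀ f : ℂ → ℝ, DetCLT.IsTestFunction B f →
      -- the centred statistic is asymptotically normal with its own variance, at scale
      -- `max 1 (standard deviation)`
      DetCLT.IsAsymptoticToNormals P
        (fun ρ ω => (DetCLT.linStat (Z ρ) f ω - ∫ ω', DetCLT.linStat (Z ρ) f ω' ∂(P ρ)) /
          max 1 (√(Var[DetCLT.linStat (Z ρ) f; P ρ])))
        (fun ρ => (Var[DetCLT.linStat (Z ρ) f; P ρ] /
          (max 1 (√(Var[DetCLT.linStat (Z ρ) f; P ρ]))) ^ 2).toNNReal) ∧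
      -- if the variance stays away from zero, the standardised statistic tends to `N(0, 1)`
      ((∃ δ : ℝ, 0 < δ ∧ ∀ᶠ ρ in DetCLT.toInfty R, δ ≤ Var[DetCLT.linStat (Z ρ) f; P ρ]) →
        DetCLT.TendsToNormalWithMoments P
          (fun ρ ω => (DetCLT.linStat (Z ρ) f ω - ∫ ω', DetCLT.linStat (Z ρ) f ω' ∂(P ρ)) /
            √(Var[DetCLT.linStat (Z ρ) f; P ρ])) 1) ∧
      -- if the variance tends to `v`, the centred statistic tends to `N(0, v)`
      (∀ v : ℝ≥0, Tendsto (fun ρ => Var[DetCLT.linStat (Z ρ) f; P ρ])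
          (DetCLT.toInfty R) (𝓝 (v : ℝ)) →
        DetCLT.TendsToNormalWithMoments P
          (fun ρ ω => DetCLT.linStat (Z ρ) f ω - ∫ ω', DetCLT.linStat (Z ρ) f ω' ∂(P ρ)) v) := by
  refine ⟨fun k hk f hf => ⟨?_, DetCLT.tendsto_jointCumulant hB hK hUB hL1B hID hLLAP hZ hk hf⟩,
    fun f hf => ?_⟩
  · filter_upwards [DetCLT.eventually_bddMeas_truncKernel hB hK hUB] with ρ h S
    exact DetCLT.integrable_prod_linStat
      ((hZ ρ).congr fun x hx y hy => (DetCLT.truncKernel_of_mem hx hy).symm) hB h S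
      (fun i => (hf i).1.continuous) fun i => (hf i).exists_abs_le
  have hX : ∀ ρ, Measurable (DetCLT.linStat (Z ρ) f) := fun ρ =>
    DetCLT.measurable_linStat (hZ ρ) hB.measurableSet hf.1.continuous
  have hrec := DetCLT.eventually_momentRecursion hB hK hUB hZ hf
  have hq := fun j hj => DetCLT.tendsto_scaledCumulant hB hK hUB hL1B hID hLLAP hf (i := j) hj
  -- Both limit theorems are one statement at two scales: the standard deviation with limiting
  -- variance one, and the constant one with limiting variance `v`.
  have hlimit : ∀ (s : R → ℝ) (v : ℝ≥0) (δ : ℝ), 0 < δ → (∀ᶠ ρ in DetCLT.toInfty R, δ ≤ s ρ) →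
      Tendsto (fun ρ => Var[DetCLT.linStat (Z ρ) f; P ρ] / s ρ ^ 2) (DetCLT.toInfty R) (𝓝 v) →
      DetCLT.TendsToNormalWithMoments P (fun ρ ω => (DetCLT.linStat (Z ρ) f ω -
        ∫ ω', DetCLT.linStat (Z ρ) f ω' ∂(P ρ)) / s ρ) v := by
    intro s v δ hδ hs hv
    exact DetCLT.tendsToNormalWithMoments_of_tendsto
      (fun ρ => ((hX ρ).sub_const _).div_const _)
      (DetCLT.asymptotically_normal_of_momentRecursion hX hrec hq hδ hs (w := fun _ => v)
        (C := v) (Eventually.of_forall fun _ => le_rfl) (by simpa using hv.sub_const (v : ℝ)))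
  refine ⟨?_, fun ⟨δ, hδ, hvar⟩ => ?_, fun v hv => ?_⟩
  -- The scale is at least one and the normalised variance at most one, whence the constants. The
  -- comparison law has exactly the variance of the scaled statistic, so the variance difference is
  -- identically zero.
  · refine DetCLT.asymptotically_normal_of_momentRecursion hX hrec hq one_pos
      (Eventually.of_forall fun ρ => le_max_left _ _) (C := 1) (Eventually.of_forall fun ρ => ?_)
      (tendsto_const_nhds.congr fun ρ => ?_)
    · rw [Real.toNNReal_le_one]
      refine div_le_one_of_le₀ ?_ (sq_nonneg _)
      calc Var[DetCLT.linStat (Z ρ) f; P ρ] = √(Var[DetCLT.linStat (Z ρ) f; P ρ]) ^ 2 :=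
            (Real.sq_sqrt (variance_nonneg _ _)).symm
        _ ≤ _ := pow_le_pow_left₀ (Real.sqrt_nonneg _) (le_max_right _ _) 2
    · rw [Real.coe_toNNReal _ (div_nonneg (variance_nonneg _ _) (sq_nonneg _)), sub_self]
  · refine hlimit _ 1 (√δ) (Real.sqrt_pos.2 hδ) (hvar.mono fun ρ h => Real.sqrt_le_sqrt h)
      (tendsto_const_nhds.congr' ?_)
    filter_upwards [hvar] with ρ h
    rw [Real.sq_sqrt (variance_nonneg _ _), div_self (hδ.trans_le h).ne', NNReal.coe_one]
  · simpa using hlimit (fun _ => 1) v 1 one_pos (Eventually.of_forall fun _ => le_rfl)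
      (by simpa using hv)
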